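/- **Setting.** Let $\mathcal H\neq 0$ and $\mathcal K\ne 0$ be complex Hilbert spaces, $\mathcal K$ separable, $\mathbb V$ a right $\mathcal L(\mathcal H)$-module, $G$ a group, and $U:G\to \mathrm{GL}_{\mathcal L(\mathcal H)}(\mathbb V)$ a representation. Let $g\mapsto u_g$ be unitary operators on $\mathcal K$ with $u_e=I$ and $u_{gh}=m(g,h)u_gu_h$, $m(g,h)\in\mathbb T$. Let $(\Omega,\Sigma,\nu)$ be a $\sigma$-finite measure space on which $G$ acts by measurable maps so that $\nu(X)=0$ implies $\nu(gX)=0$ for all $g\in G$; write $(\gamma_gf)(\omega)=f(g^{-1}\omega)$ for $f\in L^\infty(\nu)$ and $\rho_g=d\nu_g/d\nu$, where $\nu_g(X)=\nu(gX)$. Let $S$ be a normal completely positive map from the von Neumann algebra $\mathcal L(\mathcal K)\otimes L^\infty(\nu)$ to the $\mathcal L(\mathcal H)$-valued $\mathcal L(\mathcal H)$-sesquilinear forms on $\mathbb V$, that is, $S$ is linear, $\sum_{j,k}S_{d_j^*d_k}(v_j,v_k)\ge 0$ for all finite families, and $d\mapsto S_d(v,v)$ is normal for every $v$. Let $S_1=s_1$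 and let $S$ be covariant: $S_{u_gbu_g^*\otimes\gamma_gf}(v,w)=S_{b\otimes f}(U(g^{-1})v,U(g^{-1})w)$. A *minimal Naimark dilation* of $S$ is a Hilbert space $\mathcal H_0$ with a spectral measure $\mathsf F:\Sigma\to\mathcal L(\mathcal H_0)$ and an $\mathcal L(\mathcal H)$-linear map $Y_0:\mathbb V\to\mathcal L(\mathcal H;\mathcal K\otimes\mathcal H_0)$ such that $S_{b\otimes\chi_X}(v,w)=(Y_0v)^*(b\otimes \mathsf F(X))(Y_0w)$ and the operators $(b\otimes\mathsf F(X))(Y_0v)$ span a $\sigma$-strongly dense subspace of $\mathcal L(\mathcal H;\mathcal K\otimes\mathcal H_0)$; it is unique up to unitary equivalence. Assume that $\mathcal H_0$ is separable. For $k\in\{0,1,2,\dots,\infty\}$ let $\mathcal H_k$ be the $k$-dimensional separable Hilbert space (realised as the span of the first $k$ basis vectors of $\ell^2(\mathbb N)$), and for a $\nu$-measurable $n:\Omega\to\{0,1,2,\dots,\infty\}$ let $\int^\oplus_\Omega\mathcal H_{n(\omega)}\,d\nu(\omega)$ be the direct integral, on which $f\in L^\infty(\nu)$ acts diagonally. **(a)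 Dilation of $S$.** There are a direct integral $\mathcal H_\oplus=\int_\Omega^\oplus\mathcal H_{n(\omega)}d\nu(\omega)$ with, for every $g\in G$, $n(g\omega)=n(\omega)$ for $\nu$-a.a. $\omega$; an $\mathcal L(\mathcal H)$-linear map $Y:\mathbb V\to\mathcal L(\mathcal H;\mathcal K\otimes\mathcal H_\oplus)$ with $S_{b\otimes f}(v,w)=(Yv)^*(b\otimes\hat f)(Yw)$, such that the operators $(b\otimes\hat f)(Yv)$ span a $\sigma$-strongly dense subspace of $\mathcal L(\mathcal H;\mathcal K\otimes\mathcal H_\oplus)$; and, for every $g$, a weakly $\nu$-measurable field of unitaries $y(g,\omega)\in\mathcal U(\mathcal H_{n(\omega)})$ such that $(y_g\psi)(\omega)=y(g,\omega)\psi(g^{-1}\omega)\sqrt{\rho_{g^{-1}}(\omega)}$ (a.e.) defines a unitary operator $y_g$ on $\mathcal H_\oplus$, $YU(g)=(u_g\otimes y_g)Y$, $g\mapsto u_g\otimes y_g$ is multiplicative, and, for all $g,h\in G$ and $\nu$-a.a. $\omega$, $y(gh,\omega)=\overline{m(g,h)}\,y(g,\omega)y(h,g^{-1}\omega)$. **(b)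 Dilation of the second marginal.** There are a direct integral $\mathcal H^0_\oplus=\int^\oplus_\Omega\mathcal H_{n^0(\omega)}d\nu(\omega)$ with, for every $g$, $n^0(g\omega)=n^0(\omega)$ for $\nu$-a.a. $\omega$; an $\mathcal L(\mathcal H)$-linear map $K:\mathbb V\to\mathcal L(\mathcal H;\mathcal H_\oplus^0)$ such that $S^2_f(v,w):=S_{I\otimes f}(v,w)=(Kv)^*\hat f^0(Kw)$, where $\hat f^0$ is the diagonal operator of $f$ on $\mathcal H^0_\oplus$, and such that the operators $\hat f^0(Kv)$ span a $\sigma$-strongly dense subspace of $\mathcal L(\mathcal H;\mathcal H^0_\oplus)$; and a unitary representation $g\mapsto y^0_g$ of $G$ on $\mathcal H^0_\oplus$ of the form $(y_g^0\varphi)(\omega)=y^0(g,\omega)\varphi(g^{-1}\omega)\sqrt{\rho_{g^{-1}}(\omega)}$ (a.e.), with weakly $\nu$-measurable fields of unitaries $y^0(g,\omega)\in\mathcal U(\mathcal H_{n^0(\omega)})$, such that $KU(g)=y^0_gK$ and, for all $g,h\in G$ and $\nu$-a.a. $\omega$, $y^0(gh,\omega)=y^0(g,\omega)y^0(h,g^{-1}\omega)$.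 **(c) Factorization.** The data in (b) can be chosen so that for all data $\mathcal H_\oplus,Y,y$ as in (a) there are an isometry $C:\mathcal H_\oplus^0\to\mathcal K\otimes\mathcal H_\oplus$ and a weakly $\nu$-measurable field of operators $C(\omega)$ which, for $\nu$-a.a. $\omega$, are isometries $\mathcal H_{n^0(\omega)}\to\mathcal K\otimes\mathcal H_{n(\omega)}$, such that $(C\varphi)(\omega)=C(\omega)\varphi(\omega)$ for all $\varphi\in\mathcal H_\oplus^0$ and $\nu$-a.a. $\omega$, $Y=CK$, and for all $g\in G$ $$C(g\omega)=\big(u_g\otimes y(g,g\omega)\big)\,C(\omega)\,y^0(g,g\omega)^*\qquad\text{for }\nu\text{-a.a. }\omega .$$ **(d) Determination of $S$.** With $C$ as in (c), $\Phi(b)=C^*(b\otimes I)C$ is a quantum channel (normal, unital, completely positive) $\mathcal L(\mathcal K)\to\mathcal L(\mathcal H_\oplus^0)$ with $[\Phi(b),\hat f^0]=0$ and $(y^0_g)^*\Phi(b)y^0_g=\Phi(u_g^*bu_g)$. It is decomposable: $(\Phi(b)\varphi)(\omega)=\Phi_\omega(b)\varphi(\omega)$ (a.e.), where $\Phi_\omega(b)=C(\omega)^*(b\otimes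 I)C(\omega)$ is for $\nu$-a.a. $\omega$ a quantum channel $\mathcal L(\mathcal K)\to\mathcal L(\mathcal H_{n^0(\omega)})$, and for every $g$, for $\nu$-a.a. $\omega$ and all $b$, $y^0(g,g\omega)^*\Phi_{g\omega}(b)y^0(g,g\omega)=\Phi_\omega(u_g^*bu_g)$. Moreover $S_{b\otimes f}(v,w)=(Kv)^*\Phi(b)\hat f^0(Kw)$ for all $b,f,v,w$, and $S$ is the only normal covariant completely positive map (for the same $U$, $u$, $s_1$) which satisfies this formula. -/

import Mathlib

open MeasureTheory
open scoped ENNReal InnerProductSpace InnerProduct TensorProduct Pointwise ComplexConjugate ComplexOrder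

universe u

namespace CovariantCP

noncomputable section

/-! ### Hilbert space tensor products -/

section HilbertTensor

variable (E F : Type*) [NormedAddCommGroup E] [InnerProductSpace ℂ E]
  [NormedAddCommGroup F] [InnerProductSpace ℂ F]

/-- The Hilbert space tensor product: the completion of the algebraic tensor product. -/
def HilbertTensor : Type _ := UniformSpace.Completion (E ⊗[ℂ] F)

instance : NormedAddCommGroup (HilbertTensor E F) :=
  inferInstanceAs (NormedAddCommGroup (UniformSpace.Completion (E ⊗[ℂ] F)))

instance : InnerProductSpace ℂ (HilbertTensor E F) :=
  inferInstanceAs (InnerProductSpace ℂ (UniformSpace.Completion (E ⊗[ℂ] F)))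

instance : CompleteSpace (HilbertTensor E F) :=
  inferInstanceAs (CompleteSpace (UniformSpace.Completion (E ⊗[ℂ] F)))

/-- The embedding of the algebraic tensor product. -/
def HilbertTensor.ofAlg : E ⊗[ℂ] F →ₗᵢ[ℂ] HilbertTensor E F :=
  (UniformSpace.Completion.toComplₗᵢ (𝕜 := ℂ) (E := E ⊗[ℂ] F))

lemma HilbertTensor.denseRange_ofAlg : DenseRange (HilbertTensor.ofAlg E F) :=
  UniformSpace.Completion.denseRange_coe (α := E ⊗[ℂ] F)

variable {E F}

/-- The map `y ↦ x ⊗ y` into the Hilbert space tensor product. -/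
def tmulL (x : E) : F →L[ℂ] HilbertTensor E F :=
  (HilbertTensor.ofAlg E F).toContinuousLinearMap ∘L (TensorProduct.mkL ℂ E F x)

lemma tmulL_apply (x : E) (y : F) : tmulL x y = HilbertTensor.ofAlg E F (x ⊗ₜ[ℂ] y) := rfl

lemma inner_tmulL (x x' : E) (y y' : F) :
    ⟪tmulL x y, tmulL x' y'⟫_ℂ = ⟪x, x'⟫_ℂ * ⟪y, y'⟫_ℂ := by
  rw [tmulL_apply, tmulL_apply, LinearIsometry.inner_map_map, TensorProduct.inner_tmul]

/-- The bounded operator `b ⊗ c` on the Hilbert space tensor product. -/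
def opTensor (b : E →L[ℂ] E) (c : F →L[ℂ] F) : HilbertTensor E F →L[ℂ] HilbertTensor E F :=
  (TensorProduct.mapL b c).completion

lemma opTensor_tmulL (b : E →L[ℂ] E) (c : F →L[ℂ] F) (x : E) (y : F) :
    opTensor b c (tmulL x y) = tmulL (b x) (c y) :=
  (TensorProduct.mapL b c).completion_apply_coe (x ⊗ₜ[ℂ] y)

end HilbertTensor

/-! ### Normal maps, sesquilinear forms, the sigma-strong topology -/

/-- A map between ordered `*`-structures is normal if it preserves the suprema of (bounded)
increasing nets of self-adjoint elements. -/
def IsNormalMap {A B : Type*} [Preorder A] [Star A] [Preorder B] (f : A → B) : Prop :=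
  ∀ D : Set A, D.Nonempty → DirectedOn (· ≤ ·) D → (∀ a ∈ D, IsSelfAdjoint a) →
    ∀ s : A, IsLUB D s → IsLUB (f '' D) (f s)

/-- Sesquilinear forms with values in `L(H)` on a right `L(H)`-module `V`. The right action of
`a ∈ L(H)` is the left action of `MulOpposite.op a`. -/
structure IsSesquilinearForm {H V : Type*} [NormedAddCommGroup H] [InnerProductSpace ℂ H]
    [CompleteSpace H] [AddCommGroup V] [Module ℂ V] [Module (H →L[ℂ] H)ᵐᵒᵖ V]
    (s : V → V → (H →L[ℂ] H)) : Prop where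
  add_right : ∀ x v w, s x (v + w) = s x v + s x w
  smul_right : ∀ (c : ℂ) x v, s x (c • v) = c • s x v
  add_left : ∀ x v w, s (v + w) x = s v x + s w x
  smul_left : ∀ (c : ℂ) x v, s (c • v) x = conj c • s v x
  op_right : ∀ (a : H →L[ℂ] H) v w, s v (MulOpposite.op a • w) = s v w * a
  op_left : ∀ (a : H →L[ℂ] H) v w, s (MulOpposite.op a • v) w = star a * s v w

/-- `L(H)`-linearity of a map from a right `L(H)`-module to `L(H; H')`. -/
def IsModuleMap {H V H' : Type*} [NormedAddCommGroup H] [InnerProductSpace ℂ H]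
    [AddCommGroup V] [Module ℂ V] [Module (H →L[ℂ] H)ᵐᵒᵖ V]
    [NormedAddCommGroup H'] [InnerProductSpace ℂ H'] (Y : V →ₗ[ℂ] (H →L[ℂ] H')) : Prop :=
  ∀ (a : H →L[ℂ] H) (v : V), Y (MulOpposite.op a • v) = Y v ∘L a

/-- Density in the sigma-strong topology of `L(H; H')`, the topology generated by the seminorms
`T ↦ (∑ⱼ ‖T ξⱼ‖²)^(1/2)` with `∑ⱼ ‖ξⱼ‖² < ∞` (a directed family). -/
def SigmaStronglyDense {H H' : Type*} [NormedAddCommGroup H] [InnerProductSpace ℂ H]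
    [NormedAddCommGroup H'] [InnerProductSpace ℂ H'] (s : Set (H →L[ℂ] H')) : Prop :=
  ∀ (T : H →L[ℂ] H') (ξ : ℕ → H), (Summable fun j => ‖ξ j‖ ^ 2) → ∀ ε : ℝ, 0 < ε →
    ∃ m ∈ s, ∑' j, ‖T (ξ j) - m (ξ j)‖ ^ 2 < ε

/-! ### Multiplication operators and the von Neumann algebra `L(K) ⊗ L^∞(ν)` -/

section VonNeumann

variable {Ω : Type*} [MeasurableSpace Ω] (ν : Measure Ω)

/-- Multiplication by `f ∈ L^∞(ν)` on `L²(ν; E)`. -/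
def mulOp {E : Type*} [NormedAddCommGroup E] [InnerProductSpace ℂ E] (f : Lp ℂ ∞ ν) :
    Lp E 2 ν →L[ℂ] Lp E 2 ν :=
  (ContinuousLinearMap.lsmul ℂ ℂ).holderL ν ∞ 2 2 f

lemma coeFn_mulOp {E : Type*} [NormedAddCommGroup E] [InnerProductSpace ℂ E] (f : Lp ℂ ∞ ν)
    (ψ : Lp E 2 ν) : mulOp ν f ψ =ᵐ[ν] fun ω => f ω • ψ ω :=
  (ContinuousLinearMap.lsmul ℂ ℂ).coeFn_holder (r := 2) f ψ

variable (K : Type*) [NormedAddCommGroup K] [InnerProductSpace ℂ K]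

/-- The operators `b ⊗ f` on `K ⊗ L²(ν)`. -/
def elementaryOps : Set (HilbertTensor K (Lp ℂ 2 ν) →L[ℂ] HilbertTensor K (Lp ℂ 2 ν)) :=
  {T | ∃ (b : K →L[ℂ] K) (f : Lp ℂ ∞ ν), T = opTensor b (mulOp ν f)}

/-- The von Neumann algebra tensor product `L(K) ⊗ L^∞(ν)`: the double commutant of the operators
`b ⊗ f` on `K ⊗ L²(ν)`. -/
def tensorVN : StarSubalgebra ℂ
    (HilbertTensor K (Lp ℂ 2 ν) →L[ℂ] HilbertTensor K (Lp ℂ 2 ν)) :=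
  StarSubalgebra.centralizer ℂ
    (StarSubalgebra.centralizer ℂ (elementaryOps ν K) :
      Set (HilbertTensor K (Lp ℂ 2 ν) →L[ℂ] HilbertTensor K (Lp ℂ 2 ν)))

variable {K}

lemma opTensor_mem_tensorVN (b : K →L[ℂ] K) (f : Lp ℂ ∞ ν) :
    opTensor b (mulOp ν f) ∈ tensorVN ν K := by
  have hmem : opTensor b (mulOp ν f) ∈ elementaryOps ν K := ⟨b, f, rfl⟩
  rw [tensorVN, StarSubalgebra.mem_centralizer_iff]
  intro g hg
  have hg' := SetLike.mem_coe.1 hg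
  rw [StarSubalgebra.mem_centralizer_iff] at hg'
  refine ⟨(hg' _ hmem).1.symm, ?_⟩
  have h := congrArg star (hg' _ hmem).2
  simpa only [star_mul, star_star] using h

/-- The element `b ⊗ f` of `L(K) ⊗ L^∞(ν)`. -/
def elem (b : K →L[ℂ] K) (f : Lp ℂ ∞ ν) : tensorVN ν K :=
  ⟨opTensor b (mulOp ν f), opTensor_mem_tensorVN ν b f⟩

/-- The class in `L^∞(ν)` of the characteristic function of a measurable set. -/
def charFn {X : Set Ω} (hX : MeasurableSet X) : Lp ℂ ∞ ν :=
  MemLp.toLp (X.indicator fun _ => (1 : ℂ)) ((memLp_top_const (1 : ℂ)).indicator hX)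

/-- The unit of `L^∞(ν)`. -/
def oneFn : Lp ℂ ∞ ν := MemLp.toLp (fun _ => (1 : ℂ)) (memLp_top_const (1 : ℂ))

end VonNeumann

/-! ### The group action -/

section Action

variable {Ω : Type*} [MeasurableSpace Ω] (ν : Measure Ω) {G : Type*} [Group G] [MulAction G Ω]

/-- `ν` is quasi-invariant under the action of `G`. -/
def IsQuasiInvariant (G : Type*) [Group G] [MulAction G Ω] : Prop :=
  ∀ (g : G) (X : Set Ω), MeasurableSet X → ν X = 0 → ν (g • X) = 0

variable {ν}

lemma IsQuasiInvariant.quasiMeasurePreserving [MeasurableConstSMul G Ω]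
    (hν : IsQuasiInvariant ν G) (g : G) :
    Measure.QuasiMeasurePreserving (fun ω : Ω => g • ω) ν ν := by
  refine ⟨measurable_const_smul g, ?_⟩
  refine Measure.AbsolutelyContinuous.mk fun X hX h0 => ?_
  rw [Measure.map_apply (measurable_const_smul g) hX, Set.preimage_smul]
  exact hν g⁻¹ X hX h0

/-- The action `(γ_g f)(ω) = f(g⁻¹ ω)` of `G` on `L^∞(ν)`. -/
def translate [MeasurableConstSMul G Ω] (hν : IsQuasiInvariant ν G) (g : G) (f : Lp ℂ ∞ ν) :
    Lp ℂ ∞ ν :=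
  MemLp.toLp (fun ω => f (g⁻¹ • ω)) (by
    have hq := hν.quasiMeasurePreserving g⁻¹
    refine ⟨(Lp.aestronglyMeasurable f).comp_quasiMeasurePreserving hq, ?_⟩
    have hf := (Lp.memLp f).2
    rw [eLpNorm_exponent_top] at hf ⊢
    refine lt_of_le_of_lt ?_ hf
    refine essSup_le_of_ae_le _ ?_
    exact hq.ae (enorm_ae_le_eLpNormEssSup f ν))

variable (ν) in
/-- `√ρ_{g⁻¹}`, where `ρ_h` is the Radon-Nikodym derivative with respect to `ν` of the measure
`X ↦ ν(hX)`; for `h = g⁻¹` this measure is the image of `ν` under `ω ↦ g ω`. -/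
def sqrtDensity (g : G) (ω : Ω) : ℝ :=
  √((ν.map (fun ω' : Ω => g • ω')).rnDeriv ν ω).toReal

end Action

/-! ### Direct integrals -/

section DirectIntegral

/-- The infinite-dimensional separable Hilbert space `H_∞ = ℓ²(ℕ)`. -/
abbrev Ell2 : Type := lp (fun _ : ℕ => ℂ) 2

/-- `H_k`, the `k`-dimensional subspace of `ℓ²(ℕ)` spanned by the first `k` basis vectors. -/
def fiber (k : ℕ∞) : Submodule ℂ Ell2 where
  carrier := {x | ∀ i : ℕ, k ≤ (i : ℕ∞) → x i = 0}
  add_mem' {x y} hx hy i hi := by simp [hx i hi, hy i hi]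
  zero_mem' i _ := by simp
  smul_mem' c x hx i hi := by simp [hx i hi]

lemma isClosed_fiber (k : ℕ∞) : IsClosed (fiber k : Set Ell2) := by
  have h : (fiber k : Set Ell2) =
      ⋂ (i : ℕ) (_ : k ≤ (i : ℕ∞)), {x : Ell2 | lp.evalCLM ℂ (fun _ : ℕ => ℂ) 2 i x = 0} := by
    ext x
    simp only [Set.mem_iInter]
    rfl
  rw [h]
  exact isClosed_iInter fun i => isClosed_iInter fun _ =>
    isClosed_eq (ContinuousLinearMap.continuous _) continuous_const

instance (k : ℕ∞) : CompleteSpace (fiber k) := (isClosed_fiber k).completeSpace_coe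

/-- The orthogonal projection of `ℓ²(ℕ)` onto `H_k`. -/
def fiberProj (k : ℕ∞) : Ell2 →L[ℂ] Ell2 := (fiber k).starProjection

variable {Ω : Type*} [MeasurableSpace Ω] (ν : Measure Ω) (n : Ω → ℕ∞)

/-- The classes of square integrable functions `ψ` with `ψ(ω) ∈ H_{n(ω)}` almost everywhere. -/
def fiberwise : Submodule ℂ (Lp Ell2 2 ν) where
  carrier := {ψ | ∀ᵐ ω ∂ν, ψ ω ∈ fiber (n ω)}
  add_mem' {φ ψ} hφ hψ := by
    filter_upwards [hφ, hψ, Lp.coeFn_add φ ψ] with ω h1 h2 h3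
    rw [h3]
    exact (fiber (n ω)).add_mem h1 h2
  zero_mem' := by
    filter_upwards [Lp.coeFn_zero Ell2 2 ν] with ω h
    rw [h]
    exact (fiber (n ω)).zero_mem
  smul_mem' c ψ hψ := by
    filter_upwards [hψ, Lp.coeFn_smul c ψ] with ω h1 h2
    rw [h2]
    exact (fiber (n ω)).smul_mem c h1

lemma isClosed_fiberwise : IsClosed (fiberwise ν n : Set (Lp Ell2 2 ν)) := by
  refine isClosed_of_closure_subset fun ψ hψ => ?_
  obtain ⟨s, hs, hlim⟩ := mem_closure_iff_seq_limit.1 hψ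
  obtain ⟨k, -, hk⟩ := (tendstoInMeasure_of_tendsto_Lp hlim).exists_seq_tendsto_ae
  have hall : ∀ᵐ ω ∂ν, ∀ i, s i ω ∈ fiber (n ω) := ae_all_iff.2 fun i => hs i
  show ∀ᵐ ω ∂ν, ψ ω ∈ fiber (n ω)
  filter_upwards [hk, hall] with ω h1 h2
  exact (isClosed_fiber (n ω)).mem_of_tendsto h1 (Filter.Eventually.of_forall fun i => h2 (k i))

/-- The direct integral `∫^⊕ H_{n(ω)} dν(ω)`, as a Hilbert space. -/
def DirectIntegral : Type _ := fiberwise ν n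

instance : NormedAddCommGroup (DirectIntegral ν n) :=
  inferInstanceAs (NormedAddCommGroup (fiberwise ν n))

instance : InnerProductSpace ℂ (DirectIntegral ν n) :=
  inferInstanceAs (InnerProductSpace ℂ (fiberwise ν n))

instance : CompleteSpace (DirectIntegral ν n) :=
  (isClosed_fiberwise ν n).completeSpace_coe

variable {ν n}

/-- The inclusion of the direct integral into `L²(ν; ℓ²(ℕ))`. -/
def DirectIntegral.toLp : DirectIntegral ν n →ₗᵢ[ℂ] Lp Ell2 2 ν :=
  (fiberwise ν n).subtypeₗᵢ

/-- A representative `ω ↦ ψ(ω)` of a vector of the direct integral. -/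
instance : CoeFun (DirectIntegral ν n) fun _ => Ω → Ell2 := ⟨fun ψ => DirectIntegral.toLp ψ⟩

/-- The diagonal operator `(f̂ ψ)(ω) = f(ω) ψ(ω)` on the direct integral. -/
def diagOp (f : Lp ℂ ∞ ν) : DirectIntegral ν n →L[ℂ] DirectIntegral ν n :=
  (mulOp ν f).restrict (p := fiberwise ν n) (q := fiberwise ν n) (fun ψ hψ => by
    show ∀ᵐ ω ∂ν, (mulOp ν f ψ) ω ∈ fiber (n ω)
    filter_upwards [hψ, coeFn_mulOp ν f ψ] with ω h1 h2
    rw [h2]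
    exact (fiber (n ω)).smul_mem _ h1)

lemma coeFn_diagOp (f : Lp ℂ ∞ ν) (ψ : DirectIntegral ν n) :
    (diagOp f ψ : Ω → Ell2) =ᵐ[ν] fun ω => f ω • ψ ω :=
  coeFn_mulOp ν f (DirectIntegral.toLp ψ)

variable {K : Type*} [NormedAddCommGroup K] [InnerProductSpace ℂ K]

lemma tmulL_add (x x' : K) :
    (tmulL (x + x') : Ell2 →L[ℂ] HilbertTensor K Ell2) = tmulL x + tmulL x' := by
  ext y
  simp only [add_apply, tmulL_apply, TensorProduct.add_tmul, map_add]

lemma tmulL_smul (c : ℂ) (x : K) :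
    (tmulL (c • x) : Ell2 →L[ℂ] HilbertTensor K Ell2) = c • tmulL x := by
  ext y
  simp only [smul_apply, tmulL_apply, ← TensorProduct.smul_tmul', map_smul]

/-- The bilinear map `(x, ψ) ↦ (ω ↦ x ⊗ ψ(ω))`. -/
def disintegrateBilin : K →ₗ[ℂ] DirectIntegral ν n →ₗ[ℂ] Lp (HilbertTensor K Ell2) 2 ν :=
  LinearMap.mk₂ ℂ
    (fun (x : K) (ψ : DirectIntegral ν n) =>
      (tmulL x : Ell2 →L[ℂ] HilbertTensor K Ell2).compLpL 2 ν (DirectIntegral.toLp ψ))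
    (fun x x' ψ => by rw [tmulL_add, ContinuousLinearMap.add_compLpL,
      add_apply])
    (fun c x ψ => by rw [tmulL_smul, ContinuousLinearMap.smul_compLpL,
      smul_apply])
    (fun x ψ ψ' => by rw [map_add, map_add])
    (fun c x ψ => by rw [map_smul, map_smul])

lemma coeFn_disintegrateBilin (x : K) (ψ : DirectIntegral ν n) :
    disintegrateBilin x ψ =ᵐ[ν] fun ω => tmulL x (ψ ω) :=
  ContinuousLinearMap.coeFn_compLpL
    (tmulL x : Ell2 →L[ℂ] HilbertTensor K Ell2) (DirectIntegral.toLp ψ)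

lemma inner_disintegrateBilin (x x' : K) (ψ ψ' : DirectIntegral ν n) :
    ⟪disintegrateBilin x ψ, disintegrateBilin x' ψ'⟫_ℂ = ⟪x, x'⟫_ℂ * ⟪ψ, ψ'⟫_ℂ := by
  rw [← DirectIntegral.toLp.inner_map_map ψ ψ', L2.inner_def, L2.inner_def, ← integral_const_mul]
  refine integral_congr_ae ?_
  filter_upwards [coeFn_disintegrateBilin x ψ, coeFn_disintegrateBilin x' ψ'] with ω h h'
  rw [h, h', inner_tmulL]

/-- The algebraic part of `disintegrate`. -/
def disintegrateAux : K ⊗[ℂ] DirectIntegral ν n →ₗᵢ[ℂ] Lp (HilbertTensor K Ell2) 2 ν :=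
  LinearMap.isometryOfInner (TensorProduct.lift disintegrateBilin) (by
    intro s t
    induction s using TensorProduct.induction_on with
    | zero => rw [map_zero, inner_zero_left, inner_zero_left]
    | add s s' hs hs' => rw [map_add, inner_add_left, inner_add_left, hs, hs']
    | tmul x ψ =>
      induction t using TensorProduct.induction_on with
      | zero => rw [map_zero, inner_zero_right, inner_zero_right]
      | add t t' ht ht' => rw [map_add, inner_add_right, inner_add_right, ht, ht']
      | tmul x' ψ' =>
        rw [TensorProduct.lift.tmul, TensorProduct.lift.tmul, TensorProduct.inner_tmul,
          inner_disintegrateBilin])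

/-- The identification of `K ⊗ ∫^⊕ H_{n(ω)} dν(ω)` with `∫^⊕ K ⊗ H_{n(ω)} dν(ω)`, the latter
viewed inside `L²(ν; K ⊗ ℓ²(ℕ))`: the isometry determined by `(x ⊗ ψ)(ω) = x ⊗ ψ(ω)`. -/
def disintegrate :
    HilbertTensor K (DirectIntegral ν n) →L[ℂ] Lp (HilbertTensor K Ell2) 2 ν :=
  (disintegrateAux (ν := ν) (n := n) (K := K)).toContinuousLinearMap.fromCompletion

lemma disintegrate_ofAlg (s : K ⊗[ℂ] DirectIntegral ν n) :
    disintegrate (HilbertTensor.ofAlg K (DirectIntegral ν n) s) = disintegrateAux s :=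
  ContinuousLinearMap.fromCompletion_apply_coe _ s

lemma disintegrate_tmulL (x : K) (ψ : DirectIntegral ν n) :
    disintegrate (tmulL x ψ) =ᵐ[ν] fun ω => tmulL x (ψ ω) := by
  rw [tmulL_apply, disintegrate_ofAlg]
  exact coeFn_disintegrateBilin x ψ

lemma norm_disintegrate (z : HilbertTensor K (DirectIntegral ν n)) :
    ‖disintegrate z‖ = ‖z‖ := by
  refine DenseRange.induction_on (HilbertTensor.denseRange_ofAlg K (DirectIntegral ν n)) z ?_
    fun s => ?_
  · exact isClosed_eq (continuous_norm.comp (ContinuousLinearMap.continuous _)) continuous_norm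
  · rw [disintegrate_ofAlg, LinearIsometry.norm_map, LinearIsometry.norm_map]

end DirectIntegral

/-! ### Measurable fields of operators -/

section Fields

variable {Ω : Type*} [MeasurableSpace Ω] (ν : Measure Ω)

/-- Weak `ν`-measurability of a field of bounded operators. -/
def IsWeaklyMeasurable {E E' : Type*} [NormedAddCommGroup E] [InnerProductSpace ℂ E]
    [NormedAddCommGroup E'] [InnerProductSpace ℂ E'] (A : Ω → (E →L[ℂ] E')) : Prop :=
  ∀ (x : E) (z : E'), AEStronglyMeasurable (fun ω => ⟪z, A ω x⟫_ℂ) ν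

/-- A weakly measurable field of unitary operators `a(ω) : H_{n(ω)} → H_{n(ω)}`. A unitary operator
of `H_k` is written as the operator of `ℓ²(ℕ)` that extends it by zero on the orthogonal complement
of `H_k`, so that `a* a = a a*` is the projection onto `H_k`. -/
structure IsUnitaryField (n : Ω → ℕ∞) (a : Ω → (Ell2 →L[ℂ] Ell2)) : Prop where
  weaklyMeasurable : IsWeaklyMeasurable ν a
  star_mul : ∀ ω, star (a ω) * a ω = fiberProj (n ω)
  mul_star : ∀ ω, a ω * star (a ω) = fiberProj (n ω)

/-- A weakly measurable field of isometries `C(ω) : H_{n₀(ω)} → K ⊗ H_{n(ω)}`, again extended by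
zero on the orthogonal complement of `H_{n₀(ω)}`. -/
structure IsIsometryField {K : Type*} [NormedAddCommGroup K] [InnerProductSpace ℂ K]
    (n₀ n : Ω → ℕ∞) (C : Ω → (Ell2 →L[ℂ] HilbertTensor K Ell2)) : Prop where
  weaklyMeasurable : IsWeaklyMeasurable ν C
  isometry : ∀ᵐ ω ∂ν, (C ω)† ∘L C ω = fiberProj (n₀ ω)
  range : ∀ᵐ ω ∂ν, opTensor 1 (fiberProj (n ω)) ∘L C ω = C ω

/-- `(T ψ)(ω) = a(ω) ψ(g⁻¹ ω) √ρ_{g⁻¹}(ω)` for every `ψ` and almost every `ω`. -/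
def IsImplementedBy {G : Type*} [Group G] [MulAction G Ω] {n : Ω → ℕ∞} (g : G)
    (a : Ω → (Ell2 →L[ℂ] Ell2)) (T : DirectIntegral ν n →L[ℂ] DirectIntegral ν n) : Prop :=
  ∀ ψ : DirectIntegral ν n,
    ∀ᵐ ω ∂ν, T ψ ω = (sqrtDensity ν g ω : ℂ) • a ω (ψ (g⁻¹ • ω))

end Fields

/-! ### Quantum channels -/

section Channels

variable {K E F : Type*} [NormedAddCommGroup K] [InnerProductSpace ℂ K] [CompleteSpace K]
  [NormedAddCommGroup E] [InnerProductSpace ℂ E] [CompleteSpace E]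
  [NormedAddCommGroup F] [InnerProductSpace ℂ F]

/-- The map `b ↦ C* (b ⊗ I) C` for `C : E → K ⊗ F`. -/
def compression (C : E →L[ℂ] HilbertTensor K F) (b : K →L[ℂ] K) : E →L[ℂ] E :=
  C† ∘L opTensor b 1 ∘L C

/-- `Φ` is a quantum channel from `L(K)` to `P L(E) P = L(P E)`, where `P` is an orthogonal
projection: a normal completely positive linear map with `Φ(1) = P`. -/
structure IsChannel (P : E →L[ℂ] E) (Φ : (K →L[ℂ] K) → (E →L[ℂ] E)) : Prop where
  map_add : ∀ b c, Φ (b + c) = Φ b + Φ c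
  map_smul : ∀ (z : ℂ) b, Φ (z • b) = z • Φ b
  cp : ∀ (k : ℕ) (b : Fin k → (K →L[ℂ] K)) (x : Fin k → E),
    0 ≤ ∑ i, ∑ j, ⟪x i, Φ (star (b i) * b j) (x j)⟫_ℂ
  normal : IsNormalMap Φ
  map_one : Φ 1 = P

end Channels

/-! ### Covariant completely positive maps and their dilations -/

section Dilations

variable {Ω H K V G : Type*} [MeasurableSpace Ω] {ν : Measure Ω}
  [NormedAddCommGroup H] [InnerProductSpace ℂ H] [CompleteSpace H]
  [NormedAddCommGroup K] [InnerProductSpace ℂ K] [CompleteSpace K]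
  [AddCommGroup V] [Module ℂ V] [Module (H →L[ℂ] H)ᵐᵒᵖ V]
  [Group G] [MulAction G Ω] [MeasurableConstSMul G Ω]

/-- `g ↦ u_g` is a projective unitary representation with `u_{gh} = m(g,h) u_g u_h`. -/
structure IsMultiplierRep (m : G → G → Circle) (u : G → unitary (K →L[ℂ] K)) : Prop where
  map_one : u 1 = 1
  map_mul : ∀ g h, (u (g * h) : K →L[ℂ] K) =
    (m g h : ℂ) • ((u g : K →L[ℂ] K) * (u h : K →L[ℂ] K))

/-- `S` is a normal completely positive map from `L(K) ⊗ L^∞(ν)` to the `L(H)`-valued sesquilinear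
forms on `V` with `S_1 = s₁` which is covariant with respect to `U` and to the action
`b ⊗ f ↦ u_g b u_g* ⊗ γ_g f` (by normality it suffices to require covariance on the elements
`b ⊗ f`, which generate the von Neumann algebra). -/
structure IsCovariantNCP (hν : IsQuasiInvariant ν G) (u : G → unitary (K →L[ℂ] K))
    (U : G →* (V ≃ₗ[(H →L[ℂ] H)ᵐᵒᵖ] V)) (s₁ : V → V → (H →L[ℂ] H))
    (S : tensorVN ν K →ₗ[ℂ] (V → V → (H →L[ℂ] H))) : Prop where
  sesquilinear : ∀ d, IsSesquilinearForm (S d)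
  cp : ∀ (k : ℕ) (d : Fin k → tensorVN ν K) (v : Fin k → V),
    0 ≤ ∑ i, ∑ j, S (star (d i) * d j) (v i) (v j)
  normal : ∀ v, IsNormalMap fun d => S d v v
  covariant : ∀ (g : G) (b : K →L[ℂ] K) (f : Lp ℂ ∞ ν) (v w : V),
    S (elem ν ((u g : K →L[ℂ] K) * b * star (u g : K →L[ℂ] K)) (translate hν g f)) v w =
      S (elem ν b f) (U g⁻¹ v) (U g⁻¹ w)
  normalized : S 1 = s₁

/-- A spectral (projection valued) measure on `Ω`. Values on non-measurable sets are irrelevant. -/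
structure SpectralMeasure (Ω : Type*) [MeasurableSpace Ω] (E : Type*) [NormedAddCommGroup E]
    [InnerProductSpace ℂ E] [CompleteSpace E] where
  /-- The projection attached to a set. -/
  toFun : Set Ω → (E →L[ℂ] E)
  isStarProjection : ∀ X, MeasurableSet X → IsStarProjection (toFun X)
  map_univ : toFun Set.univ = 1
  hasSum_iUnion : ∀ X : ℕ → Set Ω, (∀ i, MeasurableSet (X i)) → Pairwise (Function.onFun Disjoint X) →
    ∀ x : E, HasSum (fun i => toFun (X i) x) (toFun (⋃ i, X i) x)

/-- `(H₀, F, Y)` is a minimal Naimark dilation of `S`: `Y` is `L(H)`-linear,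
`S_{b ⊗ χ_X}(v,w) = (Yv)* (b ⊗ F(X)) (Yw)` (equivalently, with `f` and `∫ f dF` in place of `χ_X` and
`F(X)` for all `f ∈ L^∞(ν)`), and the operators `(b ⊗ F(X)) (Yv)` span a sigma-strongly dense
subspace of `L(H; K ⊗ H₀)`. -/
structure IsMinimalNaimarkDilation (S : tensorVN ν K →ₗ[ℂ] (V → V → (H →L[ℂ] H)))
    {H₀ : Type*} [NormedAddCommGroup H₀] [InnerProductSpace ℂ H₀] [CompleteSpace H₀]
    (F : SpectralMeasure Ω H₀) (Y : V →ₗ[ℂ] (H →L[ℂ] HilbertTensor K H₀)) : Prop where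
  moduleMap : IsModuleMap Y
  dilates : ∀ (b : K →L[ℂ] K) (X : Set Ω) (hX : MeasurableSet X) (v w : V),
    S (elem ν b (charFn ν hX)) v w = (Y v)† ∘L opTensor b (F.toFun X) ∘L Y w
  dense : SigmaStronglyDense (Submodule.span ℂ {T : H →L[ℂ] HilbertTensor K H₀ |
    ∃ (b : K →L[ℂ] K) (X : Set Ω) (v : V), MeasurableSet X ∧
      T = opTensor b (F.toFun X) ∘L Y v} : Set (H →L[ℂ] HilbertTensor K H₀))

/-- A minimal covariant dilation `(n, Y, y)` of `S` into `K ⊗ H_⊕`, where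
`H_⊕ = ∫^⊕ H_{n(ω)} dν(ω)`; `y` is the field `y(g, ω)` and `T` is `g ↦ y_g`. -/
structure IsCovariantDilation (m : G → G → Circle) (u : G → unitary (K →L[ℂ] K))
    (U : G →* (V ≃ₗ[(H →L[ℂ] H)ᵐᵒᵖ] V)) (S : tensorVN ν K →ₗ[ℂ] (V → V → (H →L[ℂ] H)))
    (n : Ω → ℕ∞) (Y : V →ₗ[ℂ] (H →L[ℂ] HilbertTensor K (DirectIntegral ν n)))
    (y : G → Ω → (Ell2 →L[ℂ] Ell2))
    (T : G → unitary (DirectIntegral ν n →L[ℂ] DirectIntegral ν n)) : Prop where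
  measurable : AEMeasurable n ν
  invariant : ∀ g : G, ∀ᵐ ω ∂ν, n (g • ω) = n ω
  moduleMap : IsModuleMap Y
  dilates : ∀ (b : K →L[ℂ] K) (f : Lp ℂ ∞ ν) (v w : V),
    S (elem ν b f) v w = (Y v)† ∘L opTensor b (diagOp f) ∘L Y w
  dense : SigmaStronglyDense
    (Submodule.span ℂ {A : H →L[ℂ] HilbertTensor K (DirectIntegral ν n) |
      ∃ (b : K →L[ℂ] K) (f : Lp ℂ ∞ ν) (v : V), A = opTensor b (diagOp f) ∘L Y v} :
      Set (H →L[ℂ] HilbertTensor K (DirectIntegral ν n)))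
  unitaryField : ∀ g, IsUnitaryField ν n (y g)
  implemented : ∀ g, IsImplementedBy ν g (y g) (T g : DirectIntegral ν n →L[ℂ] DirectIntegral ν n)
  intertwines : ∀ (g : G) (v : V),
    Y (U g v) = opTensor (u g : K →L[ℂ] K) (T g : DirectIntegral ν n →L[ℂ] DirectIntegral ν n) ∘L Y v
  cocycle : ∀ g h, ∀ᵐ ω ∂ν,
    y (g * h) ω = conj (m g h : ℂ) • (y g ω * y h (g⁻¹ • ω))
  map_mul : ∀ g h,
    opTensor (u (g * h) : K →L[ℂ] K) (T (g * h) : DirectIntegral ν n →L[ℂ] DirectIntegral ν n) =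
      opTensor (u g : K →L[ℂ] K) (T g : DirectIntegral ν n →L[ℂ] DirectIntegral ν n) *
        opTensor (u h : K →L[ℂ] K) (T h : DirectIntegral ν n →L[ℂ] DirectIntegral ν n)

/-- A minimal covariant dilation `(n₀, L, y₀)` of the second marginal `S²_f = S_{1 ⊗ f}` into the
direct integral `∫^⊕ H_{n₀(ω)} dν(ω)`; `T₀` is the representation `g ↦ y⁰_g`. -/
structure IsCovariantMarginalDilation (U : G →* (V ≃ₗ[(H →L[ℂ] H)ᵐᵒᵖ] V))
    (S : tensorVN ν K →ₗ[ℂ] (V → V → (H →L[ℂ] H)))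
    (n₀ : Ω → ℕ∞) (L : V →ₗ[ℂ] (H →L[ℂ] DirectIntegral ν n₀))
    (y₀ : G → Ω → (Ell2 →L[ℂ] Ell2))
    (T₀ : G →* unitary (DirectIntegral ν n₀ →L[ℂ] DirectIntegral ν n₀)) : Prop where
  measurable : AEMeasurable n₀ ν
  invariant : ∀ g : G, ∀ᵐ ω ∂ν, n₀ (g • ω) = n₀ ω
  moduleMap : IsModuleMap L
  dilates : ∀ (f : Lp ℂ ∞ ν) (v w : V), S (elem ν 1 f) v w = (L v)† ∘L diagOp f ∘L L w
  dense : SigmaStronglyDense (Submodule.span ℂ {A : H →L[ℂ] DirectIntegral ν n₀ |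
    ∃ (f : Lp ℂ ∞ ν) (v : V), A = diagOp f ∘L L v} : Set (H →L[ℂ] DirectIntegral ν n₀))
  unitaryField : ∀ g, IsUnitaryField ν n₀ (y₀ g)
  implemented : ∀ g,
    IsImplementedBy ν g (y₀ g) (T₀ g : DirectIntegral ν n₀ →L[ℂ] DirectIntegral ν n₀)
  intertwines : ∀ (g : G) (v : V),
    L (U g v) = (T₀ g : DirectIntegral ν n₀ →L[ℂ] DirectIntegral ν n₀) ∘L L v
  cocycle : ∀ g h, ∀ᵐ ω ∂ν, y₀ (g * h) ω = y₀ g ω * y₀ h (g⁻¹ • ω)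

end Dilations

end

end CovariantCP

/-! The algebra L(K) ⊗ L^∞(ν) has essentially one kind of normal representation: b ⊗ f acts as b ⊗
ϖ(f) on K ⊗ F, where ϖ is a normal representation of L^∞(ν) on F. If F is separable, multiplicity
theory turns ϖ into the diagonal representation on a direct integral. The theorem is therefore
Stinespring's theorem for S, followed by multiplicity theory. Covariance comes from the rigidity of
minimal dilations: an operator is determined by its values on a total family, and it is isometric as
soon as the Gram matrices agree.

Existence. The kernel S_{d*d'}(v,w) is positive, and its reproducing kernel space carries a
representation π (`IsCPForm.exists_gns`). Normality of S makes π strongly continuous along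
increasing nets of projections (`IsGNS.tendsto_apply`). For the finite-rank projections of K this
reduces every element to combinations of operators b ⊗ f (`compress_mem_span`), which gives totality
and also uniqueness (`eq_of_elem_eq`). For unions of sets it gives countable additivity. If e is a
unit vector, the range of π(|e⟩⟨e| ⊗ 1) is the multiplicity space F (`exists_equiv_of_rep`). It is a
Naimark dilation space, hence separable by assumption, and `exists_directIntegral_equiv` makes it a
direct integral.

Covariance. Sending (b ⊗ f̂)(Yv)h to (u_g b u_g* ⊗ γ_g f)(Y U(g)v)h preserves inner products, so it
defines a unitary representation W. The operator (u_g* ⊗ 1)W_g commutes with L(K) ⊗ 1, hence equals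
1 ⊗ y_g (`exists_eq_opTensor_one`). The operator y_g translates L^∞(ν). Composed with a weighted
translation it commutes with L^∞(ν) and is decomposable (`exists_isometry_field`). Its fibres are
the unitaries y(g,ω); they identify H_{n(g⁻¹ω)} with H_{n(ω)}, so n is invariant. Multiplicativity
read fibre by fibre is the cocycle identity, where y_g carries the conjugate of the multiplier of
u_g.

Second marginal and channel. The vectors (1 ⊗ f̂)(Yv)h span an invariant separable subspace of K ⊗
H_⊕, to which the same multiplicity theorem applies; this gives the dilation of S². For any dilation
Y of S, the map f̂(Kv)h ↦ (1 ⊗ f̂)(Yv)h preserves inner products, and it extends to the isometry C.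
The remaining claims express that C intertwines the actions of L^∞(ν) and of G, both globally and in
almost every fibre. -/

open Filter Topology

set_option linter.unusedSectionVars false

namespace CovariantCP

noncomputable section

/-! ### Isometries and bounded operators determined by a total family -/

section TotalFamilies

variable {E E' ι : Type*} [NormedAddCommGroup E] [InnerProductSpace ℂ E]
  [NormedAddCommGroup E'] [InnerProductSpace ℂ E']

lemma denseRange_linearCombination {a : ι → E}
    (ha : Dense (Submodule.span ℂ (Set.range a) : Set E)) :
    DenseRange (Finsupp.linearCombination ℂ a) := by
  rw [← Finsupp.range_linearCombination] at ha
  exact ha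

lemma dense_span_of_forall_inner_eq_zero [CompleteSpace E] {s : Set E}
    (h : ∀ x, (∀ a ∈ s, ⟪a, x⟫_ℂ = 0) → x = 0) : Dense (Submodule.span ℂ s : Set E) := by
  rw [Submodule.dense_iff_topologicalClosure_eq_top, Submodule.topologicalClosure_eq_top_iff,
    Submodule.eq_bot_iff]
  exact fun x hx => h x fun a ha => hx a (Submodule.subset_span ha)

/-- The inequality between norms of linear combinations settles well-definedness and boundedness
together, so the family `a` need not be linearly independent. -/
lemma exists_clm_of_norm_le [CompleteSpace E'] {a : ι → E} {b : ι → E'}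
    (ha : Dense (Submodule.span ℂ (Set.range a) : Set E)) {C : ℝ} (hC : 0 ≤ C)
    (h : ∀ c : ι →₀ ℂ, ‖Finsupp.linearCombination ℂ b c‖ ≤ C * ‖Finsupp.linearCombination ℂ a c‖) :
    ∃ T : E →L[ℂ] E', (∀ i, T (a i) = b i) ∧ ‖T‖ ≤ C := by
  refine ⟨(Finsupp.linearCombination ℂ b).extendOfNorm (Finsupp.linearCombination ℂ a), ?_,
    LinearMap.opNorm_extendOfNorm_le (denseRange_linearCombination ha) hC h⟩
  intro i
  have := LinearMap.extendOfNorm_eq (denseRange_linearCombination ha) ⟨C, h⟩ (Finsupp.single i 1)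
  simpa using this

lemma inner_linearCombination_self (a : ι → E) (c : ι →₀ ℂ) :
    ⟪Finsupp.linearCombination ℂ a c, Finsupp.linearCombination ℂ a c⟫_ℂ =
      ∑ i ∈ c.support, ∑ j ∈ c.support, conj (c i) * (c j * ⟪a i, a j⟫_ℂ) := by
  simp only [Finsupp.linearCombination_apply, Finsupp.sum, sum_inner, inner_sum, inner_smul_left,
    inner_smul_right, Finset.mul_sum]
  rw [Finset.sum_comm]
  exact Finset.sum_congr rfl fun i _ => Finset.sum_congr rfl fun j _ => by ring

/-- The norm of a linear combination depends only on the Gram matrix of the family. Nearly every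
operator of the proof is obtained in this way. -/
lemma exists_linearIsometry_of_inner_eq [CompleteSpace E'] {a : ι → E} {b : ι → E'}
    (ha : Dense (Submodule.span ℂ (Set.range a) : Set E))
    (h : ∀ i j, ⟪a i, a j⟫_ℂ = ⟪b i, b j⟫_ℂ) : ∃ T : E →ₗᵢ[ℂ] E', ∀ i, T (a i) = b i := by
  have hn (c : ι →₀ ℂ) :
      ‖Finsupp.linearCombination ℂ b c‖ = ‖Finsupp.linearCombination ℂ a c‖ := by
    have : ⟪Finsupp.linearCombination ℂ b c, Finsupp.linearCombination ℂ b c⟫_ℂ =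
        ⟪Finsupp.linearCombination ℂ a c, Finsupp.linearCombination ℂ a c⟫_ℂ := by
      simp only [inner_linearCombination_self, h]
    rw [inner_self_eq_norm_sq_to_K, inner_self_eq_norm_sq_to_K] at this
    exact (sq_eq_sq₀ (norm_nonneg _) (norm_nonneg _)).1 (by exact_mod_cast this)
  have hd := denseRange_linearCombination ha
  have hn' : ∃ C, ∀ c : ι →₀ ℂ,
      ‖Finsupp.linearCombination ℂ b c‖ ≤ C * ‖Finsupp.linearCombination ℂ a c‖ :=
    ⟨1, fun c => by rw [hn, one_mul]⟩
  have hext := LinearMap.extendOfNorm_eq hd hn'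
  refine ⟨⟨((Finsupp.linearCombination ℂ b).extendOfNorm (Finsupp.linearCombination ℂ a)).toLinearMap,
    fun x => ?_⟩, fun i => ?_⟩
  · refine hd.induction_on x (isClosed_eq ?_ continuous_norm) fun c => ?_
    · exact continuous_norm.comp (ContinuousLinearMap.continuous _)
    · exact (congrArg norm (hext c)).trans (hn c)
  · have := hext (Finsupp.single i 1)
    simpa using this

/-- The range of an isometry on a complete space is closed, so it is everything once it contains a
total set. -/
lemma surjective_of_dense_span [CompleteSpace E] (T : E →ₗᵢ[ℂ] E') {s : Set E'}
    (hs : Dense (Submodule.span ℂ s : Set E')) (h : ∀ x ∈ s, ∃ y, T y = x) :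
    Function.Surjective T := by
  have hc : IsClosed (LinearMap.range T.toLinearMap : Set E') := by
    rw [LinearMap.coe_range]
    exact T.isometry.isClosedEmbedding.isClosed_range
  have hle : Submodule.span ℂ s ≤ LinearMap.range T.toLinearMap :=
    Submodule.span_le.2 fun x hx => h x hx
  intro x
  have : x ∈ (LinearMap.range T.toLinearMap : Set E') :=
    hc.closure_subset_iff.2 (SetLike.coe_subset_coe.2 hle) (hs x)
  exact this

lemma exists_linearIsometryEquiv_of_inner_eq [CompleteSpace E] [CompleteSpace E'] {a : ι → E}
    {b : ι → E'} (ha : Dense (Submodule.span ℂ (Set.range a) : Set E))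
    (hb : Dense (Submodule.span ℂ (Set.range b) : Set E'))
    (h : ∀ i j, ⟪a i, a j⟫_ℂ = ⟪b i, b j⟫_ℂ) : ∃ T : E ≃ₗᵢ[ℂ] E', ∀ i, T (a i) = b i := by
  obtain ⟨T, hT⟩ := exists_linearIsometry_of_inner_eq ha h
  refine ⟨LinearIsometryEquiv.ofSurjective T (surjective_of_dense_span T hb ?_), hT⟩
  rintro _ ⟨i, rfl⟩
  exact ⟨a i, hT i⟩

end TotalFamilies

/-! ### Suprema of increasing families of operators -/

section MonotoneConvergence

variable {E : Type*} [NormedAddCommGroup E] [InnerProductSpace ℂ E] [CompleteSpace E]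

lemma isPositive_of_inner_nonneg {T : E →L[ℂ] E} (h : ∀ x, 0 ≤ ⟪T x, x⟫_ℂ) : T.IsPositive := by
  rw [ContinuousLinearMap.isPositive_iff_complex]
  intro x
  obtain ⟨h1, h2⟩ := Complex.le_def.1 (h x)
  exact ⟨Complex.ext (by simp) (by simpa using h2), by simpa using h1⟩

lemma inner_mono {S T : E →L[ℂ] E} (h : S ≤ T) (x : E) : ⟪S x, x⟫_ℂ ≤ ⟪T x, x⟫_ℂ := by
  have := (ContinuousLinearMap.le_def S T).1 h |>.inner_nonneg_left x
  rwa [sub_apply, inner_sub_left, sub_nonneg] at this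

/-- An upper bound to which a family of operators converges weakly is its supremum. -/
lemma isLUB_of_tendsto {ι : Type*} {l : Filter ι} [l.NeBot] {a : ι → E →L[ℂ] E} {s : E →L[ℂ] E}
    (hle : ∀ i, a i ≤ s) (h : ∀ x, Tendsto (fun i => ⟪a i x, x⟫_ℂ) l (𝓝 ⟪s x, x⟫_ℂ)) :
    IsLUB (Set.range a) s := by
  refine ⟨by rintro _ ⟨i, rfl⟩; exact hle i, fun t ht => ?_⟩
  rw [ContinuousLinearMap.le_def]
  refine isPositive_of_inner_nonneg fun x => ?_
  rw [sub_apply, inner_sub_left, sub_nonneg]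
  exact le_of_tendsto' (h x) fun i => inner_mono (ht ⟨i, rfl⟩) x

/-- **Vigier's theorem**: the supremum of an increasing family is its weak limit. -/
theorem tendsto_inner_of_isLUB {D : Set (E →L[ℂ] E)} (hne : D.Nonempty)
    (hdir : DirectedOn (· ≤ ·) D) {s : E →L[ℂ] E} (hs : IsLUB D s) (x y : E) :
    Tendsto (fun d : D => ⟪(d : E →L[ℂ] E) x, y⟫_ℂ) atTop (𝓝 ⟪s x, y⟫_ℂ) := by
  have : Nonempty D := hne.to_subtype
  have : IsDirected D (· ≤ ·) := by
    refine ⟨fun a b => ?_⟩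
    obtain ⟨c, hc, h1, h2⟩ := hdir a a.2 b b.2
    exact ⟨⟨c, hc⟩, h1, h2⟩
  have : IsDirectedOrder D := this
  obtain ⟨d₀⟩ := ‹Nonempty D›
  set A : D → (E →L[ℂ] E) := fun d => s - d with hA
  have hA0 : ∀ d, 0 ≤ A d := fun d => sub_nonneg.2 (hs.1 d.2)
  have hanti : Antitone A := fun a b hab => sub_le_sub_left (show (a : E →L[ℂ] E) ≤ b from hab) s
  have hdiag : ∀ x, ∃ l : ℂ, Tendsto (fun d => ⟪A d x, x⟫_ℂ) atTop (𝓝 l) := by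
    intro x
    have h0 : ∀ d, ⟪A d x, x⟫_ℂ = ((⟪A d x, x⟫_ℂ).re : ℂ) := fun d => by
      have := ((ContinuousLinearMap.isPositive_iff_complex _).1
        ((ContinuousLinearMap.nonneg_iff_isPositive _).1 (hA0 d)) x).1
      exact this.symm
    have hmono : Antitone fun d => (⟪A d x, x⟫_ℂ).re := fun a b hab =>
      (Complex.le_def.1 (inner_mono (hanti hab) x)).1
    have hbdd : BddBelow (Set.range fun d => (⟪A d x, x⟫_ℂ).re) := by
      refine ⟨0, ?_⟩
      rintro _ ⟨d, rfl⟩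
      have := inner_mono (hA0 d) x
      rw [zero_apply, inner_zero_left] at this
      exact (Complex.le_def.1 this).1
    refine ⟨((⨅ d, (⟪A d x, x⟫_ℂ).re : ℝ) : ℂ), ?_⟩
    exact ((Complex.continuous_ofReal.tendsto _).comp (tendsto_atTop_ciInf hmono hbdd)).congr
      fun d => (h0 d).symm
  -- Polarization transfers convergence from the diagonal, where the values decrease and are
  -- nonnegative, to all matrix elements.
  have hall : ∀ x y, ∃ l : ℂ, Tendsto (fun d => ⟪A d x, y⟫_ℂ) atTop (𝓝 l) := by
    intro x y
    obtain ⟨l1, h1⟩ := hdiag (y + x)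
    obtain ⟨l2, h2⟩ := hdiag (y - x)
    obtain ⟨l3, h3⟩ := hdiag (y + Complex.I • x)
    obtain ⟨l4, h4⟩ := hdiag (y - Complex.I • x)
    refine ⟨(l1 - l2 + Complex.I * l3 - Complex.I * l4) / 4, ?_⟩
    have := (((h1.sub h2).add (h3.const_mul Complex.I)).sub (h4.const_mul Complex.I)).div_const 4
    refine this.congr fun d => ?_
    have := inner_map_polarization (A d).toLinearMap y x
    exact this.symm
  choose B hB using hall
  -- The net need not be bounded as a whole, but beyond `d₀` it lies between 0 and `A d₀`, which
  -- bounds the limit form.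
  have hbound : ∀ x y, ‖B x y‖ ≤ ‖A d₀‖ * ‖x‖ * ‖y‖ := by
    intro x y
    refine le_of_tendsto (hB x y).norm ?_
    filter_upwards [eventually_ge_atTop d₀] with d hd
    refine (norm_inner_le_norm _ _).trans ?_
    gcongr
    refine ((A d).le_opNorm x).trans ?_
    gcongr
    exact CStarAlgebra.norm_le_norm_of_nonneg_of_le (hA0 d) (hanti hd)
  let Bf : E →L⋆[ℂ] E →L[ℂ] ℂ :=
    LinearMap.mkContinuous₂ (LinearMap.mk₂'ₛₗ (starRingEnd ℂ) (RingHom.id ℂ) B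
      (fun x x' y => tendsto_nhds_unique (hB (x + x') y)
        (((hB x y).add (hB x' y)).congr fun d => by rw [map_add, inner_add_left]))
      (fun c x y => tendsto_nhds_unique (hB (c • x) y)
        (((hB x y).const_mul (conj c)).congr fun d => by rw [map_smul, inner_smul_left]))
      (fun x y y' => tendsto_nhds_unique (hB x (y + y'))
        (((hB x y).add (hB x y')).congr fun d => by rw [inner_add_right]))
      (fun c x y => tendsto_nhds_unique (hB x (c • y))
        (((hB x y).const_mul c).congr fun d => by rw [inner_smul_right])))
      ‖A d₀‖ hbound
  set R := InnerProductSpace.continuousLinearMapOfBilin Bf with hR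
  have hRB : ∀ x y, ⟪R x, y⟫_ℂ = B x y := fun x y =>
    InnerProductSpace.continuousLinearMapOfBilin_apply Bf x y
  have hlim : ∀ x y, Tendsto (fun d => ⟪A d x, y⟫_ℂ) atTop (𝓝 ⟪R x, y⟫_ℂ) := fun x y => by
    rw [hRB]; exact hB x y
  have hR0 : 0 ≤ R := by
    rw [ContinuousLinearMap.nonneg_iff_isPositive]
    refine isPositive_of_inner_nonneg fun x => ge_of_tendsto' (hlim x x) fun d => ?_
    simpa using inner_mono (hA0 d) x
  have hRle : ∀ d, R ≤ A d := fun d => by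
    rw [ContinuousLinearMap.le_def]
    refine isPositive_of_inner_nonneg fun x => ?_
    rw [sub_apply, inner_sub_left, sub_nonneg]
    refine le_of_tendsto (hlim x x) ?_
    filter_upwards [eventually_ge_atTop d] with d' hd'
    exact inner_mono (hanti hd') x
  -- The limit `R` of the net `s - d` lies below each of its members, so `s - R` is still an upper
  -- bound of `D`. Minimality of `s` forces `R = 0`.
  have hR1 : s ≤ s - R := hs.2 fun d hd => le_sub_comm.1 (hRle ⟨d, hd⟩)
  have hRz : R = 0 := le_antisymm (by simpa using hR1) hR0
  have := hlim x y
  rw [hRz, zero_apply, inner_zero_left] at this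
  have h2 := (tendsto_const_nhds (x := ⟪s x, y⟫_ℂ)).sub this
  rw [sub_zero] at h2
  exact h2.congr fun d => by simp [hA]

end MonotoneConvergence

/-! ### Sigma-strong density -/

section SigmaStrong

variable {H H' : Type*} [NormedAddCommGroup H] [InnerProductSpace ℂ H] [CompleteSpace H]
  [NormedAddCommGroup H'] [InnerProductSpace ℂ H']

/-- Since m |h⟩⟨e| = |m h⟩⟨e|, stability under right multiplication puts the rank one operators |m
h⟩⟨e| into `s`. Density of the vectors m h then puts all rank one operators, hence all finite-rank
ones, into the norm closure. -/
lemma comp_starProjection_mem_closure (s : Submodule ℂ (H →L[ℂ] H'))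
    (hr : ∀ m ∈ s, ∀ a : H →L[ℂ] H, m ∘L a ∈ s)
    (hd : Dense (Submodule.span ℂ {x : H' | ∃ m ∈ s, ∃ h, x = m h} : Set H'))
    (T : H →L[ℂ] H') (W : Submodule ℂ H) [FiniteDimensional ℂ W] :
    T ∘L W.starProjection ∈ s.topologicalClosure := by
  have hrank : ∀ (η : H') (e : H), InnerProductSpace.rankOne ℂ η e ∈ s.topologicalClosure := by
    intro η e
    let S : Submodule ℂ H' :=
      { carrier := {η | InnerProductSpace.rankOne ℂ η e ∈ s.topologicalClosure}
        add_mem' := fun {a b} ha hb => by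
          simpa using s.topologicalClosure.add_mem ha hb
        zero_mem' := by simp
        smul_mem' := fun c a ha => by
          simpa using s.topologicalClosure.smul_mem c ha }
    have hSc : IsClosed (S : Set H') := by
      refine (Submodule.isClosed_topologicalClosure s).preimage
        (f := fun η : H' => InnerProductSpace.rankOne ℂ η e) ?_
      fun_prop
    have hS : Submodule.span ℂ {x : H' | ∃ m ∈ s, ∃ h, x = m h} ≤ S := by
      refine Submodule.span_le.2 ?_
      rintro _ ⟨m, hm, h, rfl⟩
      refine s.le_topologicalClosure ?_
      have := hr m hm (InnerProductSpace.rankOne ℂ h e)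
      rwa [InnerProductSpace.comp_rankOne] at this
    exact hSc.closure_subset_iff.2 (SetLike.coe_subset_coe.2 hS) (hd η)
  have heq : T ∘L W.starProjection =
      ∑ i, InnerProductSpace.rankOne ℂ (T (stdOrthonormalBasis ℂ W i : H))
        (stdOrthonormalBasis ℂ W i : H) := by
    ext x
    have : W.starProjection x = ∑ i, ⟪(stdOrthonormalBasis ℂ W i : H), x⟫_ℂ •
        (stdOrthonormalBasis ℂ W i : H) := by
      rw [Submodule.starProjection_apply, (stdOrthonormalBasis ℂ W).orthogonalProjectionOnto_apply_eq_sum]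
      simp
    simp [this, InnerProductSpace.rankOne_apply]
  rw [heq]
  exact Submodule.sum_mem _ fun i _ => hrank _ _

/-- A square summable sequence is, up to a small tail, contained in a finite-dimensional subspace.
There norm approximation of T composed with the projection suffices, and the tail is controlled by
‖T‖. Minimality can thus be checked on vectors. -/
theorem sigmaStronglyDense_of_dense (s : Submodule ℂ (H →L[ℂ] H'))
    (hr : ∀ m ∈ s, ∀ a : H →L[ℂ] H, m ∘L a ∈ s)
    (hd : Dense (Submodule.span ℂ {x : H' | ∃ m ∈ s, ∃ h, x = m h} : Set H')) :
    SigmaStronglyDense (s : Set (H →L[ℂ] H')) := by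
  intro T ξ hξ ε hε
  set B := ∑' j, ‖ξ j‖ ^ 2 with hB
  have hB0 : 0 ≤ B := tsum_nonneg fun j => sq_nonneg _
  -- From (a + b)² ≤ 2(a² + b²) the tail enters with the factor 2‖T‖² and contributes at most ε/2.
  -- The summand 1 avoids division by zero when T = 0.
  obtain ⟨N, hN⟩ : ∃ N, ∑' j, ‖ξ (j + N)‖ ^ 2 < ε / (4 * (‖T‖ ^ 2 + 1)) := by
    have := tendsto_sum_nat_add (fun j => ‖ξ j‖ ^ 2)
    have h0 : 0 < ε / (4 * (‖T‖ ^ 2 + 1)) := by positivity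
    exact (this.eventually (gt_mem_nhds h0)).exists
  set W : Submodule ℂ H := Submodule.span ℂ (ξ '' Set.Iio N) with hW
  have : FiniteDimensional ℂ W :=
    FiniteDimensional.span_of_finite ℂ ((Set.finite_Iio N).image ξ)
  set p := W.starProjection with hp
  -- The norm error contributes 2δ²B ≤ ε/4, so the total is at most 3ε/4.
  obtain ⟨δ, hδ, hδ'⟩ : ∃ δ > 0, 2 * δ ^ 2 * B ≤ ε / 4 := by
    refine ⟨√(ε / (8 * (B + 1))), Real.sqrt_pos.2 (by positivity), ?_⟩
    rw [Real.sq_sqrt (by positivity)]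
    have : 2 * (ε / (8 * (B + 1))) * B = ε / 4 * (B / (B + 1)) := by field_simp; ring
    rw [this]
    exact mul_le_of_le_one_right (by positivity) (div_le_one_of_le₀ (by linarith) (by positivity))
  obtain ⟨m, hm, hmT⟩ := Metric.mem_closure_iff.1
    (comp_starProjection_mem_closure s hr hd T W) δ hδ
  rw [dist_eq_norm] at hmT
  refine ⟨m, hm, ?_⟩
  set v : ℕ → ℝ := fun j => 2 * δ ^ 2 * ‖ξ j‖ ^ 2 +
    2 * ‖T‖ ^ 2 * (if j < N then 0 else ‖ξ j‖ ^ 2) with hv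
  have hv2 : Summable fun j => if j < N then (0 : ℝ) else ‖ξ j‖ ^ 2 := by
    refine Summable.of_nonneg_of_le (fun j => ?_) (fun j => ?_) hξ <;> split_ifs <;>
      first | positivity | exact le_rfl
  have hvs : Summable v := (hξ.mul_left _).add (hv2.mul_left _)
  have hle : ∀ j, ‖T (ξ j) - m (ξ j)‖ ^ 2 ≤ v j := by
    intro j
    have e1 : T (ξ j) - m (ξ j) = T (ξ j - p (ξ j)) + (T ∘L p - m) (ξ j) := by
      simp
    have e2 : ‖(T ∘L p - m) (ξ j)‖ ≤ δ * ‖ξ j‖ :=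
      ((T ∘L p - m).le_opNorm _).trans (by gcongr)
    have e3 : ‖T (ξ j - p (ξ j))‖ ^ 2 ≤ ‖T‖ ^ 2 * (if j < N then 0 else ‖ξ j‖ ^ 2) := by
      split_ifs with hj
      · have : ξ j - p (ξ j) = 0 := by
          rw [sub_eq_zero]
          exact (Submodule.starProjection_eq_self_iff.2
            (Submodule.subset_span (Set.mem_image_of_mem ξ (Set.mem_Iio.2 hj)))).symm
        simp [this]
      · rw [← mul_pow]
        gcongr
        refine (T.le_opNorm _).trans ?_
        gcongr
        have : ξ j - p (ξ j) = Wᗮ.starProjection (ξ j) := by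
          rw [Submodule.starProjection_orthogonal]; simp [hp]
        rw [this]
        exact Submodule.norm_starProjection_apply_le _ _
    calc ‖T (ξ j) - m (ξ j)‖ ^ 2 ≤ (‖T (ξ j - p (ξ j))‖ + ‖(T ∘L p - m) (ξ j)‖) ^ 2 := by
          rw [e1]; gcongr; exact norm_add_le _ _
      _ ≤ 2 * (‖T (ξ j - p (ξ j))‖ ^ 2 + ‖(T ∘L p - m) (ξ j)‖ ^ 2) := add_sq_le
      _ ≤ 2 * (‖T‖ ^ 2 * (if j < N then 0 else ‖ξ j‖ ^ 2) + (δ * ‖ξ j‖) ^ 2) := by gcongr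
      _ = v j := by rw [hv]; ring
  have hus : Summable fun j => ‖T (ξ j) - m (ξ j)‖ ^ 2 :=
    Summable.of_nonneg_of_le (fun j => sq_nonneg _) hle hvs
  have htail : ∑' j, (if j < N then (0 : ℝ) else ‖ξ j‖ ^ 2) = ∑' j, ‖ξ (j + N)‖ ^ 2 := by
    rw [← hv2.sum_add_tsum_nat_add N, Finset.sum_eq_zero, zero_add]
    · simp
    · intro j hj
      simp [Finset.mem_range.1 hj]
  calc ∑' j, ‖T (ξ j) - m (ξ j)‖ ^ 2 ≤ ∑' j, v j := hus.tsum_le_tsum hle hvs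
    _ = 2 * δ ^ 2 * B + 2 * ‖T‖ ^ 2 * ∑' j, ‖ξ (j + N)‖ ^ 2 := by
        rw [hv, (hξ.mul_left _).tsum_add (hv2.mul_left _), tsum_mul_left, tsum_mul_left, htail]
    _ ≤ ε / 4 + 2 * ‖T‖ ^ 2 * (ε / (4 * (‖T‖ ^ 2 + 1))) := by gcongr
    _ ≤ ε / 4 + ε / 2 := by
        have : 2 * ‖T‖ ^ 2 * (ε / (4 * (‖T‖ ^ 2 + 1))) = ε / 2 * (‖T‖ ^ 2 / (‖T‖ ^ 2 + 1)) := by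
          field_simp; ring
        rw [this]
        gcongr
        exact mul_le_of_le_one_right (by positivity)
          (div_le_one_of_le₀ (by linarith) (by positivity))
    _ < ε := by linarith

end SigmaStrong

/-! ### Convergence on total sets -/

section TotalConvergence

variable {E F ι : Type*} [NormedAddCommGroup E] [InnerProductSpace ℂ E]
  [NormedAddCommGroup F] [NormedSpace ℂ F]

lemma tendsto_apply_of_dense {l : Filter ι} {T : ι → E →L[ℂ] F} {T₀ : E →L[ℂ] F} {C : ℝ}
    (hC : ∀ᶠ i in l, ‖T i‖ ≤ C) {s : Set E} (hs : Dense (Submodule.span ℂ s : Set E))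
    (h : ∀ x ∈ s, Tendsto (fun i => T i x) l (𝓝 (T₀ x))) (x : E) :
    Tendsto (fun i => T i x) l (𝓝 (T₀ x)) := by
  have hspan : ∀ x ∈ Submodule.span ℂ s, Tendsto (fun i => T i x) l (𝓝 (T₀ x)) := by
    intro x hx
    induction hx using Submodule.span_induction with
    | mem x hx => exact h x hx
    | zero => simpa only [map_zero] using tendsto_const_nhds
    | add x y _ _ hx hy => simpa using hx.add hy
    | smul c x _ hx => simpa using hx.const_smul c
  rw [Metric.tendsto_nhds]
  intro ε hε
  have hC' : 0 < |C| + ‖T₀‖ + 1 := by positivity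
  obtain ⟨y, hy, hxy⟩ := Metric.mem_closure_iff.1 (hs x) (ε / (2 * (|C| + ‖T₀‖ + 1)))
    (by positivity)
  filter_upwards [hC, Metric.tendsto_nhds.1 (hspan y hy) (ε / 2) (by positivity)] with i h1 h2
  rw [dist_eq_norm] at *
  have e : T i x - T₀ x = T i (x - y) - T₀ (x - y) + (T i y - T₀ y) := by
    simp only [map_sub]; abel
  calc ‖T i x - T₀ x‖ ≤ ‖T i (x - y)‖ + ‖T₀ (x - y)‖ + ‖T i y - T₀ y‖ := by
        rw [e]; exact (norm_add_le _ _).trans (by gcongr; exact norm_sub_le _ _)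
    _ ≤ |C| * ‖x - y‖ + ‖T₀‖ * ‖x - y‖ + ‖T i y - T₀ y‖ := by
        gcongr
        · exact (T i).le_of_opNorm_le (h1.trans (le_abs_self C)) _
        · exact T₀.le_opNorm _
    _ ≤ (|C| + ‖T₀‖ + 1) * ‖x - y‖ + ‖T i y - T₀ y‖ := by nlinarith [norm_nonneg (x - y)]
    _ < (|C| + ‖T₀‖ + 1) * (ε / (2 * (|C| + ‖T₀‖ + 1))) + ε / 2 := by gcongr
    _ = ε := by field_simp; ring

end TotalConvergence

lemma zero_le_inner_self {E : Type*} [NormedAddCommGroup E] [InnerProductSpace ℂ E] (x : E) :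
    0 ≤ ⟪x, x⟫_ℂ := by
  have h : ⟪x, x⟫_ℂ = ((‖x‖ ^ 2 : ℝ) : ℂ) := by
    rw [inner_self_eq_norm_sq_to_K]; push_cast; rfl
  rw [h]
  exact Complex.zero_le_real.2 (sq_nonneg _)

lemma tendsto_inner_comm {E ι : Type*} [NormedAddCommGroup E] [InnerProductSpace ℂ E]
    {l : Filter ι} {f : ι → E} {a y : E} (h : Tendsto (fun i => ⟪f i, y⟫_ℂ) l (𝓝 ⟪a, y⟫_ℂ)) :
    Tendsto (fun i => ⟪y, f i⟫_ℂ) l (𝓝 ⟪y, a⟫_ℂ) := by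
  simpa only [RCLike.star_def, inner_conj_symm] using h.star

/-- The density argument is applied twice, once in each argument of the inner product, with the
uniform norm bound used both times. -/
lemma tendsto_inner_of_dense {E ι : Type*} [NormedAddCommGroup E] [InnerProductSpace ℂ E]
    {l : Filter ι} {T : ι → E →L[ℂ] E} {T₀ : E →L[ℂ] E} {C : ℝ}
    (hC : ∀ᶠ i in l, ‖T i‖ ≤ C) {s : Set E} (hs : Dense (Submodule.span ℂ s : Set E))
    (h : ∀ x ∈ s, ∀ y ∈ s, Tendsto (fun i => ⟪y, T i x⟫_ℂ) l (𝓝 ⟪y, T₀ x⟫_ℂ)) (x y : E) :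
    Tendsto (fun i => ⟪y, T i x⟫_ℂ) l (𝓝 ⟪y, T₀ x⟫_ℂ) := by
  have h1 : ∀ y ∈ s, ∀ x, Tendsto (fun i => ⟪y, T i x⟫_ℂ) l (𝓝 ⟪y, T₀ x⟫_ℂ) := by
    intro y hy x
    refine tendsto_apply_of_dense (T := fun i => innerSL ℂ y ∘L T i) (T₀ := innerSL ℂ y ∘L T₀)
      (C := ‖y‖ * C) ?_ hs (fun x hx => h x hx y hy) x
    filter_upwards [hC] with i hi
    refine (ContinuousLinearMap.opNorm_comp_le _ _).trans ?_
    rw [innerSL_apply_norm]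
    gcongr
  have h2 : Tendsto (fun i => ⟪T i x, y⟫_ℂ) l (𝓝 ⟪T₀ x, y⟫_ℂ) := by
    refine tendsto_apply_of_dense (T := fun i => innerSL ℂ (T i x)) (T₀ := innerSL ℂ (T₀ x))
      (C := C * ‖x‖) ?_ hs (fun y hy => ?_) y
    · filter_upwards [hC] with i hi
      rw [innerSL_apply_norm]
      exact (T i).le_of_opNorm_le hi x
    · have := (h1 y hy x).star
      show Tendsto (fun i => ⟪T i x, y⟫_ℂ) l (𝓝 ⟪T₀ x, y⟫_ℂ)
      simpa only [RCLike.star_def, inner_conj_symm] using this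
  exact tendsto_inner_comm h2

/-! ### Operators on Hilbert space tensor products -/

section Tensor

variable {E F G : Type*} [NormedAddCommGroup E] [InnerProductSpace ℂ E]
  [NormedAddCommGroup F] [InnerProductSpace ℂ F] [NormedAddCommGroup G] [NormedSpace ℂ G]

lemma dense_span_tmulL (s : Set E) (t : Set F) (hs : Dense (Submodule.span ℂ s : Set E))
    (ht : Dense (Submodule.span ℂ t : Set F)) :
    Dense (Submodule.span ℂ {z | ∃ x ∈ s, ∃ y ∈ t, z = tmulL x y} : Set (HilbertTensor E F)) := by
  set S := (Submodule.span ℂ {z : HilbertTensor E F |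
    ∃ x ∈ s, ∃ y ∈ t, z = tmulL x y}).topologicalClosure with hS
  have hSc : IsClosed (S : Set (HilbertTensor E F)) := Submodule.isClosed_topologicalClosure _
  have hcont : ∀ y : F, Continuous fun x : E => (tmulL x y : HilbertTensor E F) := fun y => by
    refine (HilbertTensor.ofAlg E F).continuous.comp ?_
    exact TensorProduct.continuous_tmul.comp (by fun_prop : Continuous fun x : E => (x, y))
  have h1 : ∀ x ∈ s, ∀ y, (tmulL x y : HilbertTensor E F) ∈ S := by
    intro x hx y
    have hle : Submodule.span ℂ t ≤ S.comap (tmulL x : F →L[ℂ] HilbertTensor E F).toLinearMap :=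
      Submodule.span_le.2 fun y hy =>
        Submodule.le_topologicalClosure _ (Submodule.subset_span ⟨x, hx, y, hy, rfl⟩)
    have hc : IsClosed {y | (tmulL x y : HilbertTensor E F) ∈ S} :=
      hSc.preimage (ContinuousLinearMap.continuous _)
    exact hc.closure_subset_iff.2 (SetLike.coe_subset_coe.2 hle) (ht y)
  have h2 : ∀ (x : E) (y : F), (tmulL x y : HilbertTensor E F) ∈ S := by
    intro x y
    have hle : Submodule.span ℂ s ≤ S.comap
        ((HilbertTensor.ofAlg E F).toLinearMap ∘ₗ (TensorProduct.mk ℂ E F).flip y) :=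
      Submodule.span_le.2 fun x hx => h1 x hx y
    have hc : IsClosed {x | (tmulL x y : HilbertTensor E F) ∈ S} := hSc.preimage (hcont y)
    exact hc.closure_subset_iff.2 (SetLike.coe_subset_coe.2 hle) (hs x)
  have h3 : ∀ z : E ⊗[ℂ] F, HilbertTensor.ofAlg E F z ∈ S := by
    intro z
    induction z using TensorProduct.induction_on with
    | zero => rw [map_zero]; exact S.zero_mem
    | add z z' hz hz' => rw [map_add]; exact S.add_mem hz hz'
    | tmul x y => exact h2 x y
  intro z
  exact DenseRange.induction_on (HilbertTensor.denseRange_ofAlg E F) z hSc h3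

lemma dense_span_range_tmulL :
    Dense (Submodule.span ℂ (Set.range fun p : E × F => (tmulL p.1 p.2 : HilbertTensor E F)) :
      Set (HilbertTensor E F)) := by
  have := dense_span_tmulL (E := E) (F := F) Set.univ Set.univ (by simp) (by simp)
  convert this using 3
  ext z
  simp [eq_comm]

lemma HilbertTensor.clm_ext {S T : HilbertTensor E F →L[ℂ] G}
    (h : ∀ x y, S (tmulL x y) = T (tmulL x y)) : S = T := by
  refine ContinuousLinearMap.ext_on dense_span_range_tmulL ?_
  rintro _ ⟨p, rfl⟩
  exact h _ _

lemma HilbertTensor.ext_inner [CompleteSpace E] [CompleteSpace F] {z z' : HilbertTensor E F}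
    (h : ∀ x y, ⟪tmulL x y, z⟫_ℂ = ⟪tmulL x y, z'⟫_ℂ) : z = z' := by
  rw [← sub_eq_zero, ← inner_self_eq_zero (𝕜 := ℂ)]
  have : innerSL ℂ (z - z') = 0 := HilbertTensor.clm_ext fun x y => by
    rw [innerSL_apply_apply, zero_apply, ← inner_conj_symm, inner_sub_right, h, sub_self, map_zero]
  rw [← innerSL_apply_apply ℂ, this, zero_apply]

lemma tmulL_add_left (x x' : E) (y : F) :
    (tmulL (x + x') y : HilbertTensor E F) = tmulL x y + tmulL x' y := by
  simp only [tmulL_apply, TensorProduct.add_tmul, map_add]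

lemma tmulL_smul_left (c : ℂ) (x : E) (y : F) :
    (tmulL (c • x) y : HilbertTensor E F) = c • tmulL x y := by
  simp only [tmulL_apply, ← TensorProduct.smul_tmul', map_smul]

instance [TopologicalSpace.SeparableSpace E] [TopologicalSpace.SeparableSpace F] :
    TopologicalSpace.SeparableSpace (HilbertTensor E F) := by
  have hc : Continuous fun p : E × F => (tmulL p.1 p.2 : HilbertTensor E F) :=
    (HilbertTensor.ofAlg E F).continuous.comp TensorProduct.continuous_tmul
  have hsep := (TopologicalSpace.isSeparable_range hc).span (R := ℂ)
  have := hsep.closure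
  rw [(dense_span_range_tmulL (E := E) (F := F)).closure_eq] at this
  exact TopologicalSpace.isSeparable_univ_iff.1 this

lemma opTensor_mul (b b' : E →L[ℂ] E) (c c' : F →L[ℂ] F) :
    opTensor b c * opTensor b' c' = opTensor (b * b') (c * c') :=
  HilbertTensor.clm_ext fun x y => by
    simp only [FunLike.coe_mul_eq_comp, Function.comp_apply, opTensor_tmulL]

lemma opTensor_one : opTensor (1 : E →L[ℂ] E) (1 : F →L[ℂ] F) = 1 :=
  HilbertTensor.clm_ext fun x y => by rw [opTensor_tmulL]; rfl

lemma opTensor_add_left (b b' : E →L[ℂ] E) (c : F →L[ℂ] F) :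
    opTensor (b + b') c = opTensor b c + opTensor b' c :=
  HilbertTensor.clm_ext fun x y => by simp [opTensor_tmulL, tmulL_add_left]

lemma opTensor_smul_left (z : ℂ) (b : E →L[ℂ] E) (c : F →L[ℂ] F) :
    opTensor (z • b) c = z • opTensor b c :=
  HilbertTensor.clm_ext fun x y => by simp [opTensor_tmulL, tmulL_smul_left]

lemma opTensor_add_right (b : E →L[ℂ] E) (c c' : F →L[ℂ] F) :
    opTensor b (c + c') = opTensor b c + opTensor b c' :=
  HilbertTensor.clm_ext fun x y => by simp [opTensor_tmulL]

lemma opTensor_smul_right (z : ℂ) (b : E →L[ℂ] E) (c : F →L[ℂ] F) :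
    opTensor b (z • c) = z • opTensor b c :=
  HilbertTensor.clm_ext fun x y => by simp [opTensor_tmulL]

lemma norm_opTensor_le (b : E →L[ℂ] E) (c : F →L[ℂ] F) : ‖opTensor b c‖ ≤ ‖b‖ * ‖c‖ := by
  refine ContinuousLinearMap.opNorm_le_bound _ (by positivity) fun z => ?_
  refine DenseRange.induction_on (HilbertTensor.denseRange_ofAlg E F) z ?_ fun s => ?_
  · exact isClosed_le (by fun_prop) (by fun_prop)
  · have : opTensor b c (HilbertTensor.ofAlg E F s) =
        HilbertTensor.ofAlg E F (TensorProduct.mapL b c s) :=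
      (TensorProduct.mapL b c).completion_apply_coe s
    rw [this, LinearIsometry.norm_map, LinearIsometry.norm_map]
    exact (TensorProduct.mapL b c).le_of_opNorm_le (TensorProduct.norm_mapL_le b c) s

section Complete

variable [CompleteSpace E] [CompleteSpace F]

lemma star_opTensor (b : E →L[ℂ] E) (c : F →L[ℂ] F) :
    star (opTensor b c) = opTensor (star b) (star c) := by
  refine HilbertTensor.clm_ext fun x y => HilbertTensor.ext_inner fun x' y' => ?_
  rw [ContinuousLinearMap.star_eq_adjoint, ContinuousLinearMap.adjoint_inner_right,
    opTensor_tmulL, opTensor_tmulL, inner_tmulL, inner_tmulL, ContinuousLinearMap.star_eq_adjoint,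
    ContinuousLinearMap.star_eq_adjoint, ContinuousLinearMap.adjoint_inner_right,
    ContinuousLinearMap.adjoint_inner_right]

lemma adjoint_tmulL_tmulL (x x' : E) (y : F) :
    ((tmulL x : F →L[ℂ] HilbertTensor E F)†) (tmulL x' y) = ⟪x, x'⟫_ℂ • y := by
  refine ext_inner_left ℂ fun y' => ?_
  rw [ContinuousLinearMap.adjoint_inner_right, inner_tmulL, inner_smul_right]

/-- The compression y ↦ e ⊗ y by a unit vector e recovers c from 1 ⊗ c. -/
lemma opTensor_one_injective [Nontrivial E] {c c' : F →L[ℂ] F}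
    (h : opTensor (1 : E →L[ℂ] E) c = opTensor 1 c') : c = c' := by
  obtain ⟨e, he⟩ := exists_norm_eq E zero_le_one
  ext y
  have h1 := congrArg (fun T => ((tmulL e : F →L[ℂ] HilbertTensor E F)†) (T (tmulL e y))) h
  simpa only [opTensor_tmulL, one_apply_eq_self, adjoint_tmulL_tmulL, inner_self_eq_norm_sq_to_K, he,
    Complex.ofReal_one, one_pow, one_smul, RCLike.ofReal_one] using h1

/-- An operator commuting with all `b ⊗ 1` is of the form `1 ⊗ c`. -/
theorem exists_eq_opTensor_one [Nontrivial E] (T : HilbertTensor E F →L[ℂ] HilbertTensor E F)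
    (hT : ∀ b : E →L[ℂ] E, T * opTensor b 1 = opTensor b 1 * T) :
    ∃ c : F →L[ℂ] F, T = opTensor 1 c := by
  obtain ⟨e, he⟩ := exists_norm_eq E zero_le_one
  have hee : ⟪e, e⟫_ℂ = 1 := by rw [inner_self_eq_norm_sq_to_K, he]; simp
  refine ⟨(tmulL e : F →L[ℂ] HilbertTensor E F)† ∘L T ∘L tmulL e, ?_⟩
  have hproj : ∀ z : HilbertTensor E F,
      opTensor (InnerProductSpace.rankOne ℂ e e) 1 z =
        tmulL e (((tmulL e : F →L[ℂ] HilbertTensor E F)†) z) := by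
    intro z
    have : opTensor (InnerProductSpace.rankOne ℂ e e) (1 : F →L[ℂ] F) =
        tmulL e ∘L (tmulL e : F →L[ℂ] HilbertTensor E F)† :=
      HilbertTensor.clm_ext fun x y => by
        rw [opTensor_tmulL, ContinuousLinearMap.comp_apply, adjoint_tmulL_tmulL,
          InnerProductSpace.rankOne_apply, tmulL_smul_left, map_smul]; rfl
    rw [this]; rfl
  refine HilbertTensor.clm_ext fun x y => ?_
  -- Since x' ⊗ y = (|x'⟩⟨e| ⊗ 1)(e ⊗ y), commutation determines T on all elementary tensors from
  -- its values at e ⊗ y. The case x' = e shows that T preserves e ⊗ F, which makes the compression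
  -- by e the right choice of c.
  have h1 : ∀ x' : E, T (tmulL x' y) =
      opTensor (InnerProductSpace.rankOne ℂ x' e) 1 (T (tmulL e y)) := by
    intro x'
    have := congrArg (fun S => S (tmulL e y)) (hT (InnerProductSpace.rankOne ℂ x' e))
    simp only [FunLike.coe_mul_eq_comp, Function.comp_apply, opTensor_tmulL,
      InnerProductSpace.rankOne_apply, hee, one_smul, one_apply_eq_self] at this
    exact this
  rw [h1, h1 e, hproj, opTensor_tmulL, opTensor_tmulL, InnerProductSpace.rankOne_apply, hee,
    one_smul]
  rfl

/-- A representation of `L(E)` generated by its rank one operators is a multiple of the identity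
representation. -/
theorem exists_equiv_of_rep {𝓗 : Type*} [NormedAddCommGroup 𝓗] [InnerProductSpace ℂ 𝓗]
    [CompleteSpace 𝓗] (ρ : (E →L[ℂ] E) → (𝓗 →L[ℂ] 𝓗)) (hmul : ∀ a b, ρ (a * b) = ρ a * ρ b)
    (hstar : ∀ a, ρ (star a) = star (ρ a)) (hsmul : ∀ (z : ℂ) a, ρ (z • a) = z • ρ a)
    {e : E} (he : ‖e‖ = 1) (j : F →ₗᵢ[ℂ] 𝓗)
    (hj : ∀ ψ, ∃ η, j η = ρ (InnerProductSpace.rankOne ℂ e e) ψ)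
    (hj' : ∀ η, ρ (InnerProductSpace.rankOne ℂ e e) (j η) = j η)
    (hd : Dense (Submodule.span ℂ {ψ : 𝓗 | ∃ x y φ, ψ = ρ (InnerProductSpace.rankOne ℂ x y) φ} :
      Set 𝓗)) :
    ∃ W : HilbertTensor E F ≃ₗᵢ[ℂ] 𝓗,
      ∀ x η, W (tmulL x η) = ρ (InnerProductSpace.rankOne ℂ x e) (j η) := by
  have hee : ⟪e, e⟫_ℂ = 1 := by rw [inner_self_eq_norm_sq_to_K, he]; simp
  have hb : Dense (Submodule.span ℂ (Set.range fun p : E × F =>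
      ρ (InnerProductSpace.rankOne ℂ p.1 e) (j p.2)) : Set 𝓗) := by
    refine hd.mono (SetLike.coe_subset_coe.2 (Submodule.span_le.2 ?_))
    rintro _ ⟨x, y, φ, rfl⟩
    -- Factor |x⟩⟨y| = |x⟩⟨e| |e⟩⟨y|; the second factor maps into the range of ρ(|e⟩⟨e|), which is
    -- the image of `j`.
    obtain ⟨η, hη⟩ := hj (ρ (InnerProductSpace.rankOne ℂ e y) φ)
    refine Submodule.subset_span ⟨(x, η), ?_⟩
    simp only [hη]
    rw [← mul_apply_eq_comp, ← mul_apply_eq_comp, ← hmul, ← hmul]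
    congr 2
    ext z
    simp [InnerProductSpace.rankOne_apply, he]
  obtain ⟨W, hW⟩ := exists_linearIsometryEquiv_of_inner_eq
    (a := fun p : E × F => (tmulL p.1 p.2 : HilbertTensor E F)) dense_span_range_tmulL hb (by
    rintro ⟨x, η⟩ ⟨x', η'⟩
    rw [inner_tmulL, ← ContinuousLinearMap.adjoint_inner_right,
      ← ContinuousLinearMap.star_eq_adjoint, ← hstar, ← mul_apply_eq_comp, ← hmul]
    -- This identity is the comparison of Gram matrices: ρ(|e⟩⟨e|) acts trivially on the image of
    -- `j`, and the factor ⟪x, x'⟫ is that of the tensor product.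
    have : star (InnerProductSpace.rankOne ℂ x e) * InnerProductSpace.rankOne ℂ x' e =
        ⟪x, x'⟫_ℂ • InnerProductSpace.rankOne ℂ e e := by
      ext z
      simp [ContinuousLinearMap.star_eq_adjoint, InnerProductSpace.rankOne_apply, 
        smul_smul, mul_comm]
    rw [this, hsmul, smul_apply, hj', inner_smul_right, LinearIsometry.inner_map_map])
  exact ⟨W, fun x η => hW (x, η)⟩

end Complete

end Tensor

/-! ### Compressions -/

section Compression

variable {K E F : Type*} [NormedAddCommGroup K] [InnerProductSpace ℂ K] [CompleteSpace K]
  [NormedAddCommGroup E] [InnerProductSpace ℂ E] [CompleteSpace E]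
  [NormedAddCommGroup F] [InnerProductSpace ℂ F] [CompleteSpace F]

lemma opTensor_one_nonneg {b : K →L[ℂ] K} (hb : 0 ≤ b) :
    0 ≤ opTensor b (1 : F →L[ℂ] F) := by
  obtain ⟨c, hc⟩ := CStarAlgebra.nonneg_iff_eq_star_mul_self.1 hb
  have : opTensor b (1 : F →L[ℂ] F) = star (opTensor c 1) * opTensor c 1 := by
    rw [star_opTensor, opTensor_mul, hc, star_one, mul_one]
  rw [this]
  exact star_mul_self_nonneg _

lemma compression_add (C : E →L[ℂ] HilbertTensor K F) (b c : K →L[ℂ] K) :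
    compression C (b + c) = compression C b + compression C c := by
  ext; simp [compression, opTensor_add_left]

lemma compression_smul (C : E →L[ℂ] HilbertTensor K F) (z : ℂ) (b : K →L[ℂ] K) :
    compression C (z • b) = z • compression C b := by
  ext; simp [compression, opTensor_smul_left]

lemma inner_compression (C : E →L[ℂ] HilbertTensor K F) (b : K →L[ℂ] K) (x y : E) :
    ⟪x, compression C b y⟫_ℂ = ⟪C x, opTensor b 1 (C y)⟫_ℂ := by
  rw [compression, ContinuousLinearMap.comp_apply, ContinuousLinearMap.adjoint_inner_right]
  rfl

lemma compression_mono (C : E →L[ℂ] HilbertTensor K F) {b c : K →L[ℂ] K} (h : b ≤ c) :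
    compression C b ≤ compression C c := by
  have h0 := opTensor_one_nonneg (F := F) (sub_nonneg.2 h)
  rw [ContinuousLinearMap.nonneg_iff_isPositive] at h0
  have h1 := h0.adjoint_conj C
  rw [ContinuousLinearMap.le_def]
  convert h1 using 1
  have : c = b + (c - b) := by abel
  conv_lhs => rw [this, compression_add, add_sub_cancel_left]
  rfl

/-- By Vigier's theorem the net converges weakly to its supremum, hence so does b ⊗ 1 on elementary
tensors. The net is bounded beyond any fixed member, which extends weak convergence to all vectors.
A weak limit that bounds the net from above is its supremum. -/
lemma isNormalMap_compression (C : E →L[ℂ] HilbertTensor K F) : IsNormalMap (compression C) := by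
  intro D hne hdir _ s hs
  rw [Set.image_eq_range]
  have : Nonempty D := hne.to_subtype
  have : IsDirectedOrder D := by
    refine ⟨fun a b => ?_⟩
    obtain ⟨c, hc, h1, h2⟩ := hdir a a.2 b b.2
    exact ⟨⟨c, hc⟩, h1, h2⟩
  obtain ⟨d₀⟩ := ‹Nonempty D›
  have hbd : ∀ᶠ d : D in atTop, ‖opTensor (d : K →L[ℂ] K) (1 : F →L[ℂ] F)‖ ≤
      ‖s - d₀‖ + ‖s‖ := by
    filter_upwards [eventually_ge_atTop d₀] with d hd
    refine (norm_opTensor_le _ _).trans ?_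
    have h1 : ‖s - d‖ ≤ ‖s - d₀‖ :=
      CStarAlgebra.norm_le_norm_of_nonneg_of_le (sub_nonneg.2 (hs.1 d.2))
        (sub_le_sub_left (show (d₀ : K →L[ℂ] K) ≤ d from hd) s)
    have h2 : ‖(d : K →L[ℂ] K)‖ ≤ ‖s - d₀‖ + ‖s‖ := by
      have : (d : K →L[ℂ] K) = s - (s - d) := by abel
      rw [this]
      refine (norm_sub_le _ _).trans ?_
      linarith
    have h3 : ‖(1 : F →L[ℂ] F)‖ ≤ 1 := ContinuousLinearMap.norm_id_le
    calc ‖(d : K →L[ℂ] K)‖ * ‖(1 : F →L[ℂ] F)‖ ≤ ‖(d : K →L[ℂ] K)‖ * 1 := by gcongr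
      _ ≤ _ := by rwa [mul_one]
  refine isLUB_of_tendsto (l := atTop) (fun d : D => compression_mono C (hs.1 d.2)) fun x => ?_
  have hw := tendsto_inner_of_dense (T := fun d : D => opTensor (d : K →L[ℂ] K) (1 : F →L[ℂ] F))
    (T₀ := opTensor s 1) hbd dense_span_range_tmulL ?_ (C x) (C x)
  · simp only [← inner_compression] at hw
    simpa only [RCLike.star_def, inner_conj_symm] using hw.star
  · rintro _ ⟨p, rfl⟩ _ ⟨q, rfl⟩
    simp only [opTensor_tmulL, inner_tmulL]
    refine Tendsto.mul_const _ ?_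
    exact tendsto_inner_comm (tendsto_inner_of_isLUB hne hdir hs p.1 q.1)

/-- The sum that expresses complete positivity is the squared norm of Σ (b_i ⊗ 1) C x_i. A general
projection P serves both C itself and its fibres, which are extended by zero. -/
lemma isChannel_compression {P : E →L[ℂ] E} (C : E →L[ℂ] HilbertTensor K F) (hC : C† ∘L C = P) :
    IsChannel P (compression (K := K) C) where
  map_add := compression_add C
  map_smul := compression_smul C
  cp k b x := by
    have : ∑ i, ∑ j, ⟪x i, compression C (star (b i) * b j) (x j)⟫_ℂ =
        ⟪∑ i, opTensor (b i) 1 (C (x i)), ∑ i, opTensor (b i) 1 (C (x i))⟫_ℂ := by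
      rw [sum_inner]
      refine Finset.sum_congr rfl fun i _ => ?_
      rw [inner_sum]
      refine Finset.sum_congr rfl fun j _ => ?_
      rw [inner_compression, ← one_mul (1 : F →L[ℂ] F), ← opTensor_mul]
      conv_lhs => rw [← star_one (R := F →L[ℂ] F), ← star_opTensor]
      rw [mul_apply_eq_comp, ContinuousLinearMap.star_eq_adjoint,
        ContinuousLinearMap.adjoint_inner_right, star_one, one_mul]
    rw [this]
    exact zero_le_inner_self _
  normal := isNormalMap_compression C
  map_one := by
    rw [compression, opTensor_one, ← hC]; rfl

end Compression

/-! ### The algebra `L^∞(ν)` -/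

section LInfty

variable {Ω : Type*} [MeasurableSpace Ω] {ν : Measure Ω}

/-- The product in `L^∞(ν)`. -/
def mulFn (f g : Lp ℂ ∞ ν) : Lp ℂ ∞ ν := f • g

lemma coeFn_mulFn (f g : Lp ℂ ∞ ν) : mulFn f g =ᵐ[ν] fun ω => f ω * g ω :=
  Lp.coeFn_lpSMul f g

lemma coeFn_charFn {X : Set Ω} (hX : MeasurableSet X) :
    charFn ν hX =ᵐ[ν] X.indicator fun _ => (1 : ℂ) :=
  MemLp.coeFn_toLp _

lemma coeFn_oneFn : oneFn ν =ᵐ[ν] fun _ => (1 : ℂ) :=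
  MemLp.coeFn_toLp _

lemma mulFn_charFn {X Y : Set Ω} (hX : MeasurableSet X) (hY : MeasurableSet Y) :
    mulFn (charFn ν hX) (charFn ν hY) = charFn ν (hX.inter hY) := by
  refine Lp.ext ?_
  filter_upwards [coeFn_mulFn (charFn ν hX) (charFn ν hY), coeFn_charFn (ν := ν) hX,
    coeFn_charFn (ν := ν) hY, coeFn_charFn (ν := ν) (hX.inter hY)] with ω h1 h2 h3 h4
  rw [h1, h2, h3, h4, ← Set.inter_indicator_mul]
  simp

lemma star_charFn {X : Set Ω} (hX : MeasurableSet X) : star (charFn ν hX) = charFn ν hX := by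
  refine Lp.ext ?_
  filter_upwards [Lp.coeFn_star (charFn ν hX), coeFn_charFn (ν := ν) hX] with ω h1 h2
  rw [h1, Pi.star_apply, h2]
  by_cases h : ω ∈ X <;> simp [h]

lemma star_oneFn : star (oneFn ν) = oneFn ν := by
  refine Lp.ext ?_
  filter_upwards [Lp.coeFn_star (oneFn ν), coeFn_oneFn (ν := ν)] with ω h1 h2
  rw [h1, Pi.star_apply, h2, star_one]

lemma mulFn_oneFn (f : Lp ℂ ∞ ν) : mulFn f (oneFn ν) = f := by
  refine Lp.ext ?_
  filter_upwards [coeFn_mulFn f (oneFn ν), coeFn_oneFn (ν := ν)] with ω h1 h2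
  rw [h1, h2, mul_one]

lemma oneFn_mulFn (f : Lp ℂ ∞ ν) : mulFn (oneFn ν) f = f := by
  refine Lp.ext ?_
  filter_upwards [coeFn_mulFn (oneFn ν) f, coeFn_oneFn (ν := ν)] with ω h1 h2
  rw [h1, h2, one_mul]

lemma charFn_univ : charFn ν MeasurableSet.univ = oneFn ν := by
  simp [charFn, oneFn]

lemma ae_norm_le_norm (f : Lp ℂ ∞ ν) : ∀ᵐ ω ∂ν, ‖f ω‖ ≤ ‖f‖ := by
  have hne : eLpNormEssSup f ν ≠ ∞ := by
    have := (Lp.memLp f).2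
    rw [eLpNorm_exponent_top] at this
    exact this.ne
  filter_upwards [ae_le_eLpNormEssSup (f := f) (μ := ν)] with ω hω
  rw [Lp.norm_def, eLpNorm_exponent_top, ← toReal_enorm]
  exact ENNReal.toReal_mono hne hω

lemma norm_le_of_ae_norm_le {f : Lp ℂ ∞ ν} {C : ℝ} (hC : 0 ≤ C) (h : ∀ᵐ ω ∂ν, ‖f ω‖ ≤ C) :
    ‖f‖ ≤ C := by
  rw [Lp.norm_def, eLpNorm_exponent_top]
  exact ENNReal.toReal_le_of_le_ofReal hC (eLpNormEssSup_le_of_ae_bound h)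

lemma toLp_simpleFunc_mem_span (g : SimpleFunc Ω ℂ) :
    MemLp.toLp g (g.memLp_top ν) ∈
      Submodule.span ℂ {f : Lp ℂ ∞ ν | ∃ (X : Set Ω) (hX : MeasurableSet X), f = charFn ν hX} := by
  induction g using SimpleFunc.induction with
  | const c hs =>
    rename_i s
    have : MemLp.toLp _ (((SimpleFunc.const Ω c).piecewise s hs (SimpleFunc.const Ω 0)).memLp_top ν) =
        c • charFn ν hs := by
      rw [charFn, ← MemLp.toLp_const_smul]
      refine MemLp.toLp_congr _ _ (Eventually.of_forall fun ω => ?_)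
      by_cases h : ω ∈ s <;> simp [h]
    rw [this]
    exact Submodule.smul_mem _ _ (Submodule.subset_span ⟨s, hs, rfl⟩)
  | add hfg hf hg =>
    exact Submodule.add_mem _ hf hg

/-- The essential values of f lie in a compact disc, so rounding them to finitely many points of a
dense sequence approximates f uniformly. -/
lemma dense_span_charFn : Dense (Submodule.span ℂ {f : Lp ℂ ∞ ν |
    ∃ (X : Set Ω) (hX : MeasurableSet X), f = charFn ν hX} : Set (Lp ℂ ∞ ν)) := by
  intro f
  rw [Metric.mem_closure_iff]
  intro ε hε
  -- By compactness, finitely many balls of radius ε/2 cover the disc; N bounds the indices of their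
  -- centres.
  obtain ⟨N, hN⟩ : ∃ N : ℕ, ∀ x ∈ Metric.closedBall (0 : ℂ) ‖f‖,
      ∃ k ≤ N, dist (TopologicalSpace.denseSeq ℂ k) x < ε / 2 := by
    obtain ⟨t, ht⟩ := (isCompact_closedBall (0 : ℂ) ‖f‖).elim_finite_subcover
      (fun k : ℕ => Metric.ball (TopologicalSpace.denseSeq ℂ k) (ε / 2))
      (fun k => Metric.isOpen_ball) (fun x _ => by
        obtain ⟨k, hk⟩ := (TopologicalSpace.denseRange_denseSeq ℂ).exists_dist_lt x
          (half_pos hε)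
        exact Set.mem_iUnion.2 ⟨k, hk⟩)
    refine ⟨t.sup id, fun x hx => ?_⟩
    obtain ⟨k, hk, hk'⟩ := Set.mem_iUnion₂.1 (ht hx)
    refine ⟨k, Finset.le_sup (f := id) hk, ?_⟩
    rw [dist_comm]
    exact hk'
  set g : SimpleFunc Ω ℂ := (SimpleFunc.nearestPt (TopologicalSpace.denseSeq ℂ) N).comp f
    (Lp.stronglyMeasurable f).measurable with hg
  refine ⟨_, toLp_simpleFunc_mem_span g, ?_⟩
  rw [dist_eq_norm]
  refine lt_of_le_of_lt ?_ (half_lt_self hε)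
  refine norm_le_of_ae_norm_le (by positivity) ?_
  filter_upwards [Lp.coeFn_sub f (MemLp.toLp g (g.memLp_top ν)),
    MemLp.coeFn_toLp (g.memLp_top ν), ae_norm_le_norm f] with ω h1 h2 h3
  rw [h1, Pi.sub_apply, h2, ← dist_eq_norm, dist_comm]
  obtain ⟨k, hk, hk'⟩ := hN (f ω) (by simpa using h3)
  have := SimpleFunc.edist_nearestPt_le (TopologicalSpace.denseSeq ℂ) (f ω) hk
  rw [edist_dist, edist_dist, ENNReal.ofReal_le_ofReal_iff dist_nonneg] at this
  exact this.trans hk'.le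

variable {E : Type*} [NormedAddCommGroup E] [InnerProductSpace ℂ E]

lemma mulOp_mulFn (f g : Lp ℂ ∞ ν) :
    (mulOp ν (mulFn f g) : Lp E 2 ν →L[ℂ] Lp E 2 ν) = mulOp ν f * mulOp ν g := by
  refine ContinuousLinearMap.ext fun ψ => Lp.ext ?_
  rw [mul_apply_eq_comp]
  filter_upwards [coeFn_mulOp ν (mulFn f g) ψ, coeFn_mulOp ν f (mulOp ν g ψ), coeFn_mulOp ν g ψ,
    coeFn_mulFn f g] with ω h1 h2 h3 h4
  rw [h1, h2, h3, h4, mul_smul]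

lemma mulOp_oneFn : (mulOp ν (oneFn ν) : Lp E 2 ν →L[ℂ] Lp E 2 ν) = 1 := by
  refine ContinuousLinearMap.ext fun ψ => Lp.ext ?_
  filter_upwards [coeFn_mulOp ν (oneFn ν) ψ, coeFn_oneFn (ν := ν)] with ω h1 h2
  rw [h1, h2, one_smul]; rfl

lemma mulOp_add (f g : Lp ℂ ∞ ν) :
    (mulOp ν (f + g) : Lp E 2 ν →L[ℂ] Lp E 2 ν) = mulOp ν f + mulOp ν g := by
  rw [mulOp, map_add]; rfl

lemma mulOp_smul (c : ℂ) (f : Lp ℂ ∞ ν) :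
    (mulOp ν (c • f) : Lp E 2 ν →L[ℂ] Lp E 2 ν) = c • mulOp ν f := by
  rw [mulOp, map_smul]; rfl

lemma norm_mulOp_apply_le (f : Lp ℂ ∞ ν) (ψ : Lp E 2 ν) : ‖mulOp ν f ψ‖ ≤ ‖f‖ * ‖ψ‖ := by
  refine ((ContinuousLinearMap.lsmul ℂ ℂ : ℂ →L[ℂ] E →L[ℂ] E).norm_holder_apply_apply_le
    (r := 2) f ψ).trans ?_
  gcongr
  exact mul_le_of_le_one_left (norm_nonneg _) ContinuousLinearMap.opNorm_lsmul_le

lemma norm_mulOp_le (f : Lp ℂ ∞ ν) : ‖(mulOp ν f : Lp E 2 ν →L[ℂ] Lp E 2 ν)‖ ≤ ‖f‖ := by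
  exact ContinuousLinearMap.opNorm_le_bound _ (norm_nonneg _) (norm_mulOp_apply_le f)

lemma inner_mulOp_left (f : Lp ℂ ∞ ν) (φ ψ : Lp E 2 ν) :
    ⟪mulOp ν f φ, ψ⟫_ℂ = ⟪φ, mulOp ν (star f) ψ⟫_ℂ := by
  rw [L2.inner_def, L2.inner_def]
  refine integral_congr_ae ?_
  filter_upwards [coeFn_mulOp ν f φ, coeFn_mulOp ν (star f) ψ, Lp.coeFn_star f] with ω h1 h2 h3
  rw [h1, h2, h3, inner_smul_left, inner_smul_right, Pi.star_apply, RCLike.star_def]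

lemma star_mulOp [CompleteSpace E] (f : Lp ℂ ∞ ν) :
    star (mulOp ν f : Lp E 2 ν →L[ℂ] Lp E 2 ν) = mulOp ν (star f) := by
  rw [ContinuousLinearMap.star_eq_adjoint]
  exact ((ContinuousLinearMap.eq_adjoint_iff _ _).2 fun x y => by
    rw [inner_mulOp_left, star_star]).symm

lemma norm_sq_eq_integral (ψ : Lp E 2 ν) : ‖ψ‖ ^ 2 = ∫ ω, ‖ψ ω‖ ^ 2 ∂ν := by
  have h : ((‖ψ‖ ^ 2 : ℝ) : ℂ) = ((∫ ω, ‖ψ ω‖ ^ 2 ∂ν : ℝ) : ℂ) := by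
    rw [← integral_complex_ofReal]
    push_cast
    have := inner_self_eq_norm_sq_to_K (𝕜 := ℂ) ψ
    rw [L2.inner_def] at this
    refine this.symm.trans (integral_congr_ae (Eventually.of_forall fun ω => ?_))
    exact inner_self_eq_norm_sq_to_K (𝕜 := ℂ) (ψ ω)
  exact_mod_cast h

lemma integrable_norm_sq (ψ : Lp E 2 ν) : Integrable (fun ω => ‖ψ ω‖ ^ 2) ν :=
  (Lp.memLp ψ).integrable_norm_pow two_ne_zero

lemma norm_sq_mulOp_charFn {X : Set Ω} (hX : MeasurableSet X) (ψ : Lp E 2 ν) :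
    ‖mulOp ν (charFn ν hX) ψ‖ ^ 2 = ∫ ω in X, ‖ψ ω‖ ^ 2 ∂ν := by
  rw [norm_sq_eq_integral, ← integral_indicator hX]
  refine integral_congr_ae ?_
  filter_upwards [coeFn_mulOp ν (charFn ν hX) ψ, coeFn_charFn (ν := ν) hX] with ω h1 h2
  rw [h1, h2]
  by_cases h : ω ∈ X <;> simp [h]

variable {E' : Type*} [NormedAddCommGroup E'] [InnerProductSpace ℂ E']

/-- With characteristic functions as f, the hypothesis compares the integrals of ‖φ‖² and C²‖ψ‖²
over every measurable set, which forces the pointwise inequality. -/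
lemma ae_norm_le_of_localized {φ : Lp E' 2 ν} {ψ : Lp E 2 ν} {C : ℝ} (hC : 0 ≤ C)
    (h : ∀ f, ‖mulOp ν f φ‖ ≤ C * ‖mulOp ν f ψ‖) : ∀ᵐ ω ∂ν, ‖φ ω‖ ≤ C * ‖ψ ω‖ := by
  have := ae_le_of_forall_setIntegral_le (integrable_norm_sq φ)
    ((integrable_norm_sq ψ).const_mul (C ^ 2)) fun s hs _ => by
      rw [integral_const_mul, ← norm_sq_mulOp_charFn hs, ← norm_sq_mulOp_charFn hs, ← mul_pow]
      gcongr
      exact h _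
  filter_upwards [this] with ω hω
  rw [← mul_pow] at hω
  exact (sq_le_sq₀ (norm_nonneg _) (by positivity)).1 hω

lemma ae_norm_eq_of_localized {φ : Lp E' 2 ν} {ψ : Lp E 2 ν}
    (h : ∀ f, ‖mulOp ν f φ‖ = ‖mulOp ν f ψ‖) : ∀ᵐ ω ∂ν, ‖φ ω‖ = ‖ψ ω‖ := by
  filter_upwards [ae_norm_le_of_localized zero_le_one fun f => ((h f).trans (one_mul _).symm).le,
    ae_norm_le_of_localized zero_le_one fun f => ((h f).symm.trans (one_mul _).symm).le]
    with ω h1 h2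
  rw [one_mul] at h1 h2
  exact le_antisymm h1 h2

lemma setIntegral_inner_eq (φ ψ : Lp E 2 ν) {s : Set Ω} (hs : MeasurableSet s) :
    ∫ ω in s, ⟪φ ω, ψ ω⟫_ℂ ∂ν = ⟪mulOp ν (charFn ν hs) φ, ψ⟫_ℂ := by
  rw [L2.inner_def, ← integral_indicator hs]
  refine integral_congr_ae ?_
  filter_upwards [coeFn_mulOp ν (charFn ν hs) φ, coeFn_charFn (ν := ν) hs] with ω h1 h2
  rw [h1, h2]
  by_cases h : ω ∈ s <;> simp [h]

lemma ae_inner_eq_inner {φ ψ : Lp E 2 ν} {φ' ψ' : Lp E' 2 ν}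
    (h : ∀ f, ⟪mulOp ν f φ, ψ⟫_ℂ = ⟪mulOp ν f φ', ψ'⟫_ℂ) :
    ∀ᵐ ω ∂ν, ⟪φ ω, ψ ω⟫_ℂ = ⟪φ' ω, ψ' ω⟫_ℂ :=
  (L2.integrable_inner φ ψ).ae_eq_of_forall_setIntegral_eq _ _ (L2.integrable_inner φ' ψ')
    fun s hs _ => by rw [setIntegral_inner_eq φ ψ hs, setIntegral_inner_eq φ' ψ' hs, h]

lemma ae_inner_eq_zero {φ ψ : Lp E 2 ν} (h : ∀ f, ⟪mulOp ν f φ, ψ⟫_ℂ = 0) :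
    ∀ᵐ ω ∂ν, ⟪φ ω, ψ ω⟫_ℂ = 0 :=
  (L2.integrable_inner φ ψ).ae_eq_zero_of_forall_setIntegral_eq_zero fun s hs _ => by
    rw [setIntegral_inner_eq φ ψ hs, h]

lemma coeFn_sum_smul {ι : Type*} (F : Finset ι) (c : ι → ℂ) (φ : ι → Lp E 2 ν) :
    (∑ i ∈ F, c i • φ i : Lp E 2 ν) =ᵐ[ν] fun ω => ∑ i ∈ F, c i • φ i ω := by
  classical
  induction F using Finset.induction_on with
  | empty => simp only [Finset.sum_empty]; exact Lp.coeFn_zero E 2 ν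
  | insert i F hi ih =>
    rw [Finset.sum_insert hi]
    filter_upwards [Lp.coeFn_add (c i • φ i) (∑ i ∈ F, c i • φ i), Lp.coeFn_smul (c i) (φ i), ih]
      with ω h1 h2 h3
    rw [h1, Pi.add_apply, h2, h3, Finset.sum_insert hi, Pi.smul_apply]

end LInfty

/-! ### Operators commuting with `L^∞(ν)` are decomposable -/

section Decomposable

variable {Ω : Type*} [MeasurableSpace Ω] {ν : Measure Ω}
  {E E' : Type*} [NormedAddCommGroup E] [InnerProductSpace ℂ E]
  [NormedAddCommGroup E'] [InnerProductSpace ℂ E']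

/-- A decomposition of operators holds everywhere if it holds on a total set. -/
lemma ae_apply_eq_of_dense {X : Type*} [NormedAddCommGroup X] [NormedSpace ℂ X]
    (A : X →L[ℂ] Lp E' 2 ν) (B : X →L[ℂ] Lp E 2 ν) {a : Ω → (E →L[ℂ] E')} {s : Set X}
    (hs : Dense (Submodule.span ℂ s : Set X)) (h : ∀ z ∈ s, ∀ᵐ ω ∂ν, A z ω = a ω (B z ω)) (z : X) :
    ∀ᵐ ω ∂ν, A z ω = a ω (B z ω) := by
  have hspan : ∀ z ∈ Submodule.span ℂ s, ∀ᵐ ω ∂ν, A z ω = a ω (B z ω) := fun z hz => by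
    induction hz using Submodule.span_induction with
    | mem z hz => exact h z hz
    | zero =>
      rw [map_zero, map_zero]
      filter_upwards [Lp.coeFn_zero E 2 ν, Lp.coeFn_zero E' 2 ν] with ω h1 h2
      rw [h1, h2, Pi.zero_apply, Pi.zero_apply, map_zero]
    | add z w _ _ h1 h2 =>
      rw [map_add, map_add]
      filter_upwards [h1, h2, Lp.coeFn_add (A z) (A w), Lp.coeFn_add (B z) (B w)] with ω h1 h2 h3 h4
      rw [h3, h4, Pi.add_apply, Pi.add_apply, map_add, h1, h2]
    | smul c z _ h1 =>
      rw [map_smul, map_smul]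
      filter_upwards [h1, Lp.coeFn_smul c (A z), Lp.coeFn_smul c (B z)] with ω h1 h3 h4
      rw [h3, h4, Pi.smul_apply, Pi.smul_apply, map_smul, h1]
  -- Convergence in L² is pointwise a.e. only along a subsequence: `k` is chosen for B, and `l` is a
  -- further refinement for A.
  obtain ⟨x, hx, hlim⟩ := mem_closure_iff_seq_limit.1 (hs z)
  have hB : Tendsto (fun i => B (x i)) atTop (𝓝 (B z)) := (B.continuous.tendsto z).comp hlim
  obtain ⟨k, hk, hk'⟩ := (tendstoInMeasure_of_tendsto_Lp hB).exists_seq_tendsto_ae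
  have hA : Tendsto (fun i => A (x (k i))) atTop (𝓝 (A z)) :=
    (A.continuous.tendsto z).comp (hlim.comp hk.tendsto_atTop)
  obtain ⟨l, hl, hl'⟩ := (tendstoInMeasure_of_tendsto_Lp hA).exists_seq_tendsto_ae
  have hall : ∀ᵐ ω ∂ν, ∀ i, A (x i) ω = a ω (B (x i) ω) := ae_all_iff.2 fun i => hspan _ (hx i)
  filter_upwards [hk', hl', hall] with ω h1 h2 h3
  refine tendsto_nhds_unique h2 ?_
  simp only [h3]
  exact ((a ω).continuous.tendsto _).comp (h1.comp hl.tendsto_atTop)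

variable [SigmaFinite ν]

variable (ν) in
-- A σ-finite measure has a strictly positive integrable function; its square root is a weight that
-- turns constant vectors into square integrable sections, even for infinite ν.
lemma exists_pos_memLp_two : ∃ g : Ω → ℝ, (∀ ω, 0 < g ω) ∧ Measurable g ∧ MemLp g 2 ν := by
  obtain ⟨ρ, hpos, hmeas, hlt⟩ := exists_pos_lintegral_lt_of_sigmaFinite ν one_ne_zero
  have hm : Measurable fun ω => √(ρ ω : ℝ) := (measurable_coe_nnreal_real.comp hmeas).sqrt
  refine ⟨fun ω => √(ρ ω : ℝ), fun ω => Real.sqrt_pos.2 (hpos ω), hm, ?_⟩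
  refine (memLp_two_iff_integrable_sq hm.aestronglyMeasurable).2 ?_
  simp only [Real.sq_sqrt (NNReal.coe_nonneg _)]
  refine ⟨(measurable_coe_nnreal_real.comp hmeas).aestronglyMeasurable, ?_⟩
  rw [HasFiniteIntegral]
  refine lt_of_eq_of_lt (lintegral_congr fun ω => ?_) (hlt.trans ENNReal.one_lt_top)
  simp [enorm_eq_nnnorm]

lemma memLp_smul_const {g : Ω → ℝ} (hg : MemLp g 2 ν) (x : E) :
    MemLp (fun ω => (g ω : ℂ) • x) 2 ν := by
  refine (hg.norm.mul_const ‖x‖).of_le ?_ (Eventually.of_forall fun ω => ?_)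
  · exact (Complex.continuous_ofReal.comp_aestronglyMeasurable hg.1).smul_const x
  · simp [norm_smul]

/-- An operator commuting with `L^∞(ν)` acts fibrewise. -/
theorem exists_field_of_commute [CompleteSpace E] [CompleteSpace E'] [TopologicalSpace.SeparableSpace E]
    (T : Lp E 2 ν →L[ℂ] Lp E' 2 ν) (hT : ∀ f ψ, T (mulOp ν f ψ) = mulOp ν f (T ψ)) :
    ∃ a : Ω → (E →L[ℂ] E'), (∀ ω, ‖a ω‖ ≤ ‖T‖) ∧
      (∀ x, AEStronglyMeasurable (fun ω => a ω x) ν) ∧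
      ∀ ψ, ∀ᵐ ω ∂ν, T ψ ω = a ω (ψ ω) := by
  obtain ⟨g, hgpos, hgm, hg⟩ := exists_pos_memLp_two ν
  set x : ℕ → E := TopologicalSpace.denseSeq E with hx
  set φ : ℕ → Lp E 2 ν := fun k => (memLp_smul_const hg (x k)).toLp with hφ
  have hφω : ∀ᵐ ω ∂ν, ∀ k, φ k ω = (g ω : ℂ) • x k :=
    ae_all_iff.2 fun k => (memLp_smul_const hg (x k)).coeFn_toLp
  -- The fibre operator must be bounded on all linear combinations of the `x k` outside a single
  -- null set. The bound holds a.e. for each of countably many coefficient sequences, dense in the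
  -- product topology, and continuity extends it to all coefficients.
  have hgood : ∀ᵐ ω ∂ν, ∀ c : ℕ →₀ ℂ,
      ‖Finsupp.linearCombination ℂ (fun k => ((g ω : ℂ))⁻¹ • T (φ k) ω) c‖ ≤
        ‖T‖ * ‖Finsupp.linearCombination ℂ x c‖ := by
    have hcount : ∀ᵐ ω ∂ν, ∀ (F : Finset ℕ) (i : ℕ),
        ‖∑ k ∈ F, (TopologicalSpace.denseSeq (ℕ → ℂ) i k) • T (φ k) ω‖ ≤
          ‖T‖ * ‖∑ k ∈ F, (TopologicalSpace.denseSeq (ℕ → ℂ) i k) • φ k ω‖ := by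
      refine ae_all_iff.2 fun F => ae_all_iff.2 fun i => ?_
      set c := TopologicalSpace.denseSeq (ℕ → ℂ) i
      have h1 := ae_norm_le_of_localized (norm_nonneg T) (φ := T (∑ k ∈ F, c k • φ k))
        (ψ := ∑ k ∈ F, c k • φ k) fun f => by
          rw [← hT]; exact T.le_opNorm _
      rw [map_sum] at h1
      simp only [map_smul] at h1
      filter_upwards [h1, coeFn_sum_smul F c φ, coeFn_sum_smul F c fun k => T (φ k)]
        with ω h1 h2 h3
      rwa [h2, h3] at h1
    filter_upwards [hcount, hφω] with ω h1 h2
    have hF : ∀ (F : Finset ℕ) (c : ℕ → ℂ),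
        ‖∑ k ∈ F, c k • T (φ k) ω‖ ≤ ‖T‖ * ‖∑ k ∈ F, c k • φ k ω‖ := by
      intro F c
      refine DenseRange.induction_on (TopologicalSpace.denseRange_denseSeq (ℕ → ℂ)) c ?_ (h1 F)
      exact isClosed_le (by fun_prop) (by fun_prop)
    intro c
    have h := hF c.support fun k => c k * ((g ω : ℂ))⁻¹
    simp only [h2, smul_smul, mul_assoc,
      inv_mul_cancel₀ (Complex.ofReal_ne_zero.2 (hgpos ω).ne'), mul_one] at h
    simpa only [Finsupp.linearCombination_apply, Finsupp.sum, smul_smul] using h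
  have hdense : Dense (Submodule.span ℂ (Set.range x) : Set E) :=
    (TopologicalSpace.denseRange_denseSeq E).mono Submodule.subset_span
  classical
  -- Where the bound fails the fibre is set to 0, so that the norm bound by ‖T‖ holds at every ω.
  have hex : ∀ ω, ∃ A : E →L[ℂ] E', ‖A‖ ≤ ‖T‖ ∧ ((∀ c : ℕ →₀ ℂ,
      ‖Finsupp.linearCombination ℂ (fun k => ((g ω : ℂ))⁻¹ • T (φ k) ω) c‖ ≤
        ‖T‖ * ‖Finsupp.linearCombination ℂ x c‖) → ∀ k, A (x k) = ((g ω : ℂ))⁻¹ • T (φ k) ω) := by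
    intro ω
    by_cases h : ∀ c : ℕ →₀ ℂ,
      ‖Finsupp.linearCombination ℂ (fun k => ((g ω : ℂ))⁻¹ • T (φ k) ω) c‖ ≤
        ‖T‖ * ‖Finsupp.linearCombination ℂ x c‖
    · obtain ⟨A, hA, hA'⟩ := exists_clm_of_norm_le hdense (norm_nonneg T) h
      exact ⟨A, hA', fun _ => hA⟩
    · exact ⟨0, by rw [norm_zero]; exact norm_nonneg T, fun h' => absurd h' h⟩
  choose a ha1 ha2 using hex
  have hax : ∀ᵐ ω ∂ν, ∀ k, a ω (x k) = ((g ω : ℂ))⁻¹ • T (φ k) ω := by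
    filter_upwards [hgood] with ω hω using ha2 ω hω
  refine ⟨a, ha1, fun y => ?_, fun ψ => ?_⟩
  · obtain ⟨k, hk⟩ : ∃ k : ℕ → ℕ, Tendsto (fun i => x (k i)) atTop (𝓝 y) := by
      obtain ⟨s, hs, hlim⟩ :=
        mem_closure_iff_seq_limit.1 (TopologicalSpace.denseRange_denseSeq E y)
      choose k hk using hs
      exact ⟨k, by simpa only [hx, hk] using hlim⟩
    refine aestronglyMeasurable_of_tendsto_ae atTop (f := fun i ω => a ω (x (k i))) (fun i => ?_)
      (Eventually.of_forall fun ω => ((a ω).continuous.tendsto y).comp hk)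
    refine AEStronglyMeasurable.congr (f := fun ω => ((g ω : ℂ))⁻¹ • T (φ (k i)) ω) ?_
      (hax.mono fun ω hω => (hω _).symm)
    refine AEStronglyMeasurable.smul ?_ (Lp.aestronglyMeasurable _)
    exact (Complex.measurable_ofReal.comp hgm).inv.aestronglyMeasurable
  · have hmem : ∀ f k, ∀ᵐ ω ∂ν, T (mulOp ν f (φ k)) ω = a ω (mulOp ν f (φ k) ω) := by
      intro f k
      rw [hT]
      filter_upwards [coeFn_mulOp ν f (φ k), coeFn_mulOp ν f (T (φ k)), hax, hφω]
        with ω h1 h2 h3 h4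
      rw [h1, h2, h4, map_smul, map_smul, h3, smul_smul (g ω : ℂ),
        mul_inv_cancel₀ (Complex.ofReal_ne_zero.2 (hgpos ω).ne'), one_smul]
    -- A section orthogonal to all f·φ_k is orthogonal, at almost every point, to a dense sequence,
    -- and so vanishes.
    have hd : Dense (Submodule.span ℂ {ψ : Lp E 2 ν | ∃ f k, ψ = mulOp ν f (φ k)} :
        Set (Lp E 2 ν)) := by
      refine dense_span_of_forall_inner_eq_zero fun ψ hψ => Lp.ext ?_
      have h0 : ∀ᵐ ω ∂ν, ∀ k, ⟪φ k ω, ψ ω⟫_ℂ = 0 :=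
        ae_all_iff.2 fun k => ae_inner_eq_zero fun f => hψ _ ⟨f, k, rfl⟩
      filter_upwards [h0, hφω, Lp.coeFn_zero E 2 ν] with ω h1 h2 h3
      rw [h3, Pi.zero_apply]
      refine (TopologicalSpace.denseRange_denseSeq E).eq_zero_of_inner_right ℂ fun k => ?_
      have := h1 k
      rw [h2, inner_smul_left, mul_eq_zero] at this
      exact this.resolve_left (by simpa using (hgpos ω).ne')
    refine ae_apply_eq_of_dense T (ContinuousLinearMap.id ℂ _) hd ?_ ψ
    rintro _ ⟨f, k, rfl⟩
    exact hmem f k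

end Decomposable

/-! ### Direct integrals -/

section DirectIntegral

variable {Ω : Type*} [MeasurableSpace Ω] {ν : Measure Ω} {n : Ω → ℕ∞}

instance : TopologicalSpace.SeparableSpace Ell2 := by
  have hd : Dense (Submodule.span ℂ (Set.range fun i : ℕ => (lp.single 2 i (1 : ℂ) : Ell2)) :
      Set Ell2) := by
    refine dense_span_of_forall_inner_eq_zero fun x hx => lp.ext (funext fun i => ?_)
    have := hx _ ⟨i, rfl⟩
    rw [lp.inner_single_left] at this
    simpa using this
  have hsep : TopologicalSpace.IsSeparable (Submodule.span ℂ
      (Set.range fun i : ℕ => (lp.single 2 i (1 : ℂ) : Ell2)) : Set Ell2) :=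
    (Set.countable_range _).isSeparable.span
  have := hsep.closure
  rw [hd.closure_eq] at this
  exact TopologicalSpace.isSeparable_univ_iff.1 this

lemma DirectIntegral.mem_fiber (ψ : DirectIntegral ν n) : ∀ᵐ ω ∂ν, ψ ω ∈ fiber (n ω) := ψ.2

lemma DirectIntegral.ext {φ ψ : DirectIntegral ν n} (h : (φ : Ω → Ell2) =ᵐ[ν] ψ) : φ = ψ :=
  DirectIntegral.toLp.injective (Lp.ext h)

lemma DirectIntegral.exists_of_memLp {f : Ω → Ell2} (hf : MemLp f 2 ν)
    (hn : ∀ᵐ ω ∂ν, f ω ∈ fiber (n ω)) : ∃ ψ : DirectIntegral ν n, (ψ : Ω → Ell2) =ᵐ[ν] f := by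
  refine ⟨(⟨hf.toLp, ?_⟩ : fiberwise ν n), hf.coeFn_toLp⟩
  show ∀ᵐ ω ∂ν, (hf.toLp f : Lp Ell2 2 ν) ω ∈ fiber (n ω)
  filter_upwards [hf.coeFn_toLp, hn] with ω h1 h2
  rwa [h1]

lemma DirectIntegral.inner_def (φ ψ : DirectIntegral ν n) :
    ⟪φ, ψ⟫_ℂ = ∫ ω, ⟪φ ω, ψ ω⟫_ℂ ∂ν := by
  rw [← DirectIntegral.toLp.inner_map_map, L2.inner_def]

lemma toLp_diagOp (f : Lp ℂ ∞ ν) (ψ : DirectIntegral ν n) :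
    DirectIntegral.toLp (diagOp f ψ) = mulOp ν f (DirectIntegral.toLp ψ) := rfl

lemma diagOp_mulFn (f g : Lp ℂ ∞ ν) :
    (diagOp (mulFn f g) : DirectIntegral ν n →L[ℂ] DirectIntegral ν n) = diagOp f * diagOp g :=
  ContinuousLinearMap.ext fun ψ => DirectIntegral.toLp.injective <| by
    simp only [mul_apply_eq_comp, toLp_diagOp, mulOp_mulFn]

lemma diagOp_oneFn : (diagOp (oneFn ν) : DirectIntegral ν n →L[ℂ] DirectIntegral ν n) = 1 :=
  ContinuousLinearMap.ext fun ψ => DirectIntegral.toLp.injective <| by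
    rw [toLp_diagOp, mulOp_oneFn]; rfl

lemma inner_diagOp_left (f : Lp ℂ ∞ ν) (φ ψ : DirectIntegral ν n) :
    ⟪diagOp f φ, ψ⟫_ℂ = ⟪φ, diagOp (star f) ψ⟫_ℂ := by
  rw [← DirectIntegral.toLp.inner_map_map, ← DirectIntegral.toLp.inner_map_map, toLp_diagOp,
    toLp_diagOp, inner_mulOp_left]

lemma star_diagOp (f : Lp ℂ ∞ ν) :
    star (diagOp f : DirectIntegral ν n →L[ℂ] DirectIntegral ν n) = diagOp (star f) := by
  rw [ContinuousLinearMap.star_eq_adjoint]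
  exact ((ContinuousLinearMap.eq_adjoint_iff _ _).2 fun x y => by
    rw [inner_diagOp_left, star_star]).symm

lemma fiberProj_eq_self {k : ℕ∞} {x : Ell2} (hx : x ∈ fiber k) : fiberProj k x = x :=
  Submodule.starProjection_eq_self_iff.2 hx

lemma fiberProj_mem (k : ℕ∞) (x : Ell2) : fiberProj k x ∈ fiber k :=
  Submodule.starProjection_apply_mem _ x

lemma star_fiberProj (k : ℕ∞) : star (fiberProj k) = fiberProj k :=
  (isStarProjection_starProjection (U := fiber k)).isSelfAdjoint

lemma fiberProj_mul_self (k : ℕ∞) : fiberProj k * fiberProj k = fiberProj k :=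
  (isStarProjection_starProjection (U := fiber k)).isIdempotentElem

variable [SigmaFinite ν]

/-- A measurable family of total sections of a direct integral. -/
lemma exists_sections (hn : AEMeasurable n ν) : ∃ (g : Ω → ℂ) (φ : Ell2 → DirectIntegral ν n),
    Measurable g ∧ (∀ ω, g ω ≠ 0) ∧ ∀ x, ∀ᵐ ω ∂ν, φ x ω = g ω • fiberProj (n ω) x := by
  obtain ⟨g, hgpos, hgm, hg⟩ := exists_pos_memLp_two ν
  have hx : ∀ x : Ell2, ∃ ψ : DirectIntegral ν n,
      ∀ᵐ ω ∂ν, ψ ω = (g ω : ℂ) • fiberProj (n ω) x := by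
    intro x
    -- Functions on the discrete space ℕ∞ are measurable, so only the measurability of n matters.
    have hm : AEStronglyMeasurable (fun ω => fiberProj (n ω) x) ν :=
      (StronglyMeasurable.of_discrete (f := fun k : ℕ∞ => fiberProj k x)).aestronglyMeasurable
        |>.comp_aemeasurable hn
    refine DirectIntegral.exists_of_memLp ((memLp_smul_const hg x).of_le ?_ ?_) ?_
    · exact (Complex.measurable_ofReal.comp hgm).aestronglyMeasurable.smul hm
    · refine Eventually.of_forall fun ω => ?_
      rw [norm_smul, norm_smul]
      gcongr
      exact Submodule.norm_starProjection_apply_le _ _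
    · exact Eventually.of_forall fun ω => (fiber (n ω)).smul_mem _ (fiberProj_mem _ _)
  choose φ hφ using hx
  exact ⟨fun ω => g ω, φ, Complex.measurable_ofReal.comp hgm,
    fun ω => Complex.ofReal_ne_zero.2 (hgpos ω).ne', hφ⟩

variable {E' : Type*} [NormedAddCommGroup E'] [InnerProductSpace ℂ E']

/-- The sections g·P_{n(ω)} x_k, with x_k a dense sequence, are countably many and total in each
fibre, so one null set suffices for the operator identity. -/
lemma ae_comp_fiberProj_eq (hn : AEMeasurable n ν) {A B : Ω → (Ell2 →L[ℂ] E')}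
    (h : ∀ ψ : DirectIntegral ν n, ∀ᵐ ω ∂ν, A ω (ψ ω) = B ω (ψ ω)) :
    ∀ᵐ ω ∂ν, A ω ∘L fiberProj (n ω) = B ω ∘L fiberProj (n ω) := by
  obtain ⟨g, φ, -, hg, hφ⟩ := exists_sections hn
  have hall : ∀ᵐ ω ∂ν, ∀ k, A ω (φ (TopologicalSpace.denseSeq Ell2 k) ω) =
      B ω (φ (TopologicalSpace.denseSeq Ell2 k) ω) := ae_all_iff.2 fun k => h _
  have hall' : ∀ᵐ ω ∂ν, ∀ k, φ (TopologicalSpace.denseSeq Ell2 k) ω =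
      g ω • fiberProj (n ω) (TopologicalSpace.denseSeq Ell2 k) := ae_all_iff.2 fun k => hφ _
  filter_upwards [hall, hall'] with ω h1 h2
  refine ContinuousLinearMap.ext fun x => ?_
  refine DenseRange.induction_on (TopologicalSpace.denseRange_denseSeq Ell2) x
    (isClosed_eq (ContinuousLinearMap.continuous _) (ContinuousLinearMap.continuous _)) fun k => ?_
  have := h1 k
  rw [h2, map_smul, map_smul] at this
  exact smul_right_injective _ (hg ω) this

lemma eq_of_inner_self_eq {A B : Ell2 →L[ℂ] Ell2} (h : ∀ x, ⟪A x, x⟫_ℂ = ⟪B x, x⟫_ℂ) : A = B :=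
  ContinuousLinearMap.coe_injective ((ext_inner_map A.toLinearMap B.toLinearMap).1 h)

/-- An isometry of a direct integral commuting with the diagonal operators is given by a field of
isometries. -/
theorem exists_isometry_field [CompleteSpace E'] (hn : AEMeasurable n ν)
    (T : DirectIntegral ν n →ₗᵢ[ℂ] Lp E' 2 ν)
    (hT : ∀ f ψ, T (diagOp f ψ) = mulOp ν f (T ψ)) :
    ∃ c : Ω → (Ell2 →L[ℂ] E'), IsWeaklyMeasurable ν c ∧
      (∀ᵐ ω ∂ν, (c ω)† ∘L c ω = fiberProj (n ω)) ∧ (∀ ω, c ω ∘L fiberProj (n ω) = c ω) ∧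
      ∀ ψ : DirectIntegral ν n, ∀ᵐ ω ∂ν, T ψ ω = c ω (ψ ω) := by
  -- Since J*J = 1, the operator T J* extends T by zero on the complement of the direct integral. It
  -- still commutes with L^∞(ν), so it acts fibrewise.
  set J : DirectIntegral ν n →L[ℂ] Lp Ell2 2 ν := DirectIntegral.toLp.toContinuousLinearMap with hJ
  have hJJ : ∀ ψ, (J†) (J ψ) = ψ := fun ψ => by
    refine ext_inner_left ℂ fun φ => ?_
    rw [ContinuousLinearMap.adjoint_inner_right]
    exact DirectIntegral.toLp.inner_map_map φ ψ
  have hJf : ∀ f ψ, (J†) (mulOp ν f ψ) = diagOp f ((J†) ψ) := fun f ψ => by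
    refine ext_inner_left ℂ fun φ => ?_
    have h1 : J (diagOp (star f) φ) = mulOp ν (star f) (J φ) := rfl
    have h2 := inner_diagOp_left (star f) φ ((J†) ψ)
    have h3 := inner_mulOp_left (star f) (J φ) ψ
    rw [star_star] at h2 h3
    rw [ContinuousLinearMap.adjoint_inner_right, ← h3, ← h2,
      ContinuousLinearMap.adjoint_inner_right, h1]
  obtain ⟨a, -, -, ha⟩ := exists_field_of_commute (T.toContinuousLinearMap ∘L J†) fun f ψ => by
    simp only [ContinuousLinearMap.comp_apply, hJf]
    exact hT f _
  have hTa : ∀ ψ : DirectIntegral ν n, ∀ᵐ ω ∂ν, T ψ ω = a ω (ψ ω) := fun ψ => by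
    have := ha (J ψ)
    rw [ContinuousLinearMap.comp_apply, hJJ] at this
    exact this
  obtain ⟨g, φ, hgm, hg, hφ⟩ := exists_sections hn
  have hTφ : ∀ x, ∀ᵐ ω ∂ν, T (φ x) ω = g ω • a ω (fiberProj (n ω) x) := fun x => by
    filter_upwards [hTa (φ x), hφ x] with ω h1 h2
    rw [h1, h2, map_smul]
  refine ⟨fun ω => a ω ∘L fiberProj (n ω), fun x z => ?_, ?_, fun ω => ?_, fun ψ => ?_⟩
  · refine AEStronglyMeasurable.congr (f := fun ω => ⟪z, (g ω)⁻¹ • T (φ x) ω⟫_ℂ) ?_ ?_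
    · exact aestronglyMeasurable_const.inner
        (hgm.inv.aestronglyMeasurable.smul (Lp.aestronglyMeasurable _))
    · filter_upwards [hTφ x] with ω h1
      rw [h1, smul_smul, inv_mul_cancel₀ (hg ω), one_smul]
      rfl
  · have hnorm : ∀ x, ∀ᵐ ω ∂ν, ‖a ω (fiberProj (n ω) x)‖ = ‖fiberProj (n ω) x‖ := fun x => by
      have h0 : ∀ᵐ ω ∂ν, ‖T (φ x) ω‖ = ‖φ x ω‖ := ae_norm_eq_of_localized fun f => by
        rw [← hT, T.norm_map, ← DirectIntegral.toLp.norm_map, toLp_diagOp]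
      filter_upwards [h0, hTφ x, hφ x] with ω h1 h2 h3
      rw [h2, h3, norm_smul, norm_smul] at h1
      exact mul_left_cancel₀ (norm_ne_zero_iff.2 (hg ω)) h1
    have hall : ∀ᵐ ω ∂ν, ∀ k, ‖a ω (fiberProj (n ω) (TopologicalSpace.denseSeq Ell2 k))‖ =
      ‖fiberProj (n ω) (TopologicalSpace.denseSeq Ell2 k)‖ := ae_all_iff.2 fun k => hnorm _
    filter_upwards [hall] with ω hω
    refine eq_of_inner_self_eq fun x => ?_
    have hx : ‖a ω (fiberProj (n ω) x)‖ = ‖fiberProj (n ω) x‖ :=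
      DenseRange.induction_on (TopologicalSpace.denseRange_denseSeq Ell2) x
        (isClosed_eq (by fun_prop) (by fun_prop)) hω
    rw [ContinuousLinearMap.comp_apply, ContinuousLinearMap.adjoint_inner_left,
      inner_self_eq_norm_sq_to_K, ContinuousLinearMap.comp_apply, hx,
      ← inner_self_eq_norm_sq_to_K, ← ContinuousLinearMap.adjoint_inner_left,
      ← ContinuousLinearMap.star_eq_adjoint, star_fiberProj, ← mul_apply_eq_comp,
      fiberProj_mul_self]
  · rw [ContinuousLinearMap.comp_assoc]
    exact congrArg _ (fiberProj_mul_self (n ω))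
  · filter_upwards [hTa ψ, ψ.mem_fiber] with ω h1 h2
    rw [h1, ContinuousLinearMap.comp_apply, fiberProj_eq_self h2]

end DirectIntegral

/-! ### Multiplicity theory -/

section Multiplicity

variable {Ω : Type*} [MeasurableSpace Ω] {ν : Measure Ω}

/-! ### Rank of an index within the support of a sequence of densities -/

section Counting

open Classical in
/-- The number of indices below `k` at which the sequence `j ↦ ρ j ω` does not vanish. -/
def countSupport (ρ : ℕ → Ω → ℝ) (k : ℕ) (ω : Ω) : ℕ := Nat.count (fun j => ρ j ω ≠ 0) k

/-- The number of indices at which the sequence `j ↦ ρ j ω` does not vanish. -/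
def multiplicity (ρ : ℕ → Ω → ℝ) (ω : Ω) : ℕ∞ := {j | ρ j ω ≠ 0}.encard

lemma measurable_countSupport {ρ : ℕ → Ω → ℝ} (hρ : ∀ k, Measurable (ρ k)) (k : ℕ) :
    Measurable (countSupport ρ k) := by
  classical
  induction k with
  | zero =>
    have : countSupport ρ 0 = fun _ => 0 := funext fun ω => by simp [countSupport]
    rw [this]
    exact measurable_const
  | succ k ih =>
    have : countSupport ρ (k + 1) = fun ω => countSupport ρ k ω + if ρ k ω ≠ 0 then 1 else 0 :=
      funext fun ω => by simp only [countSupport, Nat.count_succ]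
    rw [this]
    refine ih.add (Measurable.ite ?_ measurable_const measurable_const)
    exact (hρ k (measurableSet_singleton 0)).compl

lemma measurable_multiplicity {ρ : ℕ → Ω → ℝ} (hρ : ∀ k, Measurable (ρ k)) :
    Measurable (multiplicity ρ) := by
  refine measurable_encard.comp (measurable_set_iff.2 fun k => ?_)
  exact measurable_to_prop ((hρ k (measurableSet_singleton 0)).compl.congr (by ext; simp))

lemma countSupport_lt_multiplicity {ρ : ℕ → Ω → ℝ} {k : ℕ} {ω : Ω} (h : ρ k ω ≠ 0) :
    (countSupport ρ k ω : ℕ∞) < multiplicity ρ ω := by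
  classical
  have h1 : countSupport ρ (k + 1) ω = countSupport ρ k ω + 1 := by
    simp only [countSupport, Nat.count_succ, if_pos h]
  have h2 : (countSupport ρ (k + 1) ω : ℕ∞) ≤ multiplicity ρ ω := by
    rw [countSupport, Nat.count_eq_card_filter_range, ← Set.encard_coe_eq_coe_finsetCard]
    refine Set.encard_le_encard fun j hj => ?_
    simpa using (Finset.mem_filter.1 (Finset.mem_coe.1 hj)).2
  refine lt_of_lt_of_le ?_ h2
  rw [h1]
  exact_mod_cast Nat.lt_succ_self _

lemma countSupport_ne {ρ : ℕ → Ω → ℝ} {k l : ℕ} {ω : Ω} (hk : ρ k ω ≠ 0) (hl : ρ l ω ≠ 0)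
    (hkl : k ≠ l) : countSupport ρ k ω ≠ countSupport ρ l ω := fun h =>
  hkl (Nat.count_injective (p := fun j => ρ j ω ≠ 0) hk hl (by simpa only [countSupport] using h))

lemma exists_countSupport_eq {ρ : ℕ → Ω → ℝ} {i : ℕ} {ω : Ω}
    (h : (i : ℕ∞) < multiplicity ρ ω) : ∃ k, ρ k ω ≠ 0 ∧ countSupport ρ k ω = i := by
  classical
  have hfin : ∀ hf : ({j | ρ j ω ≠ 0} : Set ℕ).Finite, i < hf.toFinset.card := fun hf => by
    rw [multiplicity, hf.encard_eq_coe_toFinset_card] at h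
    exact_mod_cast h
  refine ⟨Nat.nth (fun j => ρ j ω ≠ 0) i, Nat.nth_mem i hfin, ?_⟩
  have := Nat.count_nth hfin
  simpa only [countSupport] using this

end Counting

/-- The k-th section is placed in the coordinate that counts the earlier densities not vanishing at
ω. The nonzero sections at ω then fill exactly the first `multiplicity ρ ω` coordinates without
gaps, so the fibre is a standard space H_k. -/
lemma exists_cyclic_sections {ρ : ℕ → Ω → ℝ} (hm : ∀ k, Measurable (ρ k))
    (h0 : ∀ k ω, 0 ≤ ρ k ω) (hi : ∀ k, Integrable (ρ k) ν) :
    ∃ V : ℕ → DirectIntegral ν (multiplicity ρ), ∀ k, ∀ᵐ ω ∂ν,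
      V k ω = ((√(ρ k ω) : ℝ) : ℂ) • (lp.single 2 (countSupport ρ k ω) (1 : ℂ) : Ell2) := by
  have : ∀ k, ∃ ψ : DirectIntegral ν (multiplicity ρ), ∀ᵐ ω ∂ν,
      ψ ω = ((√(ρ k ω) : ℝ) : ℂ) • (lp.single 2 (countSupport ρ k ω) (1 : ℂ) : Ell2) := by
    intro k
    have hsq : MemLp (fun ω => √(ρ k ω)) 2 ν := by
      refine (memLp_two_iff_integrable_sq (hm k).sqrt.aestronglyMeasurable).2 ?_
      simpa only [Real.sq_sqrt (h0 k _)] using hi k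
    refine DirectIntegral.exists_of_memLp (hsq.of_le ?_ ?_) ?_
    · refine (Complex.measurable_ofReal.comp (hm k).sqrt).aestronglyMeasurable.smul ?_
      exact ((StronglyMeasurable.of_discrete (f := fun i : ℕ => (lp.single 2 i (1 : ℂ) : Ell2))
        ).comp_measurable (measurable_countSupport hm k)).aestronglyMeasurable
    · refine Eventually.of_forall fun ω => ?_
      rw [norm_smul, lp.norm_single (by norm_num)]
      simp
    · refine Eventually.of_forall fun ω i hi => ?_
      by_cases h : ρ k ω = 0
      · simp [h]
      · have hne : i ≠ countSupport ρ k ω := fun h' => by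
          have := countSupport_lt_multiplicity h
          rw [← h'] at this
          exact absurd hi (not_le.2 this)
        rw [lp.coeFn_smul, Pi.smul_apply, lp.single_apply_ne _ _ _ hne, smul_zero]
  choose V hV using this
  exact ⟨V, hV⟩

/-- Two distinct sections that are both nonzero at ω sit in different coordinates there, so they are
orthogonal pointwise; the square root of the density produces ρ_k on the diagonal. -/
lemma inner_cyclic_sections {ρ : ℕ → Ω → ℝ} (h0 : ∀ k ω, 0 ≤ ρ k ω)
    {V : ℕ → DirectIntegral ν (multiplicity ρ)} (hV : ∀ k, ∀ᵐ ω ∂ν,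
      V k ω = ((√(ρ k ω) : ℝ) : ℂ) • (lp.single 2 (countSupport ρ k ω) (1 : ℂ) : Ell2))
    (f g : Lp ℂ ∞ ν) (k l : ℕ) :
    ⟪diagOp f (V k), diagOp g (V l)⟫_ℂ =
      if k = l then ∫ ω, mulFn (star f) g ω * ρ k ω ∂ν else 0 := by
  have key : ∀ᵐ ω ∂ν, ⟪diagOp f (V k) ω, diagOp g (V l) ω⟫_ℂ =
      if k = l then mulFn (star f) g ω * ρ k ω else 0 := by
    filter_upwards [hV k, hV l, coeFn_diagOp f (V k), coeFn_diagOp g (V l),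
      coeFn_mulFn (star f) g, Lp.coeFn_star f] with ω h1 h2 h3 h4 h5 h6
    rw [h3, h4, h1, h2, inner_smul_left, inner_smul_right, inner_smul_left, inner_smul_right,
      lp.inner_single_left]
    split_ifs with hkl
    · subst hkl
      rw [h5, h6, lp.single_apply_self]
      have hs : ((√(ρ k ω) : ℝ) : ℂ) * ((√(ρ k ω) : ℝ) : ℂ) = ρ k ω := by
        rw [← Complex.ofReal_mul, Real.mul_self_sqrt (h0 k ω)]
      simp only [Pi.star_apply, RCLike.star_def, Complex.conj_ofReal, RCLike.inner_apply, map_one,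
        mul_one]
      rw [← hs]
      ring
    · by_cases hk : ρ k ω = 0
      · simp [hk]
      by_cases hl : ρ l ω = 0
      · simp [hl]
      rw [lp.single_apply_ne _ _ _ (countSupport_ne hk hl hkl)]
      simp
  rw [DirectIntegral.inner_def, integral_congr_ae key]
  split_ifs <;> simp

/-- Each coordinate below the multiplicity is the position of some nonvanishing density, so a vector
orthogonal to all sections has no nonzero coordinate. -/
lemma dense_span_cyclic_sections {ρ : ℕ → Ω → ℝ} (h0 : ∀ k ω, 0 ≤ ρ k ω)
    {V : ℕ → DirectIntegral ν (multiplicity ρ)} (hV : ∀ k, ∀ᵐ ω ∂ν,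
      V k ω = ((√(ρ k ω) : ℝ) : ℂ) • (lp.single 2 (countSupport ρ k ω) (1 : ℂ) : Ell2)) :
    Dense (Submodule.span ℂ (Set.range fun p : ℕ × Lp ℂ ∞ ν => diagOp p.2 (V p.1)) :
      Set (DirectIntegral ν (multiplicity ρ))) := by
  refine dense_span_of_forall_inner_eq_zero fun ψ hψ => DirectIntegral.ext ?_
  have h1 : ∀ᵐ ω ∂ν, ∀ k, ⟪V k ω, ψ ω⟫_ℂ = 0 := ae_all_iff.2 fun k =>
    ae_inner_eq_zero fun f => by
      have := hψ _ ⟨(k, f), rfl⟩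
      rwa [← DirectIntegral.toLp.inner_map_map] at this
  filter_upwards [h1, ae_all_iff.2 hV, ψ.mem_fiber, Lp.coeFn_zero Ell2 2 ν] with ω h1 h2 h3 h4
  rw [map_zero, h4]
  refine lp.ext (funext fun i => ?_)
  rcases le_or_gt (multiplicity ρ ω) i with hi | hi
  · exact h3 i hi
  · obtain ⟨k, hk, rfl⟩ := exists_countSupport_eq hi
    have := h1 k
    rw [h2, inner_smul_left, lp.inner_single_left, mul_eq_zero] at this
    have hne : (starRingEnd ℂ) ((√(ρ k ω) : ℝ) : ℂ) ≠ 0 := by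
      rw [Complex.conj_ofReal]
      exact Complex.ofReal_ne_zero.2 (Real.sqrt_ne_zero'.2 (lt_of_le_of_ne (h0 k ω) (Ne.symm hk)))
    simpa using this.resolve_left hne

variable {E : Type*} [NormedAddCommGroup E] [InnerProductSpace ℂ E] [CompleteSpace E]

/-- A `*`-representation of `L^∞(ν)` on a separable Hilbert space splits into cyclic
subrepresentations. -/
lemma exists_orthogonal_cyclic [TopologicalSpace.SeparableSpace E]
    (ϖ : Lp ℂ ∞ ν → (E →L[ℂ] E)) (hmul : ∀ f g, ϖ (mulFn f g) = ϖ f * ϖ g)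
    (hstar : ∀ f, ϖ (star f) = star (ϖ f)) (hone : ϖ (oneFn ν) = 1) :
    ∃ η : ℕ → E, (∀ k l f g, k ≠ l → ⟪ϖ f (η k), ϖ g (η l)⟫_ℂ = 0) ∧
      Dense (Submodule.span ℂ (Set.range fun p : ℕ × Lp ℂ ∞ ν => ϖ p.2 (η p.1)) : Set E) := by
  set ξ := TopologicalSpace.denseSeq E with hξ
  set M : ℕ → Submodule ℂ E := fun k =>
    (Submodule.span ℂ {x | ∃ j < k, ∃ f, x = ϖ f (ξ j)}).topologicalClosure with hM
  have hMc : ∀ k, IsClosed (M k : Set E) := fun k => Submodule.isClosed_topologicalClosure _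
  have hMcomplete : ∀ k, CompleteSpace (M k) := fun k => (hMc k).completeSpace_coe
  have hinv : ∀ k f, ∀ x ∈ M k, ϖ f x ∈ M k := by
    intro k f
    have : M k ≤ (M k).comap (ϖ f).toLinearMap := by
      refine Submodule.topologicalClosure_minimal _ (Submodule.span_le.2 ?_)
        ((hMc k).preimage (ϖ f).continuous)
      rintro _ ⟨j, hj, g, rfl⟩
      refine Submodule.le_topologicalClosure _ (Submodule.subset_span ⟨j, hj, mulFn f g, ?_⟩)
      rw [hmul]; rfl
    exact this
  have hmono : Monotone M := fun k l hkl =>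
    Submodule.topologicalClosure_mono (Submodule.span_mono fun x ⟨j, hj, h⟩ => ⟨j, hj.trans_le hkl, h⟩)
  -- Gram–Schmidt for cyclic subspaces: `M k` is the closed invariant subspace generated by the
  -- first k vectors of a dense sequence, and `η k` is the part of `ξ k` orthogonal to it.
  -- Invariance of `M k` makes the cyclic subspaces of the `η k` mutually orthogonal.
  set η : ℕ → E := fun k => ξ k - (M k).starProjection (ξ k) with hη
  have hηM : ∀ k, η k ∈ (M k)ᗮ := fun k => Submodule.sub_starProjection_mem_orthogonal _
  have hξM : ∀ k, ξ k ∈ M (k + 1) := fun k =>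
    Submodule.le_topologicalClosure _ (Submodule.subset_span
      ⟨k, Nat.lt_succ_self k, oneFn ν, by rw [hone]; rfl⟩)
  have hηM' : ∀ k, η k ∈ M (k + 1) := fun k =>
    (M (k + 1)).sub_mem (hξM k) (hmono (Nat.le_succ k) (Submodule.starProjection_apply_mem _ _))
  have horth : ∀ k l f g, k < l → ⟪ϖ f (η k), ϖ g (η l)⟫_ℂ = 0 := by
    intro k l f g hkl
    rw [← ContinuousLinearMap.adjoint_inner_left, ← ContinuousLinearMap.star_eq_adjoint, ← hstar]
    exact hηM l _ (hinv l _ _ (hinv l _ _ (hmono (Nat.succ_le_of_lt hkl) (hηM' k))))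
  refine ⟨η, fun k l f g hkl => ?_, ?_⟩
  · rcases lt_or_gt_of_ne hkl with h | h
    · exact horth k l f g h
    · rw [← inner_conj_symm, horth l k g f h, map_zero]
  · set N := (Submodule.span ℂ
      (Set.range fun p : ℕ × Lp ℂ ∞ ν => ϖ p.2 (η p.1))).topologicalClosure with hN
    have hNc : IsClosed (N : Set E) := Submodule.isClosed_topologicalClosure _
    have hNinv : ∀ f, ∀ x ∈ N, ϖ f x ∈ N := by
      intro f
      have : N ≤ N.comap (ϖ f).toLinearMap := by
        refine Submodule.topologicalClosure_minimal _ (Submodule.span_le.2 ?_)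
          (hNc.preimage (ϖ f).continuous)
        rintro _ ⟨⟨j, g⟩, rfl⟩
        refine Submodule.le_topologicalClosure _ (Submodule.subset_span ⟨(j, mulFn f g), ?_⟩)
        simp only [hmul]; rfl
      exact this
    have hηN : ∀ k, η k ∈ N := fun k =>
      Submodule.le_topologicalClosure _ (Submodule.subset_span ⟨(k, oneFn ν), by simp [hone]⟩)
    have hMN : ∀ k, M k ≤ N := by
      intro k
      induction k with
      | zero =>
        refine Submodule.topologicalClosure_minimal _ (Submodule.span_le.2 ?_) hNc
        rintro _ ⟨j, hj, -⟩
        exact absurd hj (Nat.not_lt_zero j)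
      | succ k ih =>
        refine Submodule.topologicalClosure_minimal _ (Submodule.span_le.2 ?_) hNc
        rintro _ ⟨j, hj, f, rfl⟩
        refine hNinv f _ ?_
        rcases Nat.lt_succ_iff_lt_or_eq.1 hj with h | rfl
        · exact ih (hmono h (hξM j))
        · have : ξ j = η j + (M j).starProjection (ξ j) := by simp [hη]
          rw [this]
          exact N.add_mem (hηN j) (ih (Submodule.starProjection_apply_mem _ _))
    have hle : closure (Set.range ξ) ⊆ N :=
      hNc.closure_subset_iff.2 (Set.range_subset_iff.2 fun k => hMN _ (hξM k))
    intro x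
    exact hle (TopologicalSpace.denseRange_denseSeq E x)

/-- A normal `*`-representation of `L^∞(ν)` on a separable Hilbert space is unitarily equivalent to
the diagonal representation on a direct integral. -/
theorem exists_directIntegral_equiv [TopologicalSpace.SeparableSpace E]
    (ϖ : Lp ℂ ∞ ν → (E →L[ℂ] E)) (hmul : ∀ f g, ϖ (mulFn f g) = ϖ f * ϖ g)
    (hstar : ∀ f, ϖ (star f) = star (ϖ f)) (hone : ϖ (oneFn ν) = 1)
    (hnormal : ∀ η : E, ∃ ρ : Ω → ℝ, Measurable ρ ∧ (∀ ω, 0 ≤ ρ ω) ∧ Integrable ρ ν ∧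
      ∀ f, ⟪η, ϖ f η⟫_ℂ = ∫ ω, f ω * ρ ω ∂ν) :
    ∃ n : Ω → ℕ∞, Measurable n ∧ ∃ W : E ≃ₗᵢ[ℂ] DirectIntegral ν n,
      ∀ f η, W (ϖ f η) = diagOp f (W η) := by
  obtain ⟨η, horth, hdense⟩ := exists_orthogonal_cyclic ϖ hmul hstar hone
  choose ρ hρm hρ0 hρi hρ using fun k => hnormal (η k)
  obtain ⟨V, hV⟩ := exists_cyclic_sections hρm hρ0 hρi
  -- Both total families have the same Gram matrix: zero between different cyclic parts and ∫ f̄ g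
  -- ρ_k within one.
  obtain ⟨W, hW⟩ := exists_linearIsometryEquiv_of_inner_eq hdense
    (dense_span_cyclic_sections hρ0 hV) (by
      rintro ⟨k, f⟩ ⟨l, g⟩
      rw [inner_cyclic_sections hρ0 hV]
      split_ifs with hkl
      · subst hkl
        rw [← hρ, hmul, hstar, mul_apply_eq_comp, ContinuousLinearMap.star_eq_adjoint,
          ContinuousLinearMap.adjoint_inner_right]
      · exact horth k l f g hkl)
  refine ⟨_, measurable_multiplicity hρm, W, fun f x => ?_⟩
  have : W.toContinuousLinearEquiv.toContinuousLinearMap ∘L ϖ f =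
      diagOp f ∘L W.toContinuousLinearEquiv.toContinuousLinearMap := by
    refine ContinuousLinearMap.ext_on hdense ?_
    rintro _ ⟨⟨k, g⟩, rfl⟩
    have h1 := hW (k, mulFn f g)
    have h2 := hW (k, g)
    simp only [hmul, mul_apply_eq_comp, diagOp_mulFn] at h1 h2
    show W (ϖ f (ϖ g (η k))) = diagOp f (W (ϖ g (η k)))
    rw [h1, h2]
  exact congrArg (fun T => T x) this

end Multiplicity

/-! ### The GNS construction for completely positive maps into sesquilinear forms -/

section GNS

variable {A : Type u} [Ring A] [StarRing A] [Algebra ℂ A] [StarModule ℂ A]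
  {H : Type u} {V : Type u} [NormedAddCommGroup H] [InnerProductSpace ℂ H] [CompleteSpace H]
  [AddCommGroup V] [Module ℂ V] [Module (H →L[ℂ] H)ᵐᵒᵖ V]
  {𝓗 : Type*} [NormedAddCommGroup 𝓗] [InnerProductSpace ℂ 𝓗] [CompleteSpace 𝓗]

/-- Complete positivity of a map into sesquilinear forms, together with sesquilinearity. -/
structure IsCPForm (S : A →ₗ[ℂ] (V → V → (H →L[ℂ] H))) : Prop where
  sesquilinear : ∀ d, IsSesquilinearForm (S d)
  cp : ∀ (k : ℕ) (d : Fin k → A) (v : Fin k → V),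
    0 ≤ ∑ i, ∑ j, S (star (d i) * d j) (v i) (v j)

namespace IsCPForm

variable {S : A →ₗ[ℂ] (V → V → (H →L[ℂ] H))}

/-- Positive operators are self-adjoint. Apply this to the pairs (d, v), (d', z v') and subtract the
diagonal terms; the values z = 1 and z = i separate the two off-diagonal terms. -/
lemma star_apply (hS : IsCPForm S) (d d' : A) (v v' : V) :
    star (S (star d * d') v v') = S (star d' * d) v' v := by
  have key : ∀ z : ℂ, IsSelfAdjoint (z • S (star d * d') v v' + conj z • S (star d' * d) v' v) := by
    intro z
    have h1 := (hS.cp 2 ![d, d'] ![v, z • v']).isSelfAdjoint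
    have h2 := (hS.cp 1 ![d] ![v]).isSelfAdjoint
    have h3 := (hS.cp 1 ![d'] ![z • v']).isSelfAdjoint
    simp only [Fin.sum_univ_two, Finset.univ_unique, Finset.sum_singleton, Fin.default_eq_zero,
      Matrix.cons_val_zero, Matrix.cons_val_one, Matrix.cons_val_fin_one] at h1 h2 h3
    have := (h1.sub h2).sub h3
    refine (congrArg IsSelfAdjoint ?_).mp this
    rw [(hS.sesquilinear _).smul_right, (hS.sesquilinear _).smul_left]
    abel
  have h1 := (key 1).star_eq
  have h2 := (key Complex.I).star_eq
  simp only [star_add, star_smul, map_one, one_smul, Complex.conj_I, RCLike.star_def,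
    neg_smul, star_neg, neg_neg] at h1 h2
  have h3 : Complex.I • (star (S (star d' * d) v' v) - star (S (star d * d') v v')) =
      Complex.I • (S (star d * d') v v' - S (star d' * d) v' v) := by
    rw [smul_sub, smul_sub]
    rw [← sub_eq_add_neg] at h2
    rw [← h2]; abel
  have h4 := smul_right_injective _ Complex.I_ne_zero h3
  have h5 : (2 : ℂ) • star (S (star d * d') v v') = (2 : ℂ) • S (star d' * d) v' v := by
    rw [two_smul, two_smul]
    calc star (S (star d * d') v v') + star (S (star d * d') v v')
        = (star (S (star d * d') v v') + star (S (star d' * d) v' v)) -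
          (star (S (star d' * d) v' v) - star (S (star d * d') v v')) := by abel
      _ = _ := by rw [h1, h4]; abel
  exact smul_right_injective _ two_ne_zero h5

/-- The kernel on `A × V` attached to a completely positive map. -/
def kernel (S : A →ₗ[ℂ] (V → V → (H →L[ℂ] H))) : Matrix (A × V) (A × V) (H →L[ℂ] H) :=
  Matrix.of fun p q => S (star p.1 * q.1) p.2 q.2

/-- Operator coefficients a in L(H) are absorbed into the module as v·a by sesquilinearity over
L(H), which leaves the defining inequality of complete positivity. -/
lemma posSemidef_kernel (hS : IsCPForm S) : (kernel S).PosSemidef := by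
  refine ⟨Matrix.IsHermitian.ext fun p q => hS.star_apply _ _ _ _, fun x => ?_⟩
  have := hS.cp x.support.card (fun i => (x.support.equivFin.symm i : A × V).1)
    (fun i => MulOpposite.op (x (x.support.equivFin.symm i : A × V)) •
      (x.support.equivFin.symm i : A × V).2)
  convert this using 1
  simp only [Finsupp.sum]
  rw [← Finset.sum_coe_sort, ← x.support.equivFin.symm.sum_comp]
  refine Finset.sum_congr rfl fun i _ => ?_
  rw [← Finset.sum_coe_sort, ← x.support.equivFin.symm.sum_comp]
  refine Finset.sum_congr rfl fun j _ => ?_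
  rw [(hS.sesquilinear _).op_left, (hS.sesquilinear _).op_right, ← mul_assoc]
  rfl

end IsCPForm

/-- A GNS representation of a completely positive map into sesquilinear forms: `π` is a
`*`-representation, `S_d(v, w) = (Jv)* π(d) (Jw)` and the vectors `π(d) (Jv) h` are total. -/
structure IsGNS (S : A →ₗ[ℂ] (V → V → (H →L[ℂ] H))) (π : A →⋆ₐ[ℂ] (𝓗 →L[ℂ] 𝓗))
    (J : V →ₗ[ℂ] (H →L[ℂ] 𝓗)) : Prop where
  moduleMap : IsModuleMap J
  dilates : ∀ d v w, S d v w = (J v)† ∘L π d ∘L J w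
  dense : Dense (Submodule.span ℂ (Set.range fun p : (A × V) × H => π p.1.1 (J p.1.2 p.2)) : Set 𝓗)

lemma inner_self_eq_ofReal {E : Type*} [NormedAddCommGroup E] [InnerProductSpace ℂ E] (x : E) :
    ⟪x, x⟫_ℂ = ((‖x‖ ^ 2 : ℝ) : ℂ) := by
  rw [inner_self_eq_norm_sq_to_K]; push_cast; rfl

lemma _root_.IsStarProjection.star_sub_mul_sub {R : Type*} [Ring R] [StarRing R] {p r : R}
    (hp : IsStarProjection p) (hr : IsStarProjection r) (h : p * r = r) :
    star (p - r) * (p - r) = p - r := by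
  have h' : r * p = r := by
    have := congrArg star h
    rwa [star_mul, hp.isSelfAdjoint.star_eq, hr.isSelfAdjoint.star_eq] at this
  rw [star_sub, hp.isSelfAdjoint.star_eq, hr.isSelfAdjoint.star_eq, sub_mul, mul_sub, mul_sub,
    hp.isIdempotentElem, hr.isIdempotentElem, h, h', sub_self, sub_zero]

lemma _root_.IsStarProjection.conj_sub_conj {R : Type*} [Ring R] [StarRing R] {p r : R}
    (hp : IsStarProjection p) (hr : IsStarProjection r) (h : p * r = r) (d : R) :
    star d * p * d - star d * r * d = star ((p - r) * d) * ((p - r) * d) := by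
  have := hp.star_sub_mul_sub hr h
  calc _ = star d * (p - r) * d := by noncomm_ring
    _ = star d * (star (p - r) * (p - r)) * d := by rw [this]
    _ = _ := by rw [star_mul]; noncomm_ring

lemma IsGNS.inner_conj {S : A →ₗ[ℂ] (V → V → (H →L[ℂ] H))} {π : A →⋆ₐ[ℂ] (𝓗 →L[ℂ] 𝓗)}
    {J : V →ₗ[ℂ] (H →L[ℂ] 𝓗)} (hG : IsGNS S π J) (d r : A) (v : V) (h : H) :
    ⟪π r (π d (J v h)), π d (J v h)⟫_ℂ = ⟪S (star d * r * d) v v h, h⟫_ℂ := by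
  rw [hG.dilates, ContinuousLinearMap.comp_apply, ContinuousLinearMap.adjoint_inner_left,
    ContinuousLinearMap.comp_apply, map_mul, map_mul, map_star, mul_apply_eq_comp,
    mul_apply_eq_comp, ContinuousLinearMap.star_eq_adjoint, ContinuousLinearMap.adjoint_inner_left]

lemma IsGNS.apply_mono {S : A →ₗ[ℂ] (V → V → (H →L[ℂ] H))} {π : A →⋆ₐ[ℂ] (𝓗 →L[ℂ] 𝓗)}
    {J : V →ₗ[ℂ] (H →L[ℂ] 𝓗)} (hG : IsGNS S π J) {p r : A} (hp : IsStarProjection p)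
    (hr : IsStarProjection r) (h : p * r = r) (d : A) (v : V) :
    S (star d * r * d) v v ≤ S (star d * p * d) v v := by
  have h1 : S (star d * p * d) v v - S (star d * r * d) v v =
      (π ((p - r) * d) ∘L J v)† ∘L (π ((p - r) * d) ∘L J v) := by
    have h3 := congrArg (fun d => S d v v) (hp.conj_sub_conj hr h d)
    simp only [map_sub, Pi.sub_apply] at h3
    rw [h3, hG.dilates, map_mul, map_star, ContinuousLinearMap.adjoint_comp,
      ContinuousLinearMap.star_eq_adjoint]
    rfl
  rw [ContinuousLinearMap.le_def, h1]
  exact ContinuousLinearMap.isPositive_adjoint_comp_self _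

/-- For projections r ≤ p the difference is again a projection, so the squared distance of the
images is a difference of values of S. Weak convergence of S thereby becomes strong convergence of
π. -/
lemma IsGNS.norm_sub_sq {S : A →ₗ[ℂ] (V → V → (H →L[ℂ] H))} {π : A →⋆ₐ[ℂ] (𝓗 →L[ℂ] 𝓗)}
    {J : V →ₗ[ℂ] (H →L[ℂ] 𝓗)} (hG : IsGNS S π J) {p r : A} (hp : IsStarProjection p)
    (hr : IsStarProjection r) (hpr : p * r = r) (d : A) (v : V) (h : H) :
    ‖π r (π d (J v h)) - π p (π d (J v h))‖ ^ 2 =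
      (⟪S (star d * p * d) v v h, h⟫_ℂ - ⟪S (star d * r * d) v v h, h⟫_ℂ).re := by
  have h1 : ⟪S (star d * p * d) v v h, h⟫_ℂ - ⟪S (star d * r * d) v v h, h⟫_ℂ =
      ⟪π (p - r) (π d (J v h)), π (p - r) (π d (J v h))⟫_ℂ := by
    rw [← hG.inner_conj, ← hG.inner_conj, ← inner_sub_left, ← sub_apply, ← map_sub,
      ← ContinuousLinearMap.adjoint_inner_left (π (p - r)), ← ContinuousLinearMap.star_eq_adjoint,
      ← map_star, ← mul_apply_eq_comp (π (star (p - r))) (π (p - r)),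
      ← map_mul π (star (p - r)) (p - r), hp.star_sub_mul_sub hr hpr]
  rw [h1, inner_self_eq_ofReal, Complex.ofReal_re, map_sub, sub_apply, norm_sub_rev]

lemma tendsto_inner_of_isLUB_range {ι : Type*} [Preorder ι] [IsDirectedOrder ι] [Nonempty ι]
    {a : ι → (H →L[ℂ] H)} (hm : Monotone a) {s : H →L[ℂ] H} (hs : IsLUB (Set.range a) s) (x y : H) :
    Tendsto (fun i => ⟪a i x, y⟫_ℂ) atTop (𝓝 ⟪s x, y⟫_ℂ) := by
  refine (tendsto_inner_of_isLUB (Set.range_nonempty _)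
    (directedOn_range.2 hm.directed_le) hs x y).comp
    (g := fun d : Set.range a => ⟪d.1 x, y⟫_ℂ) (f := fun i => ⟨a i, i, rfl⟩) (tendsto_atTop.2 ?_)
  rintro ⟨_, i, rfl⟩
  filter_upwards [eventually_ge_atTop i] with j hj
  exact hm hj

lemma IsGNS.tendsto_apply_of_tendsto {S : A →ₗ[ℂ] (V → V → (H →L[ℂ] H))}
    {π : A →⋆ₐ[ℂ] (𝓗 →L[ℂ] 𝓗)} {J : V →ₗ[ℂ] (H →L[ℂ] 𝓗)} (hG : IsGNS S π J) {ι : Type*}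
    {l : Filter ι} {q : ι → A} {q₀ : A} (hq : ∀ i, IsStarProjection (q i))
    (hq₀ : IsStarProjection q₀) (hle : ∀ i, q₀ * q i = q i)
    (h : ∀ d v h, Tendsto (fun i => ⟪S (star d * q i * d) v v h, h⟫_ℂ) l
      (𝓝 ⟪S (star d * q₀ * d) v v h, h⟫_ℂ)) (x : 𝓗) :
    Tendsto (fun i => π (q i) x) l (𝓝 (π q₀ x)) := by
  refine tendsto_apply_of_dense (C := 1) ?_ hG.dense ?_ x
  · exact Eventually.of_forall fun i => ((hq i).map π).norm_le
  rintro _ ⟨⟨⟨d, v⟩, x⟩, rfl⟩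
  rw [tendsto_iff_norm_sub_tendsto_zero]
  have h0 : Tendsto (fun i => ‖π (q i) (π d (J v x)) - π q₀ (π d (J v x))‖ ^ 2) l (𝓝 0) := by
    simp only [hG.norm_sub_sq hq₀ (hq _) (hle _)]
    have := (Complex.continuous_re.tendsto _).comp
      ((h d v x).const_sub ⟪S (star d * q₀ * d) v v x, x⟫_ℂ)
    rwa [sub_self, Complex.zero_re] at this
  have h1 := (Real.continuous_sqrt.tendsto 0).comp h0
  rw [Real.sqrt_zero] at h1
  exact h1.congr fun i => Real.sqrt_sq (norm_nonneg _)

lemma eq_of_forall_inner_eq {E : Type*} [NormedAddCommGroup E] [InnerProductSpace ℂ E] {s : Set E}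
    (hs : Dense (Submodule.span ℂ s : Set E)) {z z' : E} (h : ∀ a ∈ s, ⟪a, z⟫_ℂ = ⟪a, z'⟫_ℂ) :
    z = z' := by
  refine hs.eq_of_inner_right ℂ fun y hy => ?_
  induction hy using Submodule.span_induction with
  | mem x hx => exact h x hx
  | zero => rw [inner_zero_left, inner_zero_left]
  | add x y _ _ hx hy => rw [inner_add_left, inner_add_left, hx, hy]
  | smul c x _ hx => rw [inner_smul_left, inner_smul_left, hx]

/-- The vectors b' take up the deficit: the squared norms of a combination of b and of b' add up to
C² times that of a, so the former alone is bounded by it. -/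
lemma exists_clm_of_inner_add_eq {ι E E' : Type*} [NormedAddCommGroup E] [InnerProductSpace ℂ E]
    [NormedAddCommGroup E'] [InnerProductSpace ℂ E'] [CompleteSpace E'] {a : ι → E} {b b' : ι → E'}
    (ha : Dense (Submodule.span ℂ (Set.range a) : Set E)) {C : ℝ} (hC : 0 ≤ C)
    (h : ∀ i j, ⟪b i, b j⟫_ℂ + ⟪b' i, b' j⟫_ℂ = (C : ℂ) ^ 2 * ⟪a i, a j⟫_ℂ) :
    ∃ T : E →L[ℂ] E', ∀ i, T (a i) = b i := by
  obtain ⟨T, hT, -⟩ := exists_clm_of_norm_le (b := b) ha hC fun c => by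
    have h1 : ⟪Finsupp.linearCombination ℂ b c, Finsupp.linearCombination ℂ b c⟫_ℂ +
        ⟪Finsupp.linearCombination ℂ b' c, Finsupp.linearCombination ℂ b' c⟫_ℂ = (C : ℂ) ^ 2 *
        ⟪Finsupp.linearCombination ℂ a c, Finsupp.linearCombination ℂ a c⟫_ℂ := by
      simp only [inner_linearCombination_self, ← Finset.sum_add_distrib, Finset.mul_sum]
      refine Finset.sum_congr rfl fun i _ => Finset.sum_congr rfl fun j _ => ?_
      rw [← mul_add, ← mul_add, h]
      ring
    have h2 := congrArg Complex.re h1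
    rw [inner_self_eq_ofReal, inner_self_eq_ofReal, inner_self_eq_ofReal, ← Complex.ofReal_pow, ← Complex.ofReal_mul, ← Complex.ofReal_add,
      Complex.ofReal_re, Complex.ofReal_re] at h2
    refine abs_le_of_sq_le_sq' ?_ (by positivity) |>.2
    rw [mul_pow, ← h2]
    exact le_add_of_nonneg_right (sq_nonneg _)
  exact ⟨T, hT⟩

/-- The space is the reproducing kernel Hilbert space of `kernel S`, on which A acts by left
multiplication in the first index. The hypothesis `hA` plays the role of d*d ≤ ‖d‖²: it passes to
the Gram matrices and bounds the action of d. -/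
theorem IsCPForm.exists_gns {S : A →ₗ[ℂ] (V → V → (H →L[ℂ] H))} (hS : IsCPForm S)
    (hA : ∀ d : A, ∃ (C : ℝ) (c : A), 0 ≤ C ∧ star d * d + star c * c = ((C : ℂ) ^ 2) • (1 : A)) :
    ∃ (𝓗 : Type u) (_ : NormedAddCommGroup 𝓗) (_ : InnerProductSpace ℂ 𝓗) (_ : CompleteSpace 𝓗)
      (π : A →⋆ₐ[ℂ] (𝓗 →L[ℂ] 𝓗)) (J : V →ₗ[ℂ] (H →L[ℂ] 𝓗)), IsGNS S π J := by
  have : Fact (kernel S).PosSemidef := ⟨hS.posSemidef_kernel⟩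
  set k : A × V → (H →L[ℂ] RKHS.OfKernel (kernel S)) :=
    RKHS.kerFun (RKHS.OfKernel (kernel S)) with hk
  have hinner : ∀ p q x y, ⟪k p x, k q y⟫_ℂ = ⟪x, S (star p.1 * q.1) p.2 q.2 y⟫_ℂ := by
    intro p q x y
    rw [← ContinuousLinearMap.adjoint_inner_right, ← ContinuousLinearMap.comp_apply,
      hk, ← RKHS.kernel_apply, RKHS.OfKernel.kernel_ofKernel]
    rfl
  set a : (A × V) × H → RKHS.OfKernel (kernel S) := fun p => k p.1 p.2 with ha
  have hdense : Dense (Submodule.span ℂ (Set.range a) : Set (RKHS.OfKernel (kernel S))) := by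
    rw [Submodule.dense_iff_topologicalClosure_eq_top, ← RKHS.kerFun_dense]
    congr 2
    ext z
    simp [ha, hk]
  -- Vectors are compared by their inner products with the kernel vectors, which turns each
  -- algebraic law for π and J into one for S.
  have hext : ∀ z z' : RKHS.OfKernel (kernel S), (∀ p, ⟪a p, z⟫_ℂ = ⟪a p, z'⟫_ℂ) → z = z' := by
    intro z z' h
    refine eq_of_forall_inner_eq hdense ?_
    rintro _ ⟨p, rfl⟩
    exact h p
  have hex : ∀ d : A, ∃ T : RKHS.OfKernel (kernel S) →L[ℂ] RKHS.OfKernel (kernel S),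
      ∀ p, T (a p) = a ((d * p.1.1, p.1.2), p.2) := by
    intro d
    obtain ⟨C, c, hC, hc⟩ := hA d
    refine exists_clm_of_inner_add_eq (b' := fun p => a ((c * p.1.1, p.1.2), p.2)) hdense hC ?_
    intro p q
    simp only [ha, hinner]
    rw [star_mul, star_mul, ← inner_smul_right, ← inner_add_right]
    have : star p.1.1 * star d * (d * q.1.1) + star p.1.1 * star c * (c * q.1.1) =
        (C : ℂ) ^ 2 • (star p.1.1 * q.1.1) := by
      calc _ = star p.1.1 * (star d * d + star c * c) * q.1.1 := by noncomm_ring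
        _ = _ := by rw [hc]; simp
    have h2 := congrArg (fun d => S d p.1.2 q.1.2 q.2) this
    simp only [map_add, map_smul, Pi.add_apply, Pi.smul_apply, add_apply, smul_apply] at h2
    rw [h2]
  choose π₀ hπ using hex
  have hclm : ∀ {T T' : RKHS.OfKernel (kernel S) →L[ℂ] RKHS.OfKernel (kernel S)},
      (∀ p, T (a p) = T' (a p)) → T = T' := by
    intro T T' h
    refine ContinuousLinearMap.ext_on hdense ?_
    rintro _ ⟨p, rfl⟩
    exact h p
  have hone : π₀ 1 = 1 := hclm fun p => by rw [hπ, one_mul]; rfl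
  have hmul : ∀ d d', π₀ (d * d') = π₀ d * π₀ d' := fun d d' => hclm fun p => by
    rw [hπ, mul_apply_eq_comp, hπ, hπ, mul_assoc]
  have hadd : ∀ d d', π₀ (d + d') = π₀ d + π₀ d' := fun d d' => hclm fun p => by
    rw [add_apply, hπ, hπ, hπ]
    refine hext _ _ fun q => ?_
    simp only [ha, inner_add_right, hinner, add_mul, mul_add, map_add, Pi.add_apply, add_apply]
  have hsmul : ∀ (z : ℂ) d, π₀ (z • d) = z • π₀ d := fun z d => hclm fun p => by
    rw [smul_apply, hπ, hπ]
    refine hext _ _ fun q => ?_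
    simp only [ha, inner_smul_right, hinner, smul_mul_assoc, mul_smul_comm, map_smul,
      Pi.smul_apply, smul_apply]
  have hstar : ∀ d, π₀ (star d) = star (π₀ d) := fun d => hclm fun p => hext _ _ fun q => by
    rw [ContinuousLinearMap.star_eq_adjoint, ContinuousLinearMap.adjoint_inner_right, hπ, hπ]
    simp only [ha, hinner, star_mul, mul_assoc]
  let π : A →⋆ₐ[ℂ] (RKHS.OfKernel (kernel S) →L[ℂ] RKHS.OfKernel (kernel S)) :=
    { toFun := π₀
      map_one' := hone
      map_mul' := hmul
      map_zero' := by simpa using hsmul 0 0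
      map_add' := hadd
      commutes' := fun z => by
        rw [Algebra.algebraMap_eq_smul_one, hsmul, hone, Algebra.algebraMap_eq_smul_one]
      map_star' := hstar }
  let J : V →ₗ[ℂ] (H →L[ℂ] RKHS.OfKernel (kernel S)) :=
    { toFun := fun v => k (1, v)
      map_add' := fun v w => ContinuousLinearMap.ext fun h => hext _ _ fun q => by
        simp only [ha, add_apply, inner_add_right, hinner, (hS.sesquilinear _).add_right]
      map_smul' := fun z v => ContinuousLinearMap.ext fun h => hext _ _ fun q => by
        simp only [ha, smul_apply, inner_smul_right, hinner, (hS.sesquilinear _).smul_right,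
          RingHom.id_apply] }
  refine ⟨_, inferInstance, inferInstance, inferInstance, π, J, ?_, ?_, ?_⟩
  · intro b v
    refine ContinuousLinearMap.ext fun h => hext _ _ fun q => ?_
    show ⟪k q.1 q.2, k (1, MulOpposite.op b • v) h⟫_ℂ = ⟪k q.1 q.2, k (1, v) (b h)⟫_ℂ
    rw [hinner, hinner, (hS.sesquilinear _).op_right]
    rfl
  · intro d v w
    refine ContinuousLinearMap.ext fun h => ext_inner_left ℂ fun h' => ?_
    rw [ContinuousLinearMap.comp_apply, ContinuousLinearMap.adjoint_inner_right]
    show _ = ⟪k (1, v) h', π₀ d (a ((1, w), h))⟫_ℂ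
    rw [hπ, mul_one, ha, hinner, star_one, one_mul]
  · suffices h : (fun p : (A × V) × H => π p.1.1 (J p.1.2 p.2)) = a by rw [h]; exact hdense
    funext p
    show π₀ _ (a ((1, _), _)) = _
    rw [hπ, mul_one]

end GNS

/-! ### The von Neumann algebra `L(K) ⊗ L^∞(ν)` and its normal representations -/

section VonNeumann

variable {Ω : Type u} [MeasurableSpace Ω] {ν : Measure Ω} {K : Type u} [NormedAddCommGroup K]
  [InnerProductSpace ℂ K]

lemma mem_tensorVN_iff {d : HilbertTensor K (Lp ℂ 2 ν) →L[ℂ] HilbertTensor K (Lp ℂ 2 ν)} :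
    d ∈ tensorVN ν K ↔ ∀ g ∈ StarSubalgebra.centralizer ℂ (elementaryOps ν K), Commute d g := by
  rw [tensorVN, StarSubalgebra.mem_centralizer_iff]
  exact ⟨fun h g hg => (h g hg).1.symm, fun h g hg => ⟨(h g hg).symm, (h _ (star_mem hg)).symm⟩⟩

/-- Take c = (‖d‖² − d*d)^{1/2}. Everything that commutes with d and d* commutes with this root, so
c stays in the double commutant. -/
lemma exists_star_mul_self_add_eq (d : tensorVN ν K) : ∃ c : tensorVN ν K,
    star d * d + star c * c = ((‖d.1‖ : ℂ) ^ 2) • (1 : tensorVN ν K) := by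
  set D : HilbertTensor K (Lp ℂ 2 ν) →L[ℂ] HilbertTensor K (Lp ℂ 2 ν) := d.1 with hD
  set x := ((‖D‖ : ℂ) ^ 2) • (1 : HilbertTensor K (Lp ℂ 2 ν) →L[ℂ] HilbertTensor K (Lp ℂ 2 ν)) -
    star D * D with hx
  have hx0 : 0 ≤ x := by
    rw [ContinuousLinearMap.nonneg_iff_isPositive]
    refine isPositive_of_inner_nonneg fun z => ?_
    have h1 : ⟪(star D * D) z, z⟫_ℂ = ((‖D z‖ ^ 2 : ℝ) : ℂ) := by
      rw [mul_apply_eq_comp, ContinuousLinearMap.star_eq_adjoint,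
        ContinuousLinearMap.adjoint_inner_left, inner_self_eq_ofReal]
    have h2 : ⟪((‖D‖ : ℂ) ^ 2 • (1 : HilbertTensor K (Lp ℂ 2 ν) →L[ℂ] _)) z, z⟫_ℂ =
        ((‖D‖ ^ 2 * ‖z‖ ^ 2 : ℝ) : ℂ) := by
      rw [smul_apply, one_apply_eq_self, inner_smul_left, inner_self_eq_ofReal]
      simp
    rw [hx, sub_apply, inner_sub_left, h1, h2, ← Complex.ofReal_sub, Complex.zero_le_real,
      sub_nonneg, ← mul_pow]
    exact pow_le_pow_left₀ (norm_nonneg _) (D.le_opNorm z) 2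
  have hmem : CFC.sqrt x ∈ tensorVN ν K := by
    rw [mem_tensorVN_iff]
    intro g hg
    have h1 := mem_tensorVN_iff.1 d.2 g hg
    have h2 := mem_tensorVN_iff.1 (star_mem d.2) g hg
    exact Commute.cfcₙ_nnreal (((Commute.one_left g).smul_left _).sub_left (h2.mul_left h1)) _
  refine ⟨⟨CFC.sqrt x, hmem⟩, Subtype.ext ?_⟩
  show star D * D + star (CFC.sqrt x) * CFC.sqrt x = _
  rw [(CFC.sqrt_nonneg x).isSelfAdjoint.star_eq, CFC.sqrt_mul_sqrt_self x hx0, hx]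
  simp

lemma star_conj_le {p r : tensorVN ν K} (hp : IsStarProjection p) (hr : IsStarProjection r)
    (h : p * r = r) (d : tensorVN ν K) : star d * r * d ≤ star d * p * d := by
  have h1 : 0 ≤ star ((p - r) * d).1 * ((p - r) * d).1 := star_mul_self_nonneg _
  have h3 : (star d * p * d).1 - (star d * r * d).1 = star ((p - r) * d).1 * ((p - r) * d).1 :=
    congrArg Subtype.val (hp.conj_sub_conj hr h d)
  exact sub_nonneg.1 (h1.trans_eq h3.symm)

/-- Normality concerns suprema in the von Neumann algebra. The strong limit q₀ gives the supremum of
the conjugated projections among all bounded operators, and it belongs to the algebra, whose order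
is the inherited one. -/
lemma isLUB_star_conj {ι : Type*} {l : Filter ι} [l.NeBot] {q : ι → tensorVN ν K}
    {q₀ : tensorVN ν K} (hq : ∀ i, IsStarProjection (q i)) (hq₀ : IsStarProjection q₀)
    (hle : ∀ i, q₀ * q i = q i) (hlim : ∀ x, Tendsto (fun i => (q i).1 x) l (𝓝 (q₀.1 x)))
    (d : tensorVN ν K) : IsLUB (Set.range fun i => star d * q i * d) (star d * q₀ * d) := by
  have h1 : ∀ i, star d * q i * d ≤ star d * q₀ * d := fun i => star_conj_le hq₀ (hq i) (hle i) d
  have h2 : IsLUB (Set.range fun i => (star d * q i * d).1) (star d * q₀ * d).1 := by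
    refine isLUB_of_tendsto (l := l) h1 fun z => ?_
    have := ((star d.1).continuous.tendsto _).comp (hlim (d.1 z))
    exact this.inner tendsto_const_nhds
  refine ⟨?_, fun t ht => h2.2 ?_⟩
  · rintro _ ⟨i, rfl⟩
    exact h1 i
  · rintro _ ⟨i, rfl⟩
    exact ht ⟨i, rfl⟩

variable {H : Type u} {V : Type u} [NormedAddCommGroup H] [InnerProductSpace ℂ H] [CompleteSpace H]
  [AddCommGroup V] [Module ℂ V] [Module (H →L[ℂ] H)ᵐᵒᵖ V]
  {𝓗 : Type*} [NormedAddCommGroup 𝓗] [InnerProductSpace ℂ 𝓗] [CompleteSpace 𝓗]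

/-- The GNS representation of a normal completely positive map is normal on increasing nets of
projections. -/
lemma IsGNS.tendsto_apply {S : tensorVN ν K →ₗ[ℂ] (V → V → (H →L[ℂ] H))}
    {π : tensorVN ν K →⋆ₐ[ℂ] (𝓗 →L[ℂ] 𝓗)} {J : V →ₗ[ℂ] (H →L[ℂ] 𝓗)} (hG : IsGNS S π J)
    (hN : ∀ v, IsNormalMap fun d => S d v v) {ι : Type*} [Preorder ι] [IsDirectedOrder ι]
    [Nonempty ι] {q : ι → tensorVN ν K} {q₀ : tensorVN ν K} (hq : ∀ i, IsStarProjection (q i))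
    (hq₀ : IsStarProjection q₀) (hmono : ∀ i j, i ≤ j → q j * q i = q i)
    (hle : ∀ i, q₀ * q i = q i)
    (hlim : ∀ x, Tendsto (fun i => (q i).1 x) atTop
      (𝓝 (q₀.1 x))) (x : 𝓗) :
    Tendsto (fun i => π (q i) x) atTop (𝓝 (π q₀ x)) := by
  refine hG.tendsto_apply_of_tendsto hq hq₀ hle (fun d v h => ?_) x
  have hamono : Monotone fun i => star d * q i * d := fun i j hij =>
    star_conj_le (hq j) (hq i) (hmono i j hij) d
  have hself : ∀ a ∈ Set.range fun i => star d * q i * d, IsSelfAdjoint a := by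
    rintro _ ⟨i, rfl⟩
    exact (hq i).isSelfAdjoint.conjugate' d
  have hN' := hN v _ (Set.range_nonempty _) (directedOn_range.2 hamono.directed_le) hself _
    (isLUB_star_conj hq hq₀ hle hlim d)
  rw [← Set.range_comp] at hN'
  exact tendsto_inner_of_isLUB_range
    (fun i j hij => hG.apply_mono (hq j) (hq i) (hmono i j hij) d v) hN' h h

end VonNeumann

/-! ### Elementary operators in the von Neumann algebra -/

section BasisProj

variable {ι E : Type*} [NormedAddCommGroup E] [InnerProductSpace ℂ E] [CompleteSpace E]

/-- The orthogonal projection onto the span of finitely many vectors of a Hilbert basis. -/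
def basisProj (b : HilbertBasis ι ℂ E) (s : Finset ι) : E →L[ℂ] E :=
  ∑ i ∈ s, InnerProductSpace.rankOne ℂ (b i) (b i)

lemma rankOne_mul_rankOne (x y z w : E) :
    InnerProductSpace.rankOne ℂ x y * InnerProductSpace.rankOne ℂ z w =
      ⟪y, z⟫_ℂ • InnerProductSpace.rankOne ℂ x w := by
  ext v
  simp [mul_apply_eq_comp, InnerProductSpace.rankOne_apply, smul_smul, mul_comm]

lemma star_rankOne (x y : E) :
    star (InnerProductSpace.rankOne ℂ x y : E →L[ℂ] E) = InnerProductSpace.rankOne ℂ y x := by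
  rw [ContinuousLinearMap.star_eq_adjoint, InnerProductSpace.adjoint_rankOne]

lemma basisProj_mul (b : HilbertBasis ι ℂ E) {s t : Finset ι} (h : s ≤ t) :
    basisProj b t * basisProj b s = basisProj b s := by
  classical
  have hb : ∀ i j, ⟪b i, b j⟫_ℂ = if i = j then 1 else 0 := orthonormal_iff_ite.1 b.orthonormal
  simp only [basisProj, Finset.mul_sum, Finset.sum_mul, rankOne_mul_rankOne, hb, ite_smul,
    one_smul, zero_smul]
  refine Finset.sum_congr rfl fun i hi => ?_
  rw [Finset.sum_ite_eq' t i, if_pos (h hi)]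

lemma isStarProjection_basisProj (b : HilbertBasis ι ℂ E) (s : Finset ι) :
    IsStarProjection (basisProj b s) := by
  refine ⟨basisProj_mul b le_rfl, ?_⟩
  rw [IsSelfAdjoint, basisProj, star_sum]
  exact Finset.sum_congr rfl fun i _ => star_rankOne _ _

lemma tendsto_basisProj (b : HilbertBasis ι ℂ E) (x : E) :
    Tendsto (fun s => basisProj b s x) atTop (𝓝 x) := by
  have h := b.hasSum_repr x
  refine h.congr fun s => ?_
  simp [basisProj, HilbertBasis.repr_apply_apply]

end BasisProj

/-! ### The operators b ⊗ f and the matrix entries of L(K) ⊗ L^∞(ν) -/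

section Elem

variable {Ω : Type u} [MeasurableSpace Ω] {ν : Measure Ω} {K : Type u} [NormedAddCommGroup K]
  [InnerProductSpace ℂ K] [CompleteSpace K]

lemma mulFn_comm (f g : Lp ℂ ∞ ν) : mulFn f g = mulFn g f := by
  refine Lp.ext ?_
  filter_upwards [coeFn_mulFn f g, coeFn_mulFn g f] with ω h1 h2
  rw [h1, h2, mul_comm]

lemma val_mul (a b : tensorVN ν K) : (a * b).1 = a.1 * b.1 := rfl

lemma val_star (a : tensorVN ν K) : (star a).1 = star a.1 := rfl

lemma val_add (a b : tensorVN ν K) : (a + b).1 = a.1 + b.1 := rfl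

lemma val_smul (z : ℂ) (b : tensorVN ν K) : (z • b).1 = z • b.1 := rfl

lemma val_one : (1 : tensorVN ν K).1 = 1 := rfl

lemma val_elem (b : K →L[ℂ] K) (f : Lp ℂ ∞ ν) : (elem ν b f).1 = opTensor b (mulOp ν f) := rfl

lemma elem_mul (b b' : K →L[ℂ] K) (f f' : Lp ℂ ∞ ν) :
    elem ν b f * elem ν b' f' = elem ν (b * b') (mulFn f f') :=
  Subtype.ext <| by rw [val_mul, val_elem, val_elem, val_elem, opTensor_mul, mulOp_mulFn]

lemma star_elem (b : K →L[ℂ] K) (f : Lp ℂ ∞ ν) : star (elem ν b f) = elem ν (star b) (star f) :=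
  Subtype.ext <| by rw [val_star, val_elem, val_elem, star_opTensor, star_mulOp]

lemma elem_one : elem ν (1 : K →L[ℂ] K) (oneFn ν) = 1 :=
  Subtype.ext <| by rw [val_elem, val_one, mulOp_oneFn, opTensor_one]

lemma elem_smul_left (z : ℂ) (b : K →L[ℂ] K) (f : Lp ℂ ∞ ν) : elem ν (z • b) f = z • elem ν b f :=
  Subtype.ext <| by rw [val_elem, val_smul, val_elem, opTensor_smul_left]

lemma elem_add_left (b b' : K →L[ℂ] K) (f : Lp ℂ ∞ ν) :
    elem ν (b + b') f = elem ν b f + elem ν b' f :=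
  Subtype.ext <| by rw [val_elem, val_add, val_elem, val_elem, opTensor_add_left]

lemma elem_smul_right (z : ℂ) (b : K →L[ℂ] K) (f : Lp ℂ ∞ ν) : elem ν b (z • f) = z • elem ν b f :=
  Subtype.ext <| by rw [val_elem, val_smul, val_elem, mulOp_smul, opTensor_smul_right]

lemma elem_add_right (b : K →L[ℂ] K) (f f' : Lp ℂ ∞ ν) :
    elem ν b (f + f') = elem ν b f + elem ν b f' :=
  Subtype.ext <| by rw [val_elem, val_add, val_elem, val_elem, mulOp_add, opTensor_add_right]

lemma isStarProjection_elem_one {p : K →L[ℂ] K} (hp : IsStarProjection p) :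
    IsStarProjection (elem ν p (oneFn ν)) := by
  refine ⟨?_, ?_⟩
  · rw [IsIdempotentElem, elem_mul, hp.isIdempotentElem, mulFn_oneFn]
  · rw [IsSelfAdjoint, star_elem, hp.isSelfAdjoint.star_eq, star_oneFn]

lemma isStarProjection_elem_charFn {X : Set Ω} (hX : MeasurableSet X) :
    IsStarProjection (elem ν (1 : K →L[ℂ] K) (charFn ν hX)) := by
  refine ⟨?_, ?_⟩
  · rw [IsIdempotentElem, elem_mul, one_mul, mulFn_charFn]
    congr 2
    exact Set.inter_self X
  · rw [IsSelfAdjoint, star_elem, star_one, star_charFn]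

lemma inner_opTensor_left {F : Type*} [NormedAddCommGroup F] [InnerProductSpace ℂ F]
    [CompleteSpace F] (b : K →L[ℂ] K) (c : F →L[ℂ] F) (z z' : HilbertTensor K F) :
    ⟪opTensor b c z, z'⟫_ℂ = ⟪z, opTensor (star b) (star c) z'⟫_ℂ := by
  rw [← star_opTensor, ContinuousLinearMap.star_eq_adjoint, ContinuousLinearMap.adjoint_inner_right]

lemma opTensor_one_mem_centralizer (g : Lp ℂ ∞ ν) :
    opTensor (1 : K →L[ℂ] K) (mulOp ν g) ∈ StarSubalgebra.centralizer ℂ (elementaryOps ν K) := by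
  rw [StarSubalgebra.mem_centralizer_iff]
  rintro _ ⟨b, f, rfl⟩
  rw [star_opTensor, star_mulOp]
  simp only [opTensor_mul, one_mul, mul_one, ← mulOp_mulFn]
  exact ⟨by rw [mulFn_comm], by rw [mulFn_comm]⟩

lemma opTensor_one_apply_tmulL {F : Type*} [NormedAddCommGroup F] [InnerProductSpace ℂ F]
    [CompleteSpace F] (a : K) (z : HilbertTensor K F) :
    opTensor (InnerProductSpace.rankOne ℂ a a) 1 z =
      tmulL a (((tmulL a : F →L[ℂ] HilbertTensor K F)†) z) := by
  have : (opTensor (InnerProductSpace.rankOne ℂ a a) 1 : HilbertTensor K F →L[ℂ] _) =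
      tmulL a ∘L (tmulL a)† := HilbertTensor.clm_ext fun x y => by
    rw [opTensor_tmulL, ContinuousLinearMap.comp_apply, adjoint_tmulL_tmulL, map_smul,
      InnerProductSpace.rankOne_apply, tmulL_smul_left, one_apply_eq_self]
  rw [this]; rfl

/-- The corner of D between a and b acts on L²(ν) and commutes with L^∞(ν), so it is decomposable.
On one-dimensional fibres this means multiplication by the function t(ω)1, which is bounded by ‖T‖.
-/
lemma exists_entry_of_commute [SigmaFinite ν]
    (D : HilbertTensor K (Lp ℂ 2 ν) →L[ℂ] HilbertTensor K (Lp ℂ 2 ν))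
    (hD : ∀ f z, D (opTensor 1 (mulOp ν f) z) = opTensor 1 (mulOp ν f) (D z)) (a b : K) :
    ∃ f : Lp ℂ ∞ ν, opTensor (InnerProductSpace.rankOne ℂ a a) 1 * D *
      opTensor (InnerProductSpace.rankOne ℂ b b) 1 =
        opTensor (InnerProductSpace.rankOne ℂ a b) (mulOp ν f) := by
  set T : Lp ℂ 2 ν →L[ℂ] Lp ℂ 2 ν := (tmulL a)† ∘L D ∘L tmulL b with hT
  have hTi : ∀ φ ψ, ⟪φ, T ψ⟫_ℂ = ⟪tmulL a φ, D (tmulL b ψ)⟫_ℂ := fun φ ψ => by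
    rw [hT, ContinuousLinearMap.comp_apply, ContinuousLinearMap.adjoint_inner_right]; rfl
  have hmul : ∀ (c : K) (f : Lp ℂ ∞ ν) (ψ : Lp ℂ 2 ν),
      tmulL c (mulOp ν f ψ) = opTensor (1 : K →L[ℂ] K) (mulOp ν f) (tmulL c ψ) := fun c f ψ => by
    rw [opTensor_tmulL, one_apply_eq_self]
  have hcomm : ∀ f ψ, T (mulOp ν f ψ) = mulOp ν f (T ψ) := by
    intro f ψ
    refine ext_inner_left ℂ fun φ => ?_
    have h1 := inner_mulOp_left (star f) φ (T ψ)
    have h2 := inner_opTensor_left (1 : K →L[ℂ] K) (mulOp ν (star f)) (tmulL a φ) (D (tmulL b ψ))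
    rw [star_star] at h1
    rw [star_mulOp, star_star, star_one] at h2
    rw [← h1, hTi, hTi, hmul, hmul, hD, h2]
  obtain ⟨t, ht, htm, htT⟩ := exists_field_of_commute T hcomm
  have hmem : MemLp (fun ω => t ω 1) ∞ ν :=
    memLp_top_of_bound (htm 1) ‖T‖ (Eventually.of_forall fun ω => by
      simpa using (t ω).le_of_opNorm_le (ht ω) 1)
  have hTf : T = mulOp ν hmem.toLp := by
    refine ContinuousLinearMap.ext fun ψ => Lp.ext ?_
    filter_upwards [htT ψ, coeFn_mulOp ν hmem.toLp ψ, hmem.coeFn_toLp] with ω h1 h2 h3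
    rw [h1, h2, h3, smul_eq_mul, mul_comm, ← smul_eq_mul, ← map_smul, smul_eq_mul, mul_one]
  refine ⟨hmem.toLp, HilbertTensor.clm_ext fun x y => ?_⟩
  rw [mul_apply_eq_comp, mul_apply_eq_comp, opTensor_tmulL, opTensor_tmulL,
    InnerProductSpace.rankOne_apply, InnerProductSpace.rankOne_apply, tmulL_smul_left,
    tmulL_smul_left, map_smul, map_smul, opTensor_one_apply_tmulL, ← hTf]
  rfl

/-- The matrix entries of an element of `L(K) ⊗ L^∞(ν)` are functions. -/
lemma exists_entry [SigmaFinite ν] (d : tensorVN ν K) (a b : K) : ∃ f : Lp ℂ ∞ ν,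
    elem ν (InnerProductSpace.rankOne ℂ a a) (oneFn ν) * d *
      elem ν (InnerProductSpace.rankOne ℂ b b) (oneFn ν) =
        elem ν (InnerProductSpace.rankOne ℂ a b) f := by
  obtain ⟨f, hf⟩ := exists_entry_of_commute d.1 (fun f z => congrArg (fun A => A z)
    (mem_tensorVN_iff.1 d.2 _ (opTensor_one_mem_centralizer (K := K) f)).eq) a b
  refine ⟨f, Subtype.ext ?_⟩
  rw [val_mul, val_mul, val_elem, val_elem, val_elem, mulOp_oneFn, hf]

lemma elem_basisProj {ι : Type*} (b : HilbertBasis ι ℂ K) (s : Finset ι) (f : Lp ℂ ∞ ν) :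
    elem ν (basisProj b s) f =
      ∑ i ∈ s, elem ν (InnerProductSpace.rankOne ℂ (b i) (b i)) f := by
  classical
  rw [basisProj]
  induction s using Finset.induction_on with
  | empty => simpa using elem_smul_left (ν := ν) 0 (0 : K →L[ℂ] K) f
  | insert i s hi ih => rw [Finset.sum_insert hi, Finset.sum_insert hi, elem_add_left, ih]

lemma _root_.Submodule.sum_mul_mul_sum_mem {ι R : Type*} [Ring R] [Module ℂ R] (M : Submodule ℂ R)
    (s : Finset ι) (p : ι → R) (d : R) (h : ∀ i j, p i * d * p j ∈ M) :
    (∑ i ∈ s, p i) * d * (∑ i ∈ s, p i) ∈ M := by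
  rw [Finset.sum_mul, Finset.sum_mul]
  refine Submodule.sum_mem _ fun i _ => ?_
  rw [Finset.mul_sum]
  exact Submodule.sum_mem _ fun j _ => h i j

/-- A finite-rank corner is a finite matrix whose entries are functions. Together with normality
this passes from the operators b ⊗ f to the whole algebra. -/
lemma compress_mem_span [SigmaFinite ν] {ι : Type*} (b : HilbertBasis ι ℂ K) (s : Finset ι)
    (d : tensorVN ν K) :
    elem ν (basisProj b s) (oneFn ν) * d * elem ν (basisProj b s) (oneFn ν) ∈
      Submodule.span ℂ {d : tensorVN ν K | ∃ b f, d = elem ν b f} := by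
  rw [elem_basisProj]
  refine Submodule.sum_mul_mul_sum_mem _ s _ d fun i j => ?_
  obtain ⟨f, hf⟩ := exists_entry d (b i) (b j)
  exact Submodule.subset_span ⟨_, f, hf⟩

end Elem

/-! ### From the GNS representation to a dilation in `K ⊗ F` -/

section Density

variable {Ω : Type*} [MeasurableSpace Ω] {ν : Measure Ω} [SigmaFinite ν]
  {F : Type*} [NormedAddCommGroup F] [InnerProductSpace ℂ F] [CompleteSpace F]

/-- A countably additive representation of `L^∞(ν)` has densities. -/
theorem exists_density (ϖ : Lp ℂ ∞ ν →ₗ[ℂ] (F →L[ℂ] F)) (hmul : ∀ f g, ϖ (mulFn f g) = ϖ f * ϖ g)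
    (hstar : ∀ f, ϖ (star f) = star (ϖ f)) (hnorm : ∀ f, ‖ϖ f‖ ≤ ‖f‖)
    (hsum : ∀ (X : ℕ → Set Ω) (hX : ∀ i, MeasurableSet (X i)), Pairwise (Function.onFun Disjoint X) →
      ∀ x, HasSum (fun i => ϖ (charFn ν (hX i)) x) (ϖ (charFn ν (MeasurableSet.iUnion hX)) x))
    (η : F) : ∃ ρ : Ω → ℝ, Measurable ρ ∧ (∀ ω, 0 ≤ ρ ω) ∧ Integrable ρ ν ∧
      ∀ f, ⟪η, ϖ f η⟫_ℂ = ∫ ω, f ω * ρ ω ∂ν := by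
  have hsq : ∀ {X : Set Ω} (hX : MeasurableSet X),
      ⟪η, ϖ (charFn ν hX) η⟫_ℂ = ((‖ϖ (charFn ν hX) η‖ ^ 2 : ℝ) : ℂ) := by
    intro X hX
    have h1 : ϖ (charFn ν hX) = star (ϖ (charFn ν hX)) * ϖ (charFn ν hX) := by
      rw [← hstar, ← hmul, star_charFn, mulFn_charFn]
      congr 2
      exact (Set.inter_self X).symm
    rw [← inner_self_eq_ofReal]
    conv_lhs => rw [h1]
    rw [mul_apply_eq_comp, ContinuousLinearMap.star_eq_adjoint,
      ContinuousLinearMap.adjoint_inner_right]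
  -- The measure is X ↦ ⟪η, ϖ(χ_X)η⟫. As χ_X is a self-adjoint idempotent this is a squared norm,
  -- hence visibly nonnegative.
  let μ : Measure Ω := Measure.ofMeasurable
    (fun X hX => ENNReal.ofReal (‖ϖ (charFn ν hX) η‖ ^ 2))
    (by
      have : charFn ν MeasurableSet.empty = 0 := by simp [charFn]; rfl
      rw [this]; simp)
    (by
      intro X hX hd
      have h1 : HasSum (fun i => ‖ϖ (charFn ν (hX i)) η‖ ^ 2)
          (‖ϖ (charFn ν (MeasurableSet.iUnion hX)) η‖ ^ 2) := by
        have h2 := (innerSL ℂ η).hasSum (hsum X hX hd η)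
        simp only [innerSL_apply_apply, hsq] at h2
        exact_mod_cast h2
      rw [← h1.tsum_eq, ENNReal.ofReal_tsum_of_nonneg (fun i => sq_nonneg _) h1.summable])
  have hμ : ∀ {X : Set Ω} (hX : MeasurableSet X), μ X = ENNReal.ofReal (‖ϖ (charFn ν hX) η‖ ^ 2) :=
    fun hX => Measure.ofMeasurable_apply _ hX
  have hfin : IsFiniteMeasure μ := ⟨by rw [hμ MeasurableSet.univ]; exact ENNReal.ofReal_lt_top⟩
  have hac : μ ≪ ν := by
    refine Measure.AbsolutelyContinuous.mk fun X hX h0 => ?_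
    have : charFn ν hX = 0 := by
      refine Lp.ext ?_
      have h1 : ∀ᵐ ω ∂ν, ω ∉ X := measure_eq_zero_iff_ae_notMem.1 h0
      filter_upwards [h1, coeFn_charFn (ν := ν) hX, Lp.coeFn_zero ℂ ∞ ν] with ω h1 h2 h3
      rw [h2, h3, Set.indicator_of_notMem h1]; rfl
    rw [hμ hX, this]; simp
  have hint : Integrable (fun ω => (μ.rnDeriv ν ω).toReal) ν := Measure.integrable_toReal_rnDeriv
  refine ⟨fun ω => (μ.rnDeriv ν ω).toReal, (Measure.measurable_rnDeriv μ ν).ennreal_toReal,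
    fun ω => ENNReal.toReal_nonneg, hint, ?_⟩
  -- The integral against the density is written as a continuous functional of f, so the identity
  -- need only be checked on characteristic functions.
  set r : Lp ℂ 1 ν := (hint.ofReal (𝕜 := ℂ)).toL1 _ with hr
  set B : Lp ℂ ∞ ν →L[ℂ] Lp ℂ 1 ν →L[ℂ] Lp ℂ 1 ν :=
    (ContinuousLinearMap.lsmul ℂ ℂ).holderL ν ∞ 1 1 with hB
  have hrhs : ∀ f : Lp ℂ ∞ ν, L1.integralCLM' ℂ (B f r) =
      ∫ ω, f ω * ((μ.rnDeriv ν ω).toReal : ℂ) ∂ν := by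
    intro f
    rw [← L1.integral_eq', L1.integral_eq_integral]
    refine integral_congr_ae ?_
    filter_upwards [(ContinuousLinearMap.lsmul ℂ ℂ).coeFn_holder (r := 1) f r,
      Integrable.coeFn_toL1 (hint.ofReal (𝕜 := ℂ))] with ω h1 h2
    refine h1.trans ?_
    rw [hr, h2]
    rfl
  have hcont1 : Continuous fun f : Lp ℂ ∞ ν => ⟪η, ϖ f η⟫_ℂ := by
    have : Continuous ϖ := AddMonoidHomClass.continuous_of_bound ϖ 1 fun f => by
      rw [one_mul]; exact hnorm f
    fun_prop
  have hcont2 : Continuous fun f : Lp ℂ ∞ ν => L1.integralCLM' ℂ (B f r) := by fun_prop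
  intro f
  rw [← hrhs]
  refine congrFun (hcont1.ext_on dense_span_charFn hcont2 ?_) f
  intro f hf
  induction hf using Submodule.span_induction with
  | mem f hf =>
    obtain ⟨X, hX, rfl⟩ := hf
    simp only [hrhs]
    rw [hsq]
    have h1 : ∫ ω, charFn ν hX ω * ((μ.rnDeriv ν ω).toReal : ℂ) ∂ν =
        ∫ ω in X, ((μ.rnDeriv ν ω).toReal : ℂ) ∂ν := by
      rw [← integral_indicator hX]
      refine integral_congr_ae ?_
      filter_upwards [coeFn_charFn (ν := ν) hX] with ω h
      rw [h]
      by_cases hω : ω ∈ X <;> simp [hω]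
    rw [h1, integral_complex_ofReal, Measure.setIntegral_toReal_rnDeriv hac, measureReal_def, hμ hX,
      ENNReal.toReal_ofReal (sq_nonneg _)]
  | zero => simp
  | add f g _ _ hf hg =>
    simp only [map_add, add_apply, inner_add_right] at hf hg ⊢
    rw [hf, hg]
  | smul c f _ hf =>
    simp only [map_smul, smul_apply, inner_smul_right] at hf ⊢
    rw [hf, smul_eq_mul]

end Density

/-! ### Reduction to elementary operators by finite-rank compression -/

section Dilation

variable {Ω : Type u} [MeasurableSpace Ω] {ν : Measure Ω} {K : Type u} [NormedAddCommGroup K]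
  [InnerProductSpace ℂ K] [CompleteSpace K]
  {H : Type u} {V : Type u} [NormedAddCommGroup H] [InnerProductSpace ℂ H] [CompleteSpace H]
  [AddCommGroup V] [Module ℂ V] [Module (H →L[ℂ] H)ᵐᵒᵖ V]
  {𝓗 : Type*} [NormedAddCommGroup 𝓗] [InnerProductSpace ℂ 𝓗] [CompleteSpace 𝓗]

lemma norm_apply_sq_add {A : Type*} [Ring A] [StarRing A] [Algebra ℂ A]
    (π : A →⋆ₐ[ℂ] (𝓗 →L[ℂ] 𝓗)) {d c : A} {C : ℝ}
    (h : star d * d + star c * c = ((C : ℂ) ^ 2) • (1 : A)) (x : 𝓗) :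
    ‖π d x‖ ^ 2 + ‖π c x‖ ^ 2 = C ^ 2 * ‖x‖ ^ 2 := by
  have h1 := congrArg (fun T : 𝓗 →L[ℂ] 𝓗 => ⟪T x, x⟫_ℂ) (congrArg π h)
  simp only [map_add, map_mul, map_star, map_smul, map_one, add_apply, smul_apply,
    one_apply_eq_self, inner_add_left, mul_apply_eq_comp, ContinuousLinearMap.star_eq_adjoint,
    ContinuousLinearMap.adjoint_inner_left, inner_smul_left, inner_self_eq_ofReal, map_pow,
    Complex.conj_ofReal] at h1
  exact_mod_cast h1

/-- The images π(q_i) are contractions, so strong convergence on the right of d combines with strong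
convergence on the left. -/
lemma tendsto_map_mul_mul {A ι : Type*} [Ring A] [StarRing A] [Algebra ℂ A]
    (π : A →⋆ₐ[ℂ] (𝓗 →L[ℂ] 𝓗)) {l : Filter ι} {q : ι → A} (hq : ∀ i, IsStarProjection (q i))
    (h : ∀ x, Tendsto (fun i => π (q i) x) l (𝓝 x)) (d : A) (x : 𝓗) :
    Tendsto (fun i => π (q i * d * q i) x) l (𝓝 (π d x)) := by
  have h1 : Tendsto (fun i => π (q i) (π d (π (q i) x) - π d x)) l (𝓝 0) := by
    have h2 : Tendsto (fun i => π d (π (q i) x) - π d x) l (𝓝 0) := by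
      have := (((π d).continuous.tendsto x).comp (h x)).sub_const (π d x)
      rwa [sub_self] at this
    refine squeeze_zero_norm (fun i => ?_) (tendsto_zero_iff_norm_tendsto_zero.1 h2)
    simpa using (π (q i)).le_of_opNorm_le ((hq i).map π).norm_le (π d (π (q i) x) - π d x)
  have h2 := h1.add (h (π d x))
  rw [zero_add] at h2
  refine h2.congr fun i => ?_
  rw [map_mul, map_mul, mul_apply_eq_comp, mul_apply_eq_comp, map_sub]
  exact sub_add_cancel _ _

lemma map_apply_mem_of_mem_span {A : Type*} [Ring A] [StarRing A] [Algebra ℂ A]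
    (π : A →⋆ₐ[ℂ] (𝓗 →L[ℂ] 𝓗)) {s : Set A} {N : Submodule ℂ 𝓗} {x : 𝓗} (h : ∀ d ∈ s, π d x ∈ N)
    {d : A} (hd : d ∈ Submodule.span ℂ s) : π d x ∈ N := by
  induction hd using Submodule.span_induction with
  | mem d hd => exact h d hd
  | zero => rw [map_zero]; exact N.zero_mem
  | add d d' _ _ h h' => rw [map_add]; exact N.add_mem h h'
  | smul c d _ h => rw [map_smul]; exact N.smul_mem c h

lemma Submodule.mem_topologicalClosure_of_tendsto {ι : Type*} {l : Filter ι} [l.NeBot] {N : Submodule ℂ 𝓗}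
    {z : ι → 𝓗} {x : 𝓗} (h : Tendsto z l (𝓝 x)) (hz : ∀ i, z i ∈ N) : x ∈ N.topologicalClosure :=
  mem_closure_of_tendsto h (Eventually.of_forall hz)

lemma IsGNS.dense_of_mem_closure {A : Type u} [Ring A] [StarRing A] [Algebra ℂ A] [StarModule ℂ A]
    {S : A →ₗ[ℂ] (V → V → (H →L[ℂ] H))} {π : A →⋆ₐ[ℂ] (𝓗 →L[ℂ] 𝓗)} {J : V →ₗ[ℂ] (H →L[ℂ] 𝓗)}
    (hG : IsGNS S π J) {N : Submodule ℂ 𝓗} (h : ∀ d v x, π d (J v x) ∈ N.topologicalClosure) :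
    Dense (N : Set 𝓗) := by
  have hle : Submodule.span ℂ (Set.range fun p : (A × V) × H => π p.1.1 (J p.1.2 p.2)) ≤
      N.topologicalClosure := by
    refine Submodule.span_le.2 ?_
    rintro _ ⟨⟨⟨d, v⟩, x⟩, rfl⟩
    exact h d v x
  have := (hG.dense.mono (SetLike.coe_subset_coe.2 hle)).closure_eq
  rw [Submodule.topologicalClosure_coe, closure_closure] at this
  exact dense_iff_closure_eq.2 this

lemma IsGNS.tendsto_inner_of_tendsto {A : Type u} [Ring A] [StarRing A] [Algebra ℂ A]
    [StarModule ℂ A] {S : A →ₗ[ℂ] (V → V → (H →L[ℂ] H))} {π : A →⋆ₐ[ℂ] (𝓗 →L[ℂ] 𝓗)}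
    {J : V →ₗ[ℂ] (H →L[ℂ] 𝓗)} (hG : IsGNS S π J) (v v' : V) (x y : H) {ι : Type*} {l : Filter ι}
    {q : ι → A} {d : A} (h : Tendsto (fun i => π (q i) (J v' x)) l (𝓝 (π d (J v' x)))) :
    Tendsto (fun i => ⟪S (q i) v v' x, y⟫_ℂ) l (𝓝 ⟪S d v v' x, y⟫_ℂ) := by
  simp only [hG.dilates, ContinuousLinearMap.comp_apply, ContinuousLinearMap.adjoint_inner_left]
  exact h.inner tendsto_const_nhds

/-- The identity d*d + c*c = ‖d‖² is preserved by π, and the term with c only helps. -/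
lemma norm_rep_le (π : tensorVN ν K →⋆ₐ[ℂ] (𝓗 →L[ℂ] 𝓗)) (d : tensorVN ν K) : ‖π d‖ ≤ ‖d.1‖ := by
  obtain ⟨c, hc⟩ := exists_star_mul_self_add_eq d
  refine ContinuousLinearMap.opNorm_le_bound _ (norm_nonneg _) fun x => ?_
  have h := norm_apply_sq_add π hc x
  refine (abs_le_of_sq_le_sq' ?_ (by positivity)).2
  rw [mul_pow, ← h]
  exact le_add_of_nonneg_right (sq_nonneg _)

variable {S : tensorVN ν K →ₗ[ℂ] (V → V → (H →L[ℂ] H))} {π : tensorVN ν K →⋆ₐ[ℂ] (𝓗 →L[ℂ] 𝓗)}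
  {J : V →ₗ[ℂ] (H →L[ℂ] 𝓗)}

/-- Normality of S enters here: finite-rank projections of K increase to 1, so π is already
nondegenerate on the operators b ⊗ 1 with b of finite rank. -/
lemma IsGNS.tendsto_basisProj (hG : IsGNS S π J) (hN : ∀ v, IsNormalMap fun d => S d v v)
    {ι : Type*} (b : HilbertBasis ι ℂ K) (x : 𝓗) :
    Tendsto (fun s => π (elem ν (basisProj b s) (oneFn ν)) x) atTop (𝓝 x) := by
  classical
  have h := hG.tendsto_apply hN (q := fun s : Finset ι => elem ν (basisProj b s) (oneFn ν)) (q₀ := 1)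
    (fun s => isStarProjection_elem_one (isStarProjection_basisProj b s)) (.one _)
    (fun s t hst => by rw [elem_mul, basisProj_mul b hst, mulFn_oneFn]) (fun s => one_mul _) ?_ x
  · rwa [map_one] at h
  · simp only [val_elem, val_one, mulOp_oneFn]
    refine tendsto_apply_of_dense (C := 1) ?_ dense_span_range_tmulL ?_
    · refine Eventually.of_forall fun s => (norm_opTensor_le _ _).trans ?_
      exact mul_le_one₀ (isStarProjection_basisProj b s).norm_le (norm_nonneg _)
        ContinuousLinearMap.norm_id_le
    · rintro _ ⟨⟨x, y⟩, rfl⟩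
      simp only [opTensor_tmulL, one_apply_eq_self]
      have hc : Continuous fun x : K => (tmulL x y : HilbertTensor K (Lp ℂ 2 ν)) :=
        (HilbertTensor.ofAlg K (Lp ℂ 2 ν)).continuous.comp
          (TensorProduct.continuous_tmul.comp (continuous_id.prodMk continuous_const))
      exact (hc.tendsto x).comp (CovariantCP.tendsto_basisProj b x)

lemma IsGNS.tendsto_compress (hG : IsGNS S π J) (hN : ∀ v, IsNormalMap fun d => S d v v)
    {ι : Type*} (b : HilbertBasis ι ℂ K) (d : tensorVN ν K) (x : 𝓗) :
    Tendsto (fun s => π (elem ν (basisProj b s) (oneFn ν) * d *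
      elem ν (basisProj b s) (oneFn ν)) x) atTop (𝓝 (π d x)) := by
  exact tendsto_map_mul_mul π
    (fun s => isStarProjection_elem_one (isStarProjection_basisProj b s))
    (hG.tendsto_basisProj hN b) d x

lemma exists_star_mul_self_add_eq' (d : tensorVN ν K) : ∃ (C : ℝ) (c : tensorVN ν K),
    0 ≤ C ∧ star d * d + star c * c = ((C : ℂ) ^ 2) • (1 : tensorVN ν K) :=
  let ⟨c, hc⟩ := exists_star_mul_self_add_eq d
  ⟨_, c, norm_nonneg _, hc⟩

lemma tendsto_inner_compress {S : tensorVN ν K →ₗ[ℂ] (V → V → (H →L[ℂ] H))} (hS : IsCPForm S)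
    (hN : ∀ v, IsNormalMap fun d => S d v v) {ι : Type*} (b : HilbertBasis ι ℂ K) (d : tensorVN ν K)
    (v v' : V) (x y : H) : Tendsto (fun s =>
      ⟪S (elem ν (basisProj b s) (oneFn ν) * d * elem ν (basisProj b s) (oneFn ν)) v v' x, y⟫_ℂ)
      atTop (𝓝 ⟪S d v v' x, y⟫_ℂ) := by
  obtain ⟨𝓗, _, _, _, π, J, hG⟩ := hS.exists_gns exists_star_mul_self_add_eq'
  exact hG.tendsto_inner_of_tendsto v v' x y (hG.tendsto_compress hN b d (J v' x))

/-- Normal completely positive maps which agree on the operators `b ⊗ f` are equal. -/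
theorem eq_of_elem_eq [SigmaFinite ν] {S S' : tensorVN ν K →ₗ[ℂ] (V → V → (H →L[ℂ] H))}
    (hS : IsCPForm S) (hS' : IsCPForm S') (hN : ∀ v, IsNormalMap fun d => S d v v)
    (hN' : ∀ v, IsNormalMap fun d => S' d v v) (h : ∀ b f, S (elem ν b f) = S' (elem ν b f)) :
    S = S' := by
  obtain ⟨w, b, -⟩ := exists_hilbertBasis ℂ K
  have hspan : ∀ d ∈ Submodule.span ℂ {d : tensorVN ν K | ∃ b f, d = elem ν b f}, S d = S' d := by
    intro d hd
    refine LinearMap.eqOn_span ?_ hd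
    rintro _ ⟨b, f, rfl⟩
    exact h b f
  refine LinearMap.ext fun d => funext fun v => funext fun v' => ContinuousLinearMap.ext fun x =>
    ext_inner_right ℂ fun y => ?_
  -- Both values are limits along the same finite-rank compressions, which are combinations of
  -- operators b ⊗ f.
  refine tendsto_nhds_unique (tendsto_inner_compress hS hN b d v v' x y) ?_
  simp only [hspan _ (compress_mem_span b _ d)]
  exact tendsto_inner_compress hS' hN' b d v v' x y

/-- Each π(d)(Jv)h is the limit of the vectors obtained by compressing d, and those are combinations
of π(b ⊗ f)(Jv)h. -/
lemma IsGNS.dense_elem [SigmaFinite ν] (hG : IsGNS S π J) (hN : ∀ v, IsNormalMap fun d => S d v v) :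
    Dense (Submodule.span ℂ (Set.range fun p : (((K →L[ℂ] K) × Lp ℂ ∞ ν) × V) × H =>
      π (elem ν p.1.1.1 p.1.1.2) (J p.1.2 p.2)) : Set 𝓗) := by
  obtain ⟨w, b, -⟩ := exists_hilbertBasis ℂ K
  set N := Submodule.span ℂ (Set.range fun p : (((K →L[ℂ] K) × Lp ℂ ∞ ν) × V) × H =>
      π (elem ν p.1.1.1 p.1.1.2) (J p.1.2 p.2)) with hNdef
  have hspan : ∀ d ∈ Submodule.span ℂ {d : tensorVN ν K | ∃ b f, d = elem ν b f}, ∀ v x,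
      π d (J v x) ∈ N := by
    intro d hd v x
    refine map_apply_mem_of_mem_span π ?_ hd
    rintro _ ⟨b, f, rfl⟩
    exact Submodule.subset_span ⟨(((b, f), v), x), rfl⟩
  refine hG.dense_of_mem_closure fun d v x => ?_
  have hlim := hG.tendsto_compress hN b d (J v x)
  exact Submodule.mem_topologicalClosure_of_tendsto hlim fun s => hspan _ (compress_mem_span b s d) v x

end Dilation

/-! ### Normal representations of `L(K) ⊗ L^∞(ν)` are multiples of `L(K)` -/

section TensorRep

variable {Ω : Type u} [MeasurableSpace Ω] {ν : Measure Ω} {K : Type u} [NormedAddCommGroup K]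
  [InnerProductSpace ℂ K] [CompleteSpace K]
  {𝓗 : Type*} [NormedAddCommGroup 𝓗] [InnerProductSpace ℂ 𝓗] [CompleteSpace 𝓗]

/-- The restriction `R b f` to the operators `b ⊗ f` of a normal representation of the von Neumann
algebra `L(K) ⊗ L^∞(ν)`. -/
structure IsTensorRep (R : (K →L[ℂ] K) → Lp ℂ ∞ ν → (𝓗 →L[ℂ] 𝓗)) : Prop where
  mul : ∀ b b' f f', R (b * b') (mulFn f f') = R b f * R b' f'
  star : ∀ b f, R (star b) (star f) = star (R b f)
  one : R 1 (oneFn ν) = 1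
  smul_left : ∀ (z : ℂ) b f, R (z • b) f = z • R b f
  add_right : ∀ b f f', R b (f + f') = R b f + R b f'
  smul_right : ∀ (z : ℂ) b f, R b (z • f) = z • R b f
  norm_le : ∀ b f, ‖R b f‖ ≤ ‖b‖ * ‖f‖
  total : Dense (Submodule.span ℂ {ψ : 𝓗 | ∃ x y φ,
    ψ = R (InnerProductSpace.rankOne ℂ x y) (oneFn ν) φ} : Set 𝓗)
  hasSum : ∀ (X : ℕ → Set Ω) (hX : ∀ i, MeasurableSet (X i)),
    Pairwise (Function.onFun Disjoint X) → ∀ φ,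
      HasSum (fun i => R 1 (charFn ν (hX i)) φ) (R 1 (charFn ν (MeasurableSet.iUnion hX)) φ)

lemma charFn_biUnion (X : ℕ → Set Ω) (hX : ∀ i, MeasurableSet (X i))
    (hd : Pairwise (Function.onFun Disjoint X)) (s : Finset ℕ) :
    charFn ν (Finset.measurableSet_biUnion s fun i _ => hX i) = ∑ i ∈ s, charFn ν (hX i) := by
  classical
  induction s using Finset.induction_on with
  | empty => simp [charFn]; rfl
  | insert k s hk ih =>
    rw [Finset.sum_insert hk, ← ih]
    refine Lp.ext ?_
    filter_upwards [coeFn_charFn (ν := ν) (Finset.measurableSet_biUnion (insert k s) fun i _ => hX i),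
      coeFn_charFn (ν := ν) (hX k),
      coeFn_charFn (ν := ν) (Finset.measurableSet_biUnion s fun i _ => hX i),
      Lp.coeFn_add (charFn ν (hX k)) (charFn ν (Finset.measurableSet_biUnion s fun i _ => hX i))]
      with ω h1 h2 h3 h4
    have hdis : Disjoint (X k) (⋃ i ∈ s, X i) := by
      simp only [Set.disjoint_iUnion_right]
      exact fun i hi => hd (fun h => hk (h ▸ hi))
    rw [h1, h4, Pi.add_apply, h2, h3, Finset.set_biUnion_insert,
      Set.indicator_union_of_disjoint hdis]

lemma norm_sub_sq_of_isStarProjection {E : Type*} [NormedAddCommGroup E] [InnerProductSpace ℂ E]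
    [CompleteSpace E] {p r : E →L[ℂ] E} (hp : IsStarProjection p) (hr : IsStarProjection r)
    (h : p * r = r) (x : E) : ‖r x - p x‖ ^ 2 = ‖p x‖ ^ 2 - ‖r x‖ ^ 2 := by
  have hsq : ∀ q : E →L[ℂ] E, star q * q = q → ⟪q x, x⟫_ℂ = ((‖q x‖ ^ 2 : ℝ) : ℂ) := by
    intro q hq
    conv_lhs => rw [← hq]
    rw [mul_apply_eq_comp, ContinuousLinearMap.star_eq_adjoint,
      ContinuousLinearMap.adjoint_inner_left, inner_self_eq_ofReal]
  have h1 := hsq (p - r) (hp.star_sub_mul_sub hr h)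
  rw [sub_apply, inner_sub_left,
    hsq p (by rw [hp.isSelfAdjoint.star_eq]; exact hp.isIdempotentElem),
    hsq r (by rw [hr.isSelfAdjoint.star_eq]; exact hr.isIdempotentElem)] at h1
  rw [norm_sub_rev]
  exact_mod_cast h1.symm

lemma isStarProjection_mulOp_charFn {E : Type*} [NormedAddCommGroup E] [InnerProductSpace ℂ E]
    [CompleteSpace E] {X : Set Ω} (hX : MeasurableSet X) :
    IsStarProjection (mulOp ν (charFn ν hX) : Lp E 2 ν →L[ℂ] Lp E 2 ν) := by
  refine ⟨?_, ?_⟩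
  · rw [IsIdempotentElem, ← mulOp_mulFn, mulFn_charFn]
    congr 2
    exact Set.inter_self X
  · rw [IsSelfAdjoint, star_mulOp, star_charFn]

/-- The squared distance is the remainder of the series of integrals of ‖ψ‖² over the disjoint sets.
-/
lemma tendsto_mulOp_charFn {E : Type*} [NormedAddCommGroup E] [InnerProductSpace ℂ E]
    [CompleteSpace E] (X : ℕ → Set Ω) (hX : ∀ i, MeasurableSet (X i))
    (hd : Pairwise (Function.onFun Disjoint X)) (ψ : Lp E 2 ν) :
    Tendsto (fun s : Finset ℕ =>
      mulOp ν (charFn ν (Finset.measurableSet_biUnion s fun i _ => hX i)) ψ) atTop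
      (𝓝 (mulOp ν (charFn ν (MeasurableSet.iUnion hX)) ψ)) := by
  rw [tendsto_iff_norm_sub_tendsto_zero]
  have hint : IntegrableOn (fun ω => ‖ψ ω‖ ^ 2) (⋃ i, X i) ν := (integrable_norm_sq ψ).integrableOn
  have h1 := hasSum_integral_iUnion hX hd hint
  have hsq : ∀ s : Finset ℕ, ‖mulOp ν (charFn ν (Finset.measurableSet_biUnion s fun i _ => hX i)) ψ -
      mulOp ν (charFn ν (MeasurableSet.iUnion hX)) ψ‖ ^ 2 =
        ∫ ω in ⋃ i, X i, ‖ψ ω‖ ^ 2 ∂ν - ∑ i ∈ s, ∫ ω in X i, ‖ψ ω‖ ^ 2 ∂ν := by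
    intro s
    rw [norm_sub_sq_of_isStarProjection (isStarProjection_mulOp_charFn _)
      (isStarProjection_mulOp_charFn _), norm_sq_mulOp_charFn, norm_sq_mulOp_charFn,
      integral_biUnion_finset s (fun i _ => hX i) (fun i _ j _ hij => hd hij)
        (fun i _ => (integrable_norm_sq ψ).integrableOn)]
    rw [← mulOp_mulFn, mulFn_charFn]
    congr 2
    exact Set.inter_eq_right.2 (Set.iUnion₂_subset fun i _ => Set.subset_iUnion X i)
  have h0 : Tendsto (fun s : Finset ℕ =>
      ‖mulOp ν (charFn ν (Finset.measurableSet_biUnion s fun i _ => hX i)) ψ -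
        mulOp ν (charFn ν (MeasurableSet.iUnion hX)) ψ‖ ^ 2) atTop (𝓝 0) := by
    simp only [hsq]
    have := (tendsto_const_nhds (x := ∫ ω in ⋃ i, X i, ‖ψ ω‖ ^ 2 ∂ν)).sub h1
    rwa [sub_self] at this
  have h2 := (Real.continuous_sqrt.tendsto 0).comp h0
  rw [Real.sqrt_zero] at h2
  exact h2.congr fun i => Real.sqrt_sq (norm_nonneg _)

/-! ### Restriction of the GNS representation to elementary operators -/

section OfGNS

variable {H : Type u} {V : Type u} [NormedAddCommGroup H] [InnerProductSpace ℂ H] [CompleteSpace H]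
  [AddCommGroup V] [Module ℂ V] [Module (H →L[ℂ] H)ᵐᵒᵖ V]
  {S : tensorVN ν K →ₗ[ℂ] (V → V → (H →L[ℂ] H))} {π : tensorVN ν K →⋆ₐ[ℂ] (𝓗 →L[ℂ] 𝓗)}
  {J : V →ₗ[ℂ] (H →L[ℂ] 𝓗)}

lemma IsGNS.total_rankOne (hG : IsGNS S π J) (hN : ∀ v, IsNormalMap fun d => S d v v) :
    Dense (Submodule.span ℂ {ψ : 𝓗 | ∃ x y φ,
      ψ = π (elem ν (InnerProductSpace.rankOne ℂ x y) (oneFn ν)) φ} : Set 𝓗) := by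
  obtain ⟨w, b, -⟩ := exists_hilbertBasis ℂ K
  intro x
  refine mem_closure_of_tendsto (hG.tendsto_basisProj hN b x) (Eventually.of_forall fun s => ?_)
  rw [elem_basisProj, map_sum, sum_apply]
  exact Submodule.sum_mem _ fun i _ => Submodule.subset_span ⟨_, _, x, rfl⟩

/-- Countable additivity is normality along the increasing net of finite partial unions. -/
lemma IsGNS.tendsto_charFn (hG : IsGNS S π J) (hN : ∀ v, IsNormalMap fun d => S d v v)
    (X : ℕ → Set Ω) (hX : ∀ i, MeasurableSet (X i)) (hd : Pairwise (Function.onFun Disjoint X))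
    (φ : 𝓗) : Tendsto (fun s : Finset ℕ =>
      π (elem ν 1 (charFn ν (Finset.measurableSet_biUnion s fun i _ => hX i))) φ) atTop
      (𝓝 (π (elem ν 1 (charFn ν (MeasurableSet.iUnion hX))) φ)) := by
  have hmul : ∀ {Y Z : Set Ω} (hY : MeasurableSet Y) (hZ : MeasurableSet Z), Z ⊆ Y →
      elem ν (1 : K →L[ℂ] K) (charFn ν hY) * elem ν 1 (charFn ν hZ) = elem ν 1 (charFn ν hZ) := by
    intro Y Z hY hZ h
    rw [elem_mul, one_mul, mulFn_charFn]
    congr 2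
    exact Set.inter_eq_right.2 h
  refine hG.tendsto_apply hN
    (q := fun s : Finset ℕ => elem ν 1 (charFn ν (Finset.measurableSet_biUnion s fun i _ => hX i)))
    (fun s => isStarProjection_elem_charFn _) (isStarProjection_elem_charFn _)
    (fun s t hst => hmul _ _ (Set.biUnion_subset_biUnion_left hst))
    (fun s => hmul _ _ (Set.iUnion₂_subset fun i _ => Set.subset_iUnion X i)) ?_ φ
  simp only [val_elem]
  refine tendsto_apply_of_dense (C := 1) ?_ dense_span_range_tmulL ?_
  · refine Eventually.of_forall fun s => (norm_opTensor_le _ _).trans ?_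
    exact mul_le_one₀ ContinuousLinearMap.norm_id_le (norm_nonneg _)
      (isStarProjection_mulOp_charFn _).norm_le
  · rintro _ ⟨⟨x, y⟩, rfl⟩
    simp only [opTensor_tmulL, one_apply_eq_self]
    exact ((tmulL x).continuous.tendsto _).comp (tendsto_mulOp_charFn X hX hd y)

lemma map_val_smul (π : tensorVN ν K →⋆ₐ[ℂ] (𝓗 →L[ℂ] 𝓗)) (z : ℂ) (d : tensorVN ν K) :
    π (z • d) = z • π d := by
  have h : z • d = algebraMap ℂ (tensorVN ν K) z * d :=
    Subtype.ext (by rw [val_smul, val_mul]; exact Algebra.smul_def z d.1)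
  rw [h, map_mul, AlgHomClass.commutes, ← Algebra.smul_def]

lemma map_val_add (π : tensorVN ν K →⋆ₐ[ℂ] (𝓗 →L[ℂ] 𝓗)) (d d' : tensorVN ν K) :
    π (d + d') = π d + π d' :=
  map_add π.toAlgHom.toRingHom d d'

lemma map_elem_smul_left (π : tensorVN ν K →⋆ₐ[ℂ] (𝓗 →L[ℂ] 𝓗)) (z : ℂ) (b : K →L[ℂ] K)
    (f : Lp ℂ ∞ ν) : π (elem ν (z • b) f) = z • π (elem ν b f) := by
  rw [elem_smul_left]
  exact map_val_smul π z _

lemma map_elem_smul_right (π : tensorVN ν K →⋆ₐ[ℂ] (𝓗 →L[ℂ] 𝓗)) (z : ℂ) (b : K →L[ℂ] K)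
    (f : Lp ℂ ∞ ν) : π (elem ν b (z • f)) = z • π (elem ν b f) := by
  rw [elem_smul_right]
  exact map_val_smul π z _

lemma map_elem_add_right (π : tensorVN ν K →⋆ₐ[ℂ] (𝓗 →L[ℂ] 𝓗)) (b : K →L[ℂ] K)
    (f f' : Lp ℂ ∞ ν) : π (elem ν b (f + f')) = π (elem ν b f) + π (elem ν b f') := by
  rw [elem_add_right]
  exact map_val_add π _ _

lemma map_elem_sum_right (π : tensorVN ν K →⋆ₐ[ℂ] (𝓗 →L[ℂ] 𝓗)) {ι : Type*} (φ : 𝓗)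
    (f : ι → Lp ℂ ∞ ν) (s : Finset ι) :
    π (elem ν 1 (∑ i ∈ s, f i)) φ = ∑ i ∈ s, π (elem ν 1 (f i)) φ :=
  map_sum (AddMonoidHom.mk' (fun f : Lp ℂ ∞ ν => π (elem ν 1 f) φ) fun f f' => by
    rw [map_elem_add_right, add_apply]) f s

theorem IsGNS.isTensorRep (hG : IsGNS S π J) (hN : ∀ v, IsNormalMap fun d => S d v v) :
    IsTensorRep fun (b : K →L[ℂ] K) (f : Lp ℂ ∞ ν) => π (elem ν b f) where
  mul b b' f f' := by rw [← elem_mul, map_mul]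
  star b f := by rw [← star_elem, map_star]
  one := by rw [elem_one, map_one]
  smul_left := map_elem_smul_left π
  add_right := map_elem_add_right π
  smul_right := map_elem_smul_right π
  norm_le b f := (norm_rep_le π _).trans ((norm_opTensor_le _ _).trans (by
    gcongr; exact norm_mulOp_le f))
  total := hG.total_rankOne hN
  hasSum X hX hd φ := by
    refine (hG.tendsto_charFn hN X hX hd φ).congr fun s => ?_
    rw [charFn_biUnion X hX hd]
    exact map_elem_sum_right π φ _ s

end OfGNS

end TensorRep

/-! ### Dilations into `K ⊗ F` -/

section Model

variable {Ω : Type u} [MeasurableSpace Ω] {ν : Measure Ω} {K : Type u} [NormedAddCommGroup K]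
  [InnerProductSpace ℂ K] [CompleteSpace K]
  {𝓗 : Type u} [NormedAddCommGroup 𝓗] [InnerProductSpace ℂ 𝓗] [CompleteSpace 𝓗]
  {R : (K →L[ℂ] K) → Lp ℂ ∞ ν → (𝓗 →L[ℂ] 𝓗)}

lemma IsTensorRep.mul_one (hR : IsTensorRep R) (b : K →L[ℂ] K) (f : Lp ℂ ∞ ν) :
    R b (oneFn ν) * R 1 f = R b f := by
  rw [← hR.mul, _root_.mul_one, oneFn_mulFn]

lemma IsTensorRep.one_mul (hR : IsTensorRep R) (b : K →L[ℂ] K) (f : Lp ℂ ∞ ν) :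
    R 1 f * R b (oneFn ν) = R b f := by
  rw [← hR.mul, _root_.one_mul, mulFn_oneFn]

/-- Since b ⊗ f = (b ⊗ 1)(1 ⊗ f), the equivalence for the representation of L(K) suffices: the
second factor commutes with the first and acts on the multiplicity space as ϖ(f). -/
lemma IsTensorRep.exists_equiv (hR : IsTensorRep R) {e : K} (he : ‖e‖ = 1) {F : Type*}
    [NormedAddCommGroup F] [InnerProductSpace ℂ F] [CompleteSpace F] (j : F →ₗᵢ[ℂ] 𝓗)
    (hj : ∀ ψ, ∃ η, j η = R (InnerProductSpace.rankOne ℂ e e) (oneFn ν) ψ)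
    (hj' : ∀ η, R (InnerProductSpace.rankOne ℂ e e) (oneFn ν) (j η) = j η)
    (ϖ : Lp ℂ ∞ ν → (F →L[ℂ] F)) (hϖ : ∀ f η, j (ϖ f η) = R 1 f (j η)) :
    ∃ W : HilbertTensor K F ≃ₗᵢ[ℂ] 𝓗, ∀ b f z, W (opTensor b (ϖ f) z) = R b f (W z) := by
  obtain ⟨W, hW⟩ := exists_equiv_of_rep (fun b => R b (oneFn ν))
    (fun a b => by rw [← hR.mul, mulFn_oneFn]) (fun a => by rw [← hR.star, star_oneFn])
    (fun z a => hR.smul_left z a _) he j hj hj' hR.total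
  refine ⟨W, fun b f z => ?_⟩
  have h : W.toContinuousLinearEquiv.toContinuousLinearMap ∘L opTensor b (ϖ f) =
      R b f ∘L W.toContinuousLinearEquiv.toContinuousLinearMap := by
    refine HilbertTensor.clm_ext fun x η => ?_
    show W (opTensor b (ϖ f) (tmulL x η)) = R b f (W (tmulL x η))
    rw [opTensor_tmulL, hW, hW, hϖ, ← mul_apply_eq_comp, ← mul_apply_eq_comp, hR.mul_one, ← hR.mul,
      mulFn_oneFn]
    congr 2
    ext v
    simp [mul_apply_eq_comp, InnerProductSpace.rankOne_apply]
  exact congrArg (fun T => T z) h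

/-- The multiplicity space of a representation of `L(K) ⊗ L^∞(ν)`. -/
lemma IsTensorRep.exists_multiplicity_space (hR : IsTensorRep R) {e : K} (he : ‖e‖ = 1) :
    ∃ (H₀ : Submodule ℂ 𝓗) (_ : CompleteSpace H₀) (ϖ : Lp ℂ ∞ ν →ₗ[ℂ] (H₀ →L[ℂ] H₀)),
      (∀ f (η : H₀), (ϖ f η : 𝓗) = R 1 f η) ∧
      (∀ ψ, R (InnerProductSpace.rankOne ℂ e e) (oneFn ν) ψ ∈ H₀) ∧
      ∀ η ∈ H₀, R (InnerProductSpace.rankOne ℂ e e) (oneFn ν) η = η := by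
  set P := R (InnerProductSpace.rankOne ℂ e e) (oneFn ν) with hP
  have hPP : P * P = P := by
    rw [hP, ← hR.mul, mulFn_oneFn, rankOne_mul_rankOne, inner_self_eq_ofReal, he]
    simp
  -- The range of the idempotent P, described as the kernel of P − 1 so that it is visibly closed.
  set H₀ : Submodule ℂ 𝓗 := LinearMap.ker (P - 1).toLinearMap with hH
  have hmem : ∀ η, η ∈ H₀ ↔ P η = η := fun η => by
    rw [hH, LinearMap.mem_ker]
    show P η - η = 0 ↔ _
    exact sub_eq_zero
  have hc : CompleteSpace H₀ := ((P - 1).isClosed_ker).completeSpace_coe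
  have hinv : ∀ f, ∀ η ∈ H₀, R 1 f η ∈ H₀ := by
    intro f η hη
    rw [hmem] at hη ⊢
    rw [hP, ← mul_apply_eq_comp, hR.mul_one, ← hR.one_mul, mul_apply_eq_comp, ← hP, hη]
  refine ⟨H₀, hc, ⟨⟨fun f => (R 1 f).restrict (p := H₀) (q := H₀) (hinv f), fun f f' => ?_⟩,
    fun z f => ?_⟩, fun f η => rfl, fun ψ => ?_, fun η hη => (hmem η).1 hη⟩
  · ext η
    show R 1 (f + f') η = R 1 f η + R 1 f' η
    rw [hR.add_right]; rfl
  · ext η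
    show R 1 (z • f) η = z • R 1 f η
    rw [hR.smul_right]; rfl
  · rw [hmem, ← mul_apply_eq_comp, hPP]

/-- The algebraic and continuity properties of a normal representation of `L^∞(ν)`. -/
structure IsNormalRep {F : Type*} [NormedAddCommGroup F] [InnerProductSpace ℂ F] [CompleteSpace F]
    (ϖ : Lp ℂ ∞ ν →ₗ[ℂ] (F →L[ℂ] F)) : Prop where
  mul : ∀ f g, ϖ (mulFn f g) = ϖ f * ϖ g
  star : ∀ f, ϖ (star f) = star (ϖ f)
  one : ϖ (oneFn ν) = 1
  norm_le : ∀ f, ‖ϖ f‖ ≤ ‖f‖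
  hasSum : ∀ (X : ℕ → Set Ω) (hX : ∀ i, MeasurableSet (X i)), Pairwise (Function.onFun Disjoint X) →
    ∀ x, HasSum (fun i => ϖ (charFn ν (hX i)) x) (ϖ (charFn ν (MeasurableSet.iUnion hX)) x)

lemma IsTensorRep.isNormalRep (hR : IsTensorRep R) {F : Type*} [NormedAddCommGroup F]
    [InnerProductSpace ℂ F] [CompleteSpace F] (j : F →ₗᵢ[ℂ] 𝓗) (ϖ : Lp ℂ ∞ ν →ₗ[ℂ] (F →L[ℂ] F))
    (h : ∀ f η, j (ϖ f η) = R 1 f (j η)) : IsNormalRep ϖ where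
  mul f g := ContinuousLinearMap.ext fun η => j.injective <| by
    rw [h, mul_apply_eq_comp, h, h, ← mul_apply_eq_comp, ← hR.mul, _root_.mul_one]
  star f := ContinuousLinearMap.ext fun η => ext_inner_left ℂ fun ξ => by
    rw [ContinuousLinearMap.star_eq_adjoint, ContinuousLinearMap.adjoint_inner_right,
      ← j.inner_map_map, ← j.inner_map_map, h, h, ← ContinuousLinearMap.adjoint_inner_right,
      ← ContinuousLinearMap.star_eq_adjoint, ← hR.star, star_one]
  one := ContinuousLinearMap.ext fun η => j.injective <| by rw [h, hR.one]; rfl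
  norm_le f := ContinuousLinearMap.opNorm_le_bound _ (norm_nonneg _) fun η => by
    rw [← j.norm_map, h, ← j.norm_map η]
    refine (R 1 f).le_of_opNorm_le ((hR.norm_le 1 f).trans ?_) _
    exact mul_le_of_le_one_left (norm_nonneg _) ContinuousLinearMap.norm_id_le
  hasSum X hX hd x := by
    have h1 := hR.hasSum X hX hd (j x)
    simp only [← h] at h1
    rw [HasSum, j.isometry.isEmbedding.tendsto_nhds_iff]
    refine h1.congr fun s => ?_
    simp

open Classical in
/-- The spectral measure of a normal representation of `L^∞(ν)`. -/
def IsNormalRep.spectralMeasure {F : Type*} [NormedAddCommGroup F] [InnerProductSpace ℂ F]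
    [CompleteSpace F] {ϖ : Lp ℂ ∞ ν →ₗ[ℂ] (F →L[ℂ] F)} (hϖ : IsNormalRep ϖ) :
    SpectralMeasure Ω F where
  toFun X := if h : MeasurableSet X then ϖ (charFn ν h) else 0
  isStarProjection X hX := by
    rw [dif_pos hX]
    refine ⟨?_, ?_⟩
    · rw [IsIdempotentElem, ← hϖ.mul, mulFn_charFn]
      congr 2
      exact Set.inter_self X
    · rw [IsSelfAdjoint, ← hϖ.star, star_charFn]
  map_univ := by rw [dif_pos MeasurableSet.univ, charFn_univ, hϖ.one]
  hasSum_iUnion X hX hd x := by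
    simp only [dif_pos (hX _), dif_pos (MeasurableSet.iUnion hX)]
    exact hϖ.hasSum X hX hd x

lemma IsNormalRep.spectralMeasure_apply {F : Type*} [NormedAddCommGroup F] [InnerProductSpace ℂ F]
    [CompleteSpace F] {ϖ : Lp ℂ ∞ ν →ₗ[ℂ] (F →L[ℂ] F)} (hϖ : IsNormalRep ϖ) {X : Set Ω}
    (hX : MeasurableSet X) : hϖ.spectralMeasure.toFun X = ϖ (charFn ν hX) := dif_pos hX

end Model

/-! ### Minimal dilations into K ⊗ F and into direct integrals -/

section Dilation

lemma sigmaStronglyDense_span_of_dense {H H' : Type*} [NormedAddCommGroup H] [InnerProductSpace ℂ H]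
    [CompleteSpace H] [NormedAddCommGroup H'] [InnerProductSpace ℂ H'] [CompleteSpace H']
    {s : Set (H →L[ℂ] H')} (hr : ∀ T ∈ s, ∀ a : H →L[ℂ] H, T ∘L a ∈ s)
    (hd : Dense (Submodule.span ℂ {x : H' | ∃ T ∈ s, ∃ h, x = T h} : Set H')) :
    SigmaStronglyDense (Submodule.span ℂ s : Set (H →L[ℂ] H')) := by
  refine sigmaStronglyDense_of_dense _ (fun m hm a => ?_) (hd.mono ?_)
  · induction hm using Submodule.span_induction with
    | mem T hT => exact Submodule.subset_span (hr T hT a)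
    | zero => rw [ContinuousLinearMap.zero_comp]; exact Submodule.zero_mem _
    | add T T' _ _ h h' => rw [ContinuousLinearMap.add_comp]; exact Submodule.add_mem _ h h'
    | smul c T _ h => rw [ContinuousLinearMap.smul_comp]; exact Submodule.smul_mem _ c h
  · refine SetLike.coe_subset_coe.2 (Submodule.span_mono ?_)
    rintro _ ⟨T, hT, h, rfl⟩
    exact ⟨T, Submodule.subset_span hT, h, rfl⟩

variable {Ω : Type u} [MeasurableSpace Ω] {ν : Measure Ω} {K : Type u} [NormedAddCommGroup K]
  [InnerProductSpace ℂ K] [CompleteSpace K]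
  {H : Type u} {V : Type u} [NormedAddCommGroup H] [InnerProductSpace ℂ H] [CompleteSpace H]
  [AddCommGroup V] [Module ℂ V] [Module (H →L[ℂ] H)ᵐᵒᵖ V]

/-- `Y` is a minimal dilation of `S` into `K ⊗ F`, where `L^∞(ν)` acts on `F` through `ϖ`. -/
structure IsDilation (S : tensorVN ν K →ₗ[ℂ] (V → V → (H →L[ℂ] H))) {F : Type*}
    [NormedAddCommGroup F] [InnerProductSpace ℂ F] [CompleteSpace F] (ϖ : Lp ℂ ∞ ν → (F →L[ℂ] F))
    (Y : V →ₗ[ℂ] (H →L[ℂ] HilbertTensor K F)) : Prop where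
  moduleMap : IsModuleMap Y
  dilates : ∀ (b : K →L[ℂ] K) (f : Lp ℂ ∞ ν) (v w : V),
    S (elem ν b f) v w = (Y v)† ∘L opTensor b (ϖ f) ∘L Y w
  dense : Dense (Submodule.span ℂ (Set.range fun p : (((K →L[ℂ] K) × Lp ℂ ∞ ν) × V) × H =>
    opTensor p.1.1.1 (ϖ p.1.1.2) (Y p.1.2 p.2)) : Set (HilbertTensor K F))

lemma dense_span_range_map {ι E E' : Type*} [NormedAddCommGroup E] [InnerProductSpace ℂ E]
    [NormedAddCommGroup E'] [InnerProductSpace ℂ E'] {a : ι → E}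
    (ha : Dense (Submodule.span ℂ (Set.range a) : Set E)) (W : E ≃ₗᵢ[ℂ] E') :
    Dense (Submodule.span ℂ (Set.range fun i => W (a i)) : Set E') := by
  have h := W.surjective.denseRange.dense_image W.continuous ha
  have h2 : W '' (Submodule.span ℂ (Set.range a) : Set E) =
      (Submodule.span ℂ (Set.range fun i => W (a i)) : Set E') := by
    have := Submodule.map_span W.toLinearEquiv.toLinearMap (Set.range a)
    rw [← Set.range_comp] at this
    exact congrArg (fun N : Submodule ℂ E' => (N : Set E')) this
  rwa [h2] at h

lemma exists_isDilation {S : tensorVN ν K →ₗ[ℂ] (V → V → (H →L[ℂ] H))}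
    {𝓗 : Type*} [NormedAddCommGroup 𝓗] [InnerProductSpace ℂ 𝓗] [CompleteSpace 𝓗]
    {R : (K →L[ℂ] K) → Lp ℂ ∞ ν → (𝓗 →L[ℂ] 𝓗)} {J : V →ₗ[ℂ] (H →L[ℂ] 𝓗)} (hJ : IsModuleMap J)
    (hS : ∀ b f v w, S (elem ν b f) v w = (J v)† ∘L R b f ∘L J w)
    (hd : Dense (Submodule.span ℂ (Set.range fun p : (((K →L[ℂ] K) × Lp ℂ ∞ ν) × V) × H =>
      R p.1.1.1 p.1.1.2 (J p.1.2 p.2)) : Set 𝓗)) {F : Type*} [NormedAddCommGroup F]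
    [InnerProductSpace ℂ F] [CompleteSpace F] {ϖ : Lp ℂ ∞ ν → (F →L[ℂ] F)}
    (W : HilbertTensor K F ≃ₗᵢ[ℂ] 𝓗) (hW : ∀ b f z, W (opTensor b (ϖ f) z) = R b f (W z)) :
    ∃ Y : V →ₗ[ℂ] (H →L[ℂ] HilbertTensor K F), IsDilation S ϖ Y := by
  set W' : 𝓗 →L[ℂ] HilbertTensor K F := W.symm.toContinuousLinearEquiv.toContinuousLinearMap with hW'
  have hWW' : ∀ x, W (W' x) = x := W.apply_symm_apply
  have hW'W : ∀ b f x, opTensor b (ϖ f) (W' x) = W' (R b f x) := fun b f x =>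
    W.injective (by rw [hW, hWW', hWW'])
  refine ⟨⟨⟨fun v => W' ∘L J v, fun v w => ?_⟩, fun c v => ?_⟩, ?_, ?_, ?_⟩
  · rw [map_add, ContinuousLinearMap.comp_add]
  · show W' ∘L J (c • v) = c • (W' ∘L J v)
    rw [map_smul, ContinuousLinearMap.comp_smul]
  · intro a v
    show W' ∘L J _ = (W' ∘L J v) ∘L a
    rw [hJ, ContinuousLinearMap.comp_assoc]
  · intro b f v w
    refine ContinuousLinearMap.ext fun h => ext_inner_left ℂ fun h' => ?_
    show _ = ⟪h', ((W' ∘L J v)†) (opTensor b (ϖ f) (W' (J w h)))⟫_ℂ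
    rw [hS, ContinuousLinearMap.adjoint_inner_right, hW'W]
    show ⟪h', ((J v)†) (R b f (J w h))⟫_ℂ = ⟪W.symm (J v h'), W.symm _⟫_ℂ
    rw [LinearIsometryEquiv.inner_map_map, ContinuousLinearMap.adjoint_inner_right]
  · have := dense_span_range_map hd W.symm
    refine this.mono (SetLike.coe_subset_coe.2 (Submodule.span_mono ?_))
    rintro _ ⟨p, rfl⟩
    exact ⟨p, hW'W _ _ _⟩

/-- For fixed b, v, h the vector (b ⊗ ϖ(f))(Yv)h depends norm continuously on f because ϖ is
contractive, so simple functions suffice. -/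
lemma IsDilation.dense_charFn {S : tensorVN ν K →ₗ[ℂ] (V → V → (H →L[ℂ] H))} {F : Type*}
    [NormedAddCommGroup F] [InnerProductSpace ℂ F] [CompleteSpace F]
    {ϖ : Lp ℂ ∞ ν →ₗ[ℂ] (F →L[ℂ] F)} (hϖ : IsNormalRep ϖ)
    {Y : V →ₗ[ℂ] (H →L[ℂ] HilbertTensor K F)} (hY : IsDilation S ϖ Y) :
    Dense (Submodule.span ℂ {x : HilbertTensor K F | ∃ (b : K →L[ℂ] K) (X : Set Ω)
      (hX : MeasurableSet X) (v : V) (h : H), x = opTensor b (ϖ (charFn ν hX)) (Y v h)} :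
      Set (HilbertTensor K F)) := by
  set N := (Submodule.span ℂ {x : HilbertTensor K F | ∃ (b : K →L[ℂ] K) (X : Set Ω)
      (hX : MeasurableSet X) (v : V) (h : H), x = opTensor b (ϖ (charFn ν hX)) (Y v h)}) with hN
  have hmem : ∀ b f v h, opTensor b (ϖ f) (Y v h) ∈ N.topologicalClosure := by
    intro b f v h
    set L : Lp ℂ ∞ ν →L[ℂ] HilbertTensor K F := LinearMap.mkContinuous
      ⟨⟨fun f => opTensor b (ϖ f) (Y v h), fun f g => by
        rw [map_add, opTensor_add_right, add_apply]⟩,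
        fun c f => by
          show opTensor b (ϖ (c • f)) (Y v h) = c • opTensor b (ϖ f) (Y v h)
          rw [map_smul, opTensor_smul_right, smul_apply]⟩ (‖b‖ * ‖Y v h‖) (fun f => by
        show ‖opTensor b (ϖ f) (Y v h)‖ ≤ _
        refine ((opTensor b (ϖ f)).le_of_opNorm_le (norm_opTensor_le b (ϖ f)) _).trans ?_
        rw [mul_right_comm]
        gcongr
        exact hϖ.norm_le f) with hL
    have hle : Submodule.span ℂ {f : Lp ℂ ∞ ν | ∃ (X : Set Ω) (hX : MeasurableSet X),
        f = charFn ν hX} ≤ N.topologicalClosure.comap L.toLinearMap := by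
      refine Submodule.span_le.2 ?_
      rintro _ ⟨X, hX, rfl⟩
      exact Submodule.le_topologicalClosure _ (Submodule.subset_span ⟨b, X, hX, v, h, rfl⟩)
    have hcl : IsClosed (N.topologicalClosure.comap L.toLinearMap : Set (Lp ℂ ∞ ν)) :=
      (Submodule.isClosed_topologicalClosure N).preimage L.continuous
    exact (dense_span_charFn (ν := ν)).closure_eq ▸ closure_minimal hle hcl <| by trivial
  have hle : Submodule.span ℂ (Set.range fun p : (((K →L[ℂ] K) × Lp ℂ ∞ ν) × V) × H =>
      opTensor p.1.1.1 (ϖ p.1.1.2) (Y p.1.2 p.2)) ≤ N.topologicalClosure := by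
    refine Submodule.span_le.2 ?_
    rintro _ ⟨p, rfl⟩
    exact hmem _ _ _ _
  have := (hY.dense.mono (SetLike.coe_subset_coe.2 hle)).closure_eq
  rw [Submodule.topologicalClosure_coe, closure_closure] at this
  exact dense_iff_closure_eq.2 this

/-- The separability assumption of the theorem speaks of Naimark dilations; this is what makes it
apply to the multiplicity space. -/
lemma IsDilation.isMinimalNaimarkDilation {S : tensorVN ν K →ₗ[ℂ] (V → V → (H →L[ℂ] H))}
    {F : Type*} [NormedAddCommGroup F] [InnerProductSpace ℂ F] [CompleteSpace F]
    {ϖ : Lp ℂ ∞ ν →ₗ[ℂ] (F →L[ℂ] F)} (hϖ : IsNormalRep ϖ)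
    {Y : V →ₗ[ℂ] (H →L[ℂ] HilbertTensor K F)} (hY : IsDilation S ϖ Y) :
    IsMinimalNaimarkDilation S hϖ.spectralMeasure Y where
  moduleMap := hY.moduleMap
  dilates b X hX v w := by rw [hY.dilates, hϖ.spectralMeasure_apply hX]
  dense := by
    refine sigmaStronglyDense_span_of_dense ?_ ((hY.dense_charFn hϖ).mono ?_)
    · rintro _ ⟨b, X, v, hX, rfl⟩ a
      exact ⟨b, X, MulOpposite.op a • v, hX, by rw [hY.moduleMap, ContinuousLinearMap.comp_assoc]⟩
    · refine SetLike.coe_subset_coe.2 (Submodule.span_mono ?_)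
      rintro _ ⟨b, X, hX, v, h, rfl⟩
      exact ⟨_, ⟨b, X, v, hX, rfl⟩, h, by rw [hϖ.spectralMeasure_apply hX]; rfl⟩

/-- A normal completely positive map is the compression of a representation. -/
theorem exists_isTensorRep [SigmaFinite ν] {S : tensorVN ν K →ₗ[ℂ] (V → V → (H →L[ℂ] H))}
    (hS : IsCPForm S) (hN : ∀ v, IsNormalMap fun d => S d v v) :
    ∃ (𝓗 : Type u) (_ : NormedAddCommGroup 𝓗) (_ : InnerProductSpace ℂ 𝓗) (_ : CompleteSpace 𝓗)
      (R : (K →L[ℂ] K) → Lp ℂ ∞ ν → (𝓗 →L[ℂ] 𝓗)) (J : V →ₗ[ℂ] (H →L[ℂ] 𝓗)),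
      IsTensorRep R ∧ IsModuleMap J ∧
      (∀ b f v w, S (elem ν b f) v w = (J v)† ∘L R b f ∘L J w) ∧
      Dense (Submodule.span ℂ (Set.range fun p : (((K →L[ℂ] K) × Lp ℂ ∞ ν) × V) × H =>
        R p.1.1.1 p.1.1.2 (J p.1.2 p.2)) : Set 𝓗) := by
  obtain ⟨𝓗, i1, i2, i3, π, J, hG⟩ := hS.exists_gns exists_star_mul_self_add_eq'
  exact ⟨𝓗, i1, i2, i3, fun b f => π (elem ν b f), J, hG.isTensorRep hN, hG.moduleMap,
    fun b f => hG.dilates _, hG.dense_elem hN⟩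

/-- Every normal completely positive map with separable Naimark dilation space has a minimal
dilation into a direct integral. -/
theorem exists_isDilation_directIntegral [SigmaFinite ν] [Nontrivial K]
    {S : tensorVN ν K →ₗ[ℂ] (V → V → (H →L[ℂ] H))} (hS : IsCPForm S)
    (hN : ∀ v, IsNormalMap fun d => S d v v)
    (hsep : ∀ (H₀ : Type u) [NormedAddCommGroup H₀] [InnerProductSpace ℂ H₀] [CompleteSpace H₀]
      (F : SpectralMeasure Ω H₀) (Y₀ : V →ₗ[ℂ] (H →L[ℂ] HilbertTensor K H₀)),
      IsMinimalNaimarkDilation S F Y₀ → TopologicalSpace.SeparableSpace H₀) :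
    ∃ n : Ω → ℕ∞, Measurable n ∧ TopologicalSpace.SeparableSpace (DirectIntegral ν n) ∧
      ∃ Y : V →ₗ[ℂ] (H →L[ℂ] HilbertTensor K (DirectIntegral ν n)), IsDilation S diagOp Y := by
  obtain ⟨𝓗, _, _, _, R, J, hR, hJ, hdil, hd⟩ := exists_isTensorRep hS hN
  obtain ⟨e, he⟩ := exists_norm_eq K zero_le_one
  obtain ⟨H₀, _, ϖ, hϖ, hH₀, hH₀'⟩ := hR.exists_multiplicity_space he
  obtain ⟨W, hW⟩ := hR.exists_equiv he H₀.subtypeₗᵢ (fun ψ => ⟨⟨_, hH₀ ψ⟩, rfl⟩)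
    (fun η => hH₀' _ η.2) ϖ hϖ
  obtain ⟨Y₀, hY₀⟩ := exists_isDilation hJ hdil hd W hW
  have hn := hR.isNormalRep H₀.subtypeₗᵢ ϖ hϖ
  have := hsep H₀ _ Y₀ (hY₀.isMinimalNaimarkDilation hn)
  obtain ⟨n, hnm, W₀, hW₀⟩ := exists_directIntegral_equiv ϖ hn.mul hn.star hn.one
    (exists_density ϖ hn.mul hn.star hn.norm_le hn.hasSum)
  -- Once `H₀` is known to be separable it is replaced by the equivalent direct integral, and the
  -- tensor product identification is rebuilt through `W₀`.
  obtain ⟨W', hW'⟩ := hR.exists_equiv he (H₀.subtypeₗᵢ.comp W₀.symm.toLinearIsometry)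
    (fun ψ => ⟨W₀ ⟨_, hH₀ ψ⟩, congrArg H₀.subtypeₗᵢ (W₀.symm_apply_apply _)⟩)
    (fun η => hH₀' _ (W₀.symm η).2) diagOp (fun f η => by
      show ((W₀.symm (diagOp f η) : H₀) : 𝓗) = R 1 f (W₀.symm η : H₀)
      rw [← hϖ]
      congr 1
      apply W₀.injective
      rw [hW₀, W₀.apply_symm_apply, W₀.apply_symm_apply])
  obtain ⟨Y, hY⟩ := exists_isDilation hJ hdil hd W' hW'
  exact ⟨n, hnm, W₀.surjective.denseRange.separableSpace W₀.continuous, Y, hY⟩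

end Dilation

/-! ### Translations -/

section Translation

variable {Ω : Type*} [MeasurableSpace Ω] {ν : Measure Ω} {G : Type*} [Group G] [MulAction G Ω]
  [MeasurableConstSMul G Ω] (hν : IsQuasiInvariant ν G)

include hν

lemma IsQuasiInvariant.ae_smul (g : G) {p : Ω → Prop} (h : ∀ᵐ ω ∂ν, p ω) : ∀ᵐ ω ∂ν, p (g • ω) :=
  (hν.quasiMeasurePreserving g).ae h

lemma IsQuasiInvariant.ae_of_ae_smul (g : G) {p : Ω → Prop} (h : ∀ᵐ ω ∂ν, p (g • ω)) :
    ∀ᵐ ω ∂ν, p ω := by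
  have := hν.ae_smul g⁻¹ h
  simpa only [smul_inv_smul] using this

lemma coeFn_translate (g : G) (f : Lp ℂ ∞ ν) :
    translate hν g f =ᵐ[ν] fun ω => f (g⁻¹ • ω) := MemLp.coeFn_toLp _

lemma translate_translate_inv (g : G) (f : Lp ℂ ∞ ν) :
    translate hν g (translate hν g⁻¹ f) = f := by
  refine Lp.ext ?_
  filter_upwards [coeFn_translate hν g (translate hν g⁻¹ f),
    hν.ae_smul g⁻¹ (coeFn_translate hν g⁻¹ f)] with ω h1 h2
  rw [h1, h2, inv_inv, smul_inv_smul]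

lemma translate_mulFn (g : G) (f f' : Lp ℂ ∞ ν) :
    translate hν g (mulFn f f') = mulFn (translate hν g f) (translate hν g f') := by
  refine Lp.ext ?_
  filter_upwards [coeFn_translate hν g f, coeFn_translate hν g f',
    coeFn_translate hν g (mulFn f f'), hν.ae_smul g⁻¹ (coeFn_mulFn f f'),
    coeFn_mulFn (translate hν g f) (translate hν g f')] with ω h1 h2 h3 h4 h5
  rw [h3, h4, h5, h1, h2]

lemma translate_star (g : G) (f : Lp ℂ ∞ ν) :
    translate hν g (star f) = star (translate hν g f) := by
  refine Lp.ext ?_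
  filter_upwards [coeFn_translate hν g f, coeFn_translate hν g (star f),
    hν.ae_smul g⁻¹ (Lp.coeFn_star f), Lp.coeFn_star (translate hν g f)] with ω h1 h2 h3 h4
  rw [h2, h3, h4, Pi.star_apply, Pi.star_apply, h1]

lemma translate_oneFn (g : G) : translate hν g (oneFn ν) = oneFn ν := by
  refine Lp.ext ?_
  filter_upwards [coeFn_translate hν g (oneFn ν), hν.ae_smul g⁻¹ (coeFn_oneFn (ν := ν)),
    coeFn_oneFn (ν := ν)] with ω h1 h2 h3
  rw [h1, h2, h3]

variable [SigmaFinite ν]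

lemma IsQuasiInvariant.withDensity_rnDeriv (g : G) :
    ν.withDensity ((ν.map (fun ω : Ω => g • ω)).rnDeriv ν) = ν.map (fun ω : Ω => g • ω) := by
  have : SigmaFinite (ν.map (fun ω : Ω => g • ω)) := (MeasurableEquiv.smul g).sigmaFinite_map
  exact Measure.withDensity_rnDeriv_eq _ _ (hν.quasiMeasurePreserving g).absolutelyContinuous

/-- Change of variables: quasi-invariance makes the image of ν under g absolutely continuous, so its
density reproduces it. -/
lemma IsQuasiInvariant.lintegral_mul_rnDeriv (g : G) {F : Ω → ℝ≥0∞} (hF : AEMeasurable F ν) :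
    ∫⁻ ω, (ν.map (fun ω : Ω => g • ω)).rnDeriv ν ω * F (g⁻¹ • ω) ∂ν = ∫⁻ ω, F ω ∂ν := by
  have h1 : AEMeasurable (fun ω => F (g⁻¹ • ω)) ν :=
    hF.comp_quasiMeasurePreserving (hν.quasiMeasurePreserving g⁻¹)
  have h2 := lintegral_withDensity_eq_lintegral_mul₀
    (Measure.measurable_rnDeriv (ν.map (fun ω : Ω => g • ω)) ν).aemeasurable h1
  rw [hν.withDensity_rnDeriv g] at h2
  refine h2.symm.trans ?_
  have h3 := lintegral_map_equiv (μ := ν) (fun ω => F (g⁻¹ • ω)) (MeasurableEquiv.smul g)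
  refine h3.trans (lintegral_congr fun ω => ?_)
  show F (g⁻¹ • g • ω) = _
  rw [inv_smul_smul]

lemma IsQuasiInvariant.rnDeriv_lt_top (g : G) :
    ∀ᵐ ω ∂ν, (ν.map (fun ω : Ω => g • ω)).rnDeriv ν ω < ∞ := by
  have : SigmaFinite (ν.map (fun ω : Ω => g • ω)) := (MeasurableEquiv.smul g).sigmaFinite_map
  exact Measure.rnDeriv_lt_top _ _

/-- Chain rule for the densities. Applying the change of variables for g and then for h shows that
the product is also a density of the image of ν under gh, and densities are unique a.e. -/
lemma IsQuasiInvariant.rnDeriv_mul (g h : G) :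
    (ν.map (fun ω : Ω => (g * h) • ω)).rnDeriv ν =ᵐ[ν] fun ω =>
      (ν.map (fun ω : Ω => g • ω)).rnDeriv ν ω * (ν.map (fun ω : Ω => h • ω)).rnDeriv ν (g⁻¹ • ω) := by
  have hm : ∀ g : G, Measurable ((ν.map (fun ω : Ω => g • ω)).rnDeriv ν) := fun g =>
    Measure.measurable_rnDeriv _ _
  have hm' : Measurable fun ω => (ν.map (fun ω : Ω => g • ω)).rnDeriv ν ω *
      (ν.map (fun ω : Ω => h • ω)).rnDeriv ν (g⁻¹ • ω) :=
    (hm g).mul ((hm h).comp (measurable_const_smul g⁻¹))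
  have key : ν.map (fun ω : Ω => (g * h) • ω) = ν.withDensity fun ω =>
      (ν.map (fun ω : Ω => g • ω)).rnDeriv ν ω *
        (ν.map (fun ω : Ω => h • ω)).rnDeriv ν (g⁻¹ • ω) := by
    refine Measure.ext fun X hX => ?_
    rw [withDensity_apply _ hX, ← lintegral_indicator hX]
    have h1 := hν.lintegral_mul_rnDeriv g
      (F := fun ω => (ν.map (fun ω : Ω => h • ω)).rnDeriv ν ω * X.indicator 1 (g • ω))
      ((hm h).mul ((measurable_one.indicator hX).comp (measurable_const_smul g))).aemeasurable
    have h2 := hν.lintegral_mul_rnDeriv h (F := fun ω => X.indicator 1 ((g * h) • ω))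
      ((measurable_one.indicator hX).comp (measurable_const_smul (g * h))).aemeasurable
    simp only [mul_smul, smul_inv_smul] at h2
    rw [h2] at h1
    have h3 : ∫⁻ ω, X.indicator (1 : Ω → ℝ≥0∞) (g • h • ω) ∂ν =
        ν.map (fun ω : Ω => (g * h) • ω) X := by
      rw [Measure.map_apply (measurable_const_smul (g * h)) hX]
      rw [← lintegral_indicator_one (measurable_const_smul (g * h) hX)]
      refine lintegral_congr fun ω => ?_
      rw [← mul_smul]; rfl
    rw [← h3, ← h1]
    refine lintegral_congr fun ω => ?_
    rw [smul_inv_smul]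
    by_cases hω : ω ∈ X <;> simp [hω]
  conv_lhs => rw [key]
  exact Measure.rnDeriv_withDensity ν hm'

lemma IsQuasiInvariant.sqrtDensity_mul (g h : G) :
    ∀ᵐ ω ∂ν, sqrtDensity ν (g * h) ω = sqrtDensity ν g ω * sqrtDensity ν h (g⁻¹ • ω) := by
  filter_upwards [hν.rnDeriv_mul g h] with ω hω
  rw [sqrtDensity, hω, ENNReal.toReal_mul, Real.sqrt_mul ENNReal.toReal_nonneg]
  rfl

omit hν [MeasurableConstSMul G Ω] in
lemma sqrtDensity_one : ∀ᵐ ω ∂ν, sqrtDensity ν (1 : G) ω = 1 := by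
  filter_upwards [Measure.rnDeriv_self ν] with ω hω
  simp only [sqrtDensity, one_smul, Measure.map_id', hω]
  simp

lemma IsQuasiInvariant.sqrtDensity_mul_inv (g : G) :
    ∀ᵐ ω ∂ν, sqrtDensity ν g ω * sqrtDensity ν g⁻¹ (g⁻¹ • ω) = 1 := by
  filter_upwards [hν.sqrtDensity_mul g g⁻¹, sqrtDensity_one (ν := ν) (G := G)] with ω h1 h2
  rw [← h1, mul_inv_cancel, h2]

lemma IsQuasiInvariant.sqrtDensity_ne_zero (g : G) : ∀ᵐ ω ∂ν, (sqrtDensity ν g ω : ℂ) ≠ 0 := by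
  filter_upwards [hν.sqrtDensity_mul_inv g] with ω h1
  exact Complex.ofReal_ne_zero.2 (left_ne_zero_of_mul_eq_one h1)

omit hν [MeasurableConstSMul G Ω] [SigmaFinite ν] in
lemma measurable_sqrtDensity (g : G) : Measurable (sqrtDensity ν g : Ω → ℝ) :=
  (Measure.measurable_rnDeriv _ _).ennreal_toReal.sqrt

lemma IsQuasiInvariant.eLpNorm_translate (g : G) {E : Type*} [NormedAddCommGroup E]
    [InnerProductSpace ℂ E] {ψ : Ω → E} (hψ : AEStronglyMeasurable ψ ν) :
    eLpNorm (fun ω => (sqrtDensity ν g ω : ℂ) • ψ (g⁻¹ • ω)) 2 ν = eLpNorm ψ 2 ν := by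
  rw [eLpNorm_eq_lintegral_rpow_enorm_toReal two_ne_zero ENNReal.ofNat_ne_top,
    eLpNorm_eq_lintegral_rpow_enorm_toReal two_ne_zero ENNReal.ofNat_ne_top]
  congr 1
  rw [← hν.lintegral_mul_rnDeriv g (hψ.enorm.pow_const _)]
  refine lintegral_congr_ae ?_
  filter_upwards [hν.rnDeriv_lt_top g] with ω hω
  rw [enorm_smul, ENNReal.mul_rpow_of_nonneg _ _ ENNReal.toReal_nonneg]
  congr 1
  rw [← ofReal_norm, Complex.norm_real, sqrtDensity, Real.norm_of_nonneg (Real.sqrt_nonneg _),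
    ENNReal.ofReal_rpow_of_nonneg (Real.sqrt_nonneg _) ENNReal.toReal_nonneg, ENNReal.toReal_ofNat,
    Real.rpow_two, Real.sq_sqrt ENNReal.toReal_nonneg, ENNReal.ofReal_toReal hω.ne]

/-- The weighted translation `ψ ↦ √ρ_{g⁻¹} ψ(g⁻¹ ·)`. -/
lemma IsQuasiInvariant.exists_translation_Lp (g : G) (E : Type*) [NormedAddCommGroup E]
    [InnerProductSpace ℂ E] : ∃ V : Lp E 2 ν →ₗᵢ[ℂ] Lp E 2 ν, ∀ ψ, ∀ᵐ ω ∂ν,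
      V ψ ω = (sqrtDensity ν g ω : ℂ) • ψ (g⁻¹ • ω) := by
  have hmeas : ∀ ψ : Lp E 2 ν, MemLp (fun ω => (sqrtDensity ν g ω : ℂ) • ψ (g⁻¹ • ω)) 2 ν := by
    intro ψ
    refine ⟨?_, ?_⟩
    · exact (Complex.measurable_ofReal.comp (measurable_sqrtDensity g)).aestronglyMeasurable.smul
        ((Lp.aestronglyMeasurable _).comp_quasiMeasurePreserving (hν.quasiMeasurePreserving g⁻¹))
    · rw [hν.eLpNorm_translate g (Lp.aestronglyMeasurable _)]
      exact (Lp.memLp _).2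
  have hex : ∀ ψ : Lp E 2 ν, ∃ φ : Lp E 2 ν, ∀ᵐ ω ∂ν,
      φ ω = (sqrtDensity ν g ω : ℂ) • ψ (g⁻¹ • ω) := fun ψ => ⟨(hmeas ψ).toLp, (hmeas ψ).coeFn_toLp⟩
  choose V hV using hex
  refine ⟨⟨⟨⟨V, fun φ ψ => Lp.ext ?_⟩, fun c ψ => Lp.ext ?_⟩, fun ψ => ?_⟩, hV⟩
  · filter_upwards [hV φ, hV ψ, hV (φ + ψ), Lp.coeFn_add (V φ) (V ψ),
      hν.ae_smul g⁻¹ (Lp.coeFn_add φ ψ)] with ω h1 h2 h3 h4 h5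
    rw [h3, h4, Pi.add_apply, h1, h2, h5, Pi.add_apply, smul_add]
  · filter_upwards [hV ψ, hV (c • ψ), Lp.coeFn_smul c (V ψ),
      hν.ae_smul g⁻¹ (Lp.coeFn_smul c ψ)] with ω h1 h2 h3 h4
    show V (c • ψ) ω = (c • V ψ : Lp E 2 ν) ω
    rw [h2, h3, Pi.smul_apply, h1, h4, Pi.smul_apply, smul_comm]
  · show ‖V ψ‖ = ‖ψ‖
    rw [Lp.norm_def, Lp.norm_def, eLpNorm_congr_ae (hV ψ),
      hν.eLpNorm_translate g (Lp.aestronglyMeasurable _)]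

/-- The vector at ω comes from the fibre at g⁻¹ω, so the multiplicity function is translated as
well. The invariance of n, still to be proved, is not needed in this form. -/
lemma IsQuasiInvariant.exists_translation {n n' : Ω → ℕ∞} (g : G) (hn : ∀ ω, n' ω = n (g⁻¹ • ω)) :
    ∃ V : DirectIntegral ν n →ₗᵢ[ℂ] DirectIntegral ν n', ∀ ψ, ∀ᵐ ω ∂ν,
      V ψ ω = (sqrtDensity ν g ω : ℂ) • ψ (g⁻¹ • ω) := by
  obtain ⟨V, hV⟩ := hν.exists_translation_Lp g Ell2
  have hmem : ∀ ψ ∈ fiberwise ν n, V ψ ∈ fiberwise ν n' := fun ψ hψ => by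
    show ∀ᵐ ω ∂ν, V ψ ω ∈ fiber (n' ω)
    filter_upwards [hν.ae_smul g⁻¹ hψ, hV ψ] with ω h h'
    rw [hn, h']
    exact Submodule.smul_mem _ _ h
  exact ⟨⟨V.toLinearMap.restrict (p := fiberwise ν n) (q := fiberwise ν n') hmem,
    fun ψ => V.norm_map ψ.1⟩, fun ψ => hV ψ.1⟩

end Translation

/-! ### Comparison of the dimensions of fibres -/

section Fiber

/-- If l < k then l is finite, and the first l + 1 basis vectors of H_k would have independent
images in a space of dimension l. -/
lemma le_of_injective_fiber {k l : ℕ∞} (f : fiber k →ₗ[ℂ] fiber l) (hf : Function.Injective f) :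
    k ≤ l := by
  by_contra! h
  obtain ⟨l, rfl⟩ := ENat.ne_top_iff_exists.1 (ne_top_of_lt h)
  have hmem : ∀ i : Fin (l + 1), (lp.single 2 (i : ℕ) (1 : ℂ) : Ell2) ∈ fiber k := by
    intro i j hj
    have hij : j ≠ i := by
      rintro rfl
      have h1 : ((i : ℕ) : ℕ∞) ≤ l := by exact_mod_cast Nat.lt_succ_iff.1 i.2
      exact absurd (hj.trans h1) (not_le.2 h)
    rw [lp.single_apply, Pi.single_eq_of_ne hij]
  set e : Fin (l + 1) → fiber k := fun i => ⟨_, hmem i⟩ with he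
  have hind : LinearIndependent ℂ e := by
    rw [Fintype.linearIndependent_iff]
    intro c hc i
    have h1 := congrArg (fun x : fiber k => (x : Ell2) (i : ℕ)) hc
    simp only [Submodule.coe_sum, Submodule.coe_smul, he, lp.coeFn_sum, Finset.sum_apply,
      lp.coeFn_smul, Pi.smul_apply, lp.single_apply, Pi.single_apply, ZeroMemClass.coe_zero,
      Fin.val_inj] at h1
    simpa using h1
  set r : fiber (l : ℕ∞) →ₗ[ℂ] (Fin l → ℂ) :=
    { toFun := fun x i => (x : Ell2) (i : ℕ)
      map_add' := fun x y => rfl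
      map_smul' := fun c x => rfl } with hr
  have hrinj : Function.Injective r := by
    refine (injective_iff_map_eq_zero r).2 fun x hx => Subtype.ext (lp.ext (funext fun i => ?_))
    by_cases hi : i < l
    · exact congrFun hx ⟨i, hi⟩
    · exact x.2 i (by exact_mod_cast not_lt.1 hi)
  have := (hind.map' (r ∘ₗ f) (LinearMap.ker_eq_bot.2 (hrinj.comp hf))).fintype_card_le_finrank
  simp at this

/-- On H_k the operator a*a is the identity, so a is injective there, and it takes values in H_l. -/
lemma le_of_star_mul_self_eq {k l : ℕ∞} {a : Ell2 →L[ℂ] Ell2} (h : star a * a = fiberProj k)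
    (h' : fiberProj l * a = a) : k ≤ l := by
  refine le_of_injective_fiber ((a.toLinearMap ∘ₗ (fiber k).subtype).codRestrict (fiber l) fun x => ?_)
    ((injective_iff_map_eq_zero _).2 fun x hx => ?_)
  · show a x ∈ fiber l
    rw [← h']
    exact fiberProj_mem _ _
  · have h1 : a x = 0 := congrArg Subtype.val hx
    refine Subtype.ext ?_
    rw [← fiberProj_eq_self x.2, ← h, mul_apply_eq_comp, h1, map_zero]
    rfl

lemma mul_fiberProj_of_star_mul_self {k : ℕ∞} {E : Type*} [NormedAddCommGroup E]
    [InnerProductSpace ℂ E] [CompleteSpace E] {a : Ell2 →L[ℂ] E} (h : a† ∘L a = fiberProj k) :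
    a ∘L fiberProj k = a := by
  refine ContinuousLinearMap.ext fun x => ?_
  rw [← sub_eq_zero, ContinuousLinearMap.comp_apply, ← map_sub, ← inner_self_eq_zero (𝕜 := ℂ),
    ← ContinuousLinearMap.adjoint_inner_right, ← ContinuousLinearMap.comp_apply, h, map_sub,
    ← mul_apply_eq_comp, fiberProj_mul_self, sub_self, inner_zero_right]

end Fiber

/-! ### Unitary operators implementing a translation, and their cocycles -/

section Implemented

variable {Ω : Type*} [MeasurableSpace Ω] {ν : Measure Ω} {G : Type*} [Group G] [MulAction G Ω]
  [MeasurableConstSMul G Ω] (hν : IsQuasiInvariant ν G) {n : Ω → ℕ∞}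

lemma IsImplementedBy.comp_diagOp {g : G} {a : Ω → (Ell2 →L[ℂ] Ell2)}
    {T : DirectIntegral ν n →L[ℂ] DirectIntegral ν n} (hT : IsImplementedBy ν g a T)
    (f : Lp ℂ ∞ ν) (ψ : DirectIntegral ν n) :
    T (diagOp f ψ) = diagOp (translate hν g f) (T ψ) := by
  refine DirectIntegral.ext ?_
  filter_upwards [hT ψ, hT (diagOp f ψ), hν.ae_smul g⁻¹ (coeFn_diagOp f ψ),
    coeFn_diagOp (translate hν g f) (T ψ), coeFn_translate hν g f] with ω h1 h2 h3 h4 h5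
  rw [h2, h3, h4, h5, h1, map_smul, smul_comm]

include hν

/-- Fields of operators are determined by their action on translated vectors. -/
lemma IsQuasiInvariant.ae_comp_fiberProj_eq [SigmaFinite ν] (hn : AEMeasurable n ν) (g : G)
    (hinv : ∀ᵐ ω ∂ν, n (g • ω) = n ω) {E : Type*} [NormedAddCommGroup E] [InnerProductSpace ℂ E]
    {A B : Ω → (Ell2 →L[ℂ] E)}
    (h : ∀ ψ : DirectIntegral ν n, ∀ᵐ ω ∂ν, A ω (ψ (g⁻¹ • ω)) = B ω (ψ (g⁻¹ • ω))) :
    ∀ᵐ ω ∂ν, A ω ∘L fiberProj (n ω) = B ω ∘L fiberProj (n ω) := by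
  refine hν.ae_of_ae_smul g ?_
  have := CovariantCP.ae_comp_fiberProj_eq hn (A := fun ω => A (g • ω)) (B := fun ω => B (g • ω))
    fun ψ => by
      filter_upwards [hν.ae_smul g (h ψ)] with ω hω
      rwa [inv_smul_smul] at hω
  filter_upwards [this, hinv] with ω h1 h2
  rw [h2, h1]

/-- A unitary operator which implements a translation of `L^∞(ν)` is given by a field of
unitary operators. -/
theorem IsQuasiInvariant.exists_unitaryField [SigmaFinite ν] (hn : AEMeasurable n ν) (g : G)
    (T : unitary (DirectIntegral ν n →L[ℂ] DirectIntegral ν n))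
    (hT : ∀ f ψ, (T : DirectIntegral ν n →L[ℂ] DirectIntegral ν n) (diagOp f ψ) =
      diagOp (translate hν g f) ((T : DirectIntegral ν n →L[ℂ] DirectIntegral ν n) ψ)) :
    (∀ᵐ ω ∂ν, n (g • ω) = n ω) ∧ ∃ a : Ω → (Ell2 →L[ℂ] Ell2), IsUnitaryField ν n a ∧
      IsImplementedBy ν g a (T : DirectIntegral ν n →L[ℂ] DirectIntegral ν n) := by
  -- With V the translation by g⁻¹ from multiplicity n' to n, the operator T V commutes with L^∞(ν)
  -- and is therefore decomposable, with fibres H_{n'(ω)} → H_{n(ω)}. The same holds for its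
  -- inverse.
  set n' : Ω → ℕ∞ := fun ω => n (g⁻¹ • ω) with hn'
  have hnm' : AEMeasurable n' ν := hn.comp_quasiMeasurePreserving (hν.quasiMeasurePreserving g⁻¹)
  obtain ⟨V, hV⟩ := hν.exists_translation (n := n') (n' := n) g⁻¹ fun ω => by
    simp only [hn', inv_inv, inv_smul_smul]
  obtain ⟨V', hV'⟩ := hν.exists_translation (n := n) (n' := n') g fun ω => rfl
  have hVV' : ∀ ψ, V (V' ψ) = ψ := fun ψ => DirectIntegral.ext <| by
    filter_upwards [hV (V' ψ), hν.ae_smul g⁻¹⁻¹ (hV' ψ), hν.sqrtDensity_mul_inv g⁻¹] with ω h1 h2 h3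
    rw [inv_inv] at h3
    rw [h1, h2, inv_inv, inv_smul_smul, smul_smul, ← Complex.ofReal_mul, h3, Complex.ofReal_one, one_smul]
  have hV'V : ∀ φ, V' (V φ) = φ := fun φ => V.injective (hVV' (V φ))
  have hVf : ∀ f φ, V (diagOp f φ) = diagOp (translate hν g⁻¹ f) (V φ) := fun f φ =>
    DirectIntegral.ext <| by
      filter_upwards [hV φ, hV (diagOp f φ), hν.ae_smul g⁻¹⁻¹ (coeFn_diagOp f φ),
        coeFn_diagOp (translate hν g⁻¹ f) (V φ), coeFn_translate hν g⁻¹ f] with ω h1 h2 h3 h4 h5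
      rw [h2, h3, h4, h5, h1, smul_comm]
  set T₁ : DirectIntegral ν n →L[ℂ] DirectIntegral ν n := T.1 with hT₁
  set T₂ : DirectIntegral ν n →L[ℂ] DirectIntegral ν n := star T₁ with hT₂
  have h12 : ∀ ψ, T₁ (T₂ ψ) = ψ := fun ψ => by
    rw [← mul_apply_eq_comp, hT₂, hT₁, Unitary.mul_star_self_of_mem T.2, one_apply_eq_self]
  have h21 : ∀ ψ, T₂ (T₁ ψ) = ψ := fun ψ => by
    rw [← mul_apply_eq_comp, hT₂, hT₁, Unitary.star_mul_self_of_mem T.2, one_apply_eq_self]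
  have hnorm₁ : ∀ ψ, ‖T₁ ψ‖ = ‖ψ‖ := fun ψ => by
    rw [← sq_eq_sq₀ (norm_nonneg _) (norm_nonneg _)]
    have : ⟪T₁ ψ, T₁ ψ⟫_ℂ = ⟪ψ, ψ⟫_ℂ := by
      rw [← ContinuousLinearMap.adjoint_inner_right, ← ContinuousLinearMap.star_eq_adjoint,
        ← hT₂, h21]
    rw [inner_self_eq_ofReal, inner_self_eq_ofReal] at this
    exact Complex.ofReal_injective this
  have hnorm₂ : ∀ ψ, ‖T₂ ψ‖ = ‖ψ‖ := fun ψ => by rw [← hnorm₁, h12]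
  have hT₂f : ∀ f ψ, T₂ (diagOp f ψ) = diagOp (translate hν g⁻¹ f) (T₂ ψ) := fun f ψ => by
    rw [← h21 (diagOp _ (T₂ ψ)), hT, translate_translate_inv, h12]
  obtain ⟨a, ha, ha1, ha2, ha3⟩ := exists_isometry_field hnm'
    (DirectIntegral.toLp.comp ((⟨T₁.toLinearMap, hnorm₁⟩ :
      DirectIntegral ν n →ₗᵢ[ℂ] DirectIntegral ν n).comp V)) (fun f φ => by
        show DirectIntegral.toLp (T₁ (V (diagOp f φ))) = mulOp ν f (DirectIntegral.toLp (T₁ (V φ)))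
        rw [hVf, hT, translate_translate_inv, toLp_diagOp])
  obtain ⟨a', -, ha1', ha2', ha3'⟩ := exists_isometry_field hn
    (DirectIntegral.toLp.comp (V'.comp (⟨T₂.toLinearMap, hnorm₂⟩ :
      DirectIntegral ν n →ₗᵢ[ℂ] DirectIntegral ν n))) (fun f ψ => by
        show DirectIntegral.toLp (V' (T₂ (diagOp f ψ))) = mulOp ν f (DirectIntegral.toLp (V' (T₂ ψ)))
        rw [← toLp_diagOp]
        congr 1
        apply V.injective
        rw [hVV', hVf, hVV', hT₂f])
  have haT : ∀ φ : DirectIntegral ν n', ∀ᵐ ω ∂ν, T₁ (V φ) ω = a ω (φ ω) := ha3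
  have haT' : ∀ ψ : DirectIntegral ν n, ∀ᵐ ω ∂ν, V' (T₂ ψ) ω = a' ω (ψ ω) := ha3'
  have haa' : ∀ᵐ ω ∂ν, (a ω * a' ω) ∘L fiberProj (n ω) = 1 ∘L fiberProj (n ω) :=
    CovariantCP.ae_comp_fiberProj_eq (B := fun _ => 1) hn fun ψ => by
      filter_upwards [haT (V' (T₂ ψ)), haT' ψ] with ω h1 h2
      rw [mul_apply_eq_comp, ← h2, ← h1, hVV', h12, one_apply_eq_self]
  have ha'a : ∀ᵐ ω ∂ν, (a' ω * a ω) ∘L fiberProj (n' ω) = 1 ∘L fiberProj (n' ω) :=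
    CovariantCP.ae_comp_fiberProj_eq (B := fun _ => 1) hnm' fun φ => by
      filter_upwards [haT' (T₁ (V φ)), haT φ] with ω h1 h2
      rw [mul_apply_eq_comp, ← h2, ← h1, h21, hV'V, one_apply_eq_self]
  have hgood : ∀ᵐ ω ∂ν, n' ω = n ω ∧ star (a ω) * a ω = fiberProj (n ω) ∧
      a ω * star (a ω) = fiberProj (n ω) := by
    filter_upwards [haa', ha'a, ha1, ha1'] with ω h1 h2 h3 h4
    have h3' : star (a ω) * a ω = fiberProj (n' ω) := h3
    have h4' : star (a' ω) * a' ω = fiberProj (n ω) := h4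
    have e1 : a ω * a' ω = fiberProj (n ω) := by
      have e := ha2' ω
      have : a ω * (a' ω * fiberProj (n ω)) = fiberProj (n ω) := by
        rw [← mul_assoc]
        exact h1
      rwa [show a' ω * fiberProj (n ω) = a' ω from e] at this
    have e2 : a' ω * a ω = fiberProj (n' ω) := by
      have e := ha2 ω
      have : a' ω * (a ω * fiberProj (n' ω)) = fiberProj (n' ω) := by
        rw [← mul_assoc]
        exact h2
      rwa [show a ω * fiberProj (n' ω) = a ω from e] at this
    have e3 : fiberProj (n ω) * a ω = a ω := by
      rw [← e1, mul_assoc, e2]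
      exact ha2 ω
    have e4 : fiberProj (n' ω) * a' ω = a' ω := by
      rw [← e2, mul_assoc, e1]
      exact ha2' ω
    -- The fibres of T V and of its inverse are isometries in opposite directions, so both
    -- inequalities between dimensions hold; this is the invariance of n.
    have hnn : n' ω = n ω := le_antisymm (le_of_star_mul_self_eq h3' e3)
      (le_of_star_mul_self_eq h4' e4)
    refine ⟨hnn, by rw [h3', hnn], ?_⟩
    have e5 : a' ω = star (a ω) := by
      rw [← e4, ← h3', mul_assoc, e1, ← star_fiberProj, ← star_mul, e3]
    rw [← e5, e1]
  refine ⟨hν.ae_of_ae_smul g⁻¹ ?_, ?_⟩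
  · filter_upwards [hgood] with ω hω
    rw [smul_inv_smul]
    exact hω.1.symm
  classical
  -- On the null set where unitarity fails the field is redefined as the projection onto the fibre,
  -- so that the unitarity relations hold at every ω.
  set p : Ω → Prop := fun ω => star (a ω) * a ω = fiberProj (n ω) ∧
      a ω * star (a ω) = fiberProj (n ω) with hp
  have hae : ∀ᵐ ω ∂ν, (if p ω then a ω else fiberProj (n ω)) = a ω :=
    hgood.mono fun ω hω => if_pos hω.2
  refine ⟨fun ω => if p ω then a ω else fiberProj (n ω), ⟨fun x z => ?_, fun ω => ?_, fun ω => ?_⟩,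
    fun ψ => ?_⟩
  · exact (ha x z).congr (hae.mono fun ω hω => congrArg (fun A : Ell2 →L[ℂ] Ell2 => ⟪z, A x⟫_ℂ) hω.symm)
  · split_ifs with h
    · exact h.1
    · rw [star_fiberProj, fiberProj_mul_self]
  · split_ifs with h
    · exact h.2
    · rw [star_fiberProj, fiberProj_mul_self]
  · filter_upwards [hae, haT (V' ψ), hV' ψ] with ω h1 h2 h3
    rw [h1, ← map_smul, ← h3, ← h2, hVV']

/-- The cocycle relation for the fields implementing a projective representation. -/
lemma IsQuasiInvariant.ae_cocycle [SigmaFinite ν] (hn : AEMeasurable n ν)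
    (hinv : ∀ g : G, ∀ᵐ ω ∂ν, n (g • ω) = n ω) {y : G → Ω → (Ell2 →L[ℂ] Ell2)}
    (hy : ∀ g, IsUnitaryField ν n (y g)) {T : G → (DirectIntegral ν n →L[ℂ] DirectIntegral ν n)}
    (hT : ∀ g, IsImplementedBy ν g (y g) (T g)) {g h : G} {z : ℂ}
    (hmul : T (g * h) = z • (T g * T h)) :
    ∀ᵐ ω ∂ν, y (g * h) ω = z • (y g ω * y h (g⁻¹ • ω)) := by
  have key : ∀ ψ : DirectIntegral ν n, ∀ᵐ ω ∂ν, y (g * h) ω (ψ ((g * h)⁻¹ • ω)) =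
      (z • (y g ω * y h (g⁻¹ • ω))) (ψ ((g * h)⁻¹ • ω)) := fun ψ => by
    filter_upwards [hT (g * h) ψ, hT g (T h ψ), hν.ae_smul g⁻¹ (hT h ψ), hν.sqrtDensity_mul g h,
      hν.sqrtDensity_ne_zero (g * h), Lp.coeFn_smul z (DirectIntegral.toLp (T g (T h ψ)))]
      with ω h1 h2 h3 h4 h5 h6
    have h7 : T (g * h) ψ ω = z • T g (T h ψ) ω := by
      rw [hmul]; exact h6
    rw [h1, h2, h3, h4, map_smul, smul_smul (sqrtDensity ν g ω : ℂ), ← Complex.ofReal_mul, ← h4,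
      smul_comm] at h7
    have h8 := smul_right_injective _ h5 h7
    rw [h8, smul_apply, mul_apply_eq_comp, mul_inv_rev, mul_smul]
  have hP : ∀ g ω, y g ω * fiberProj (n ω) = y g ω := fun g ω =>
    mul_fiberProj_of_star_mul_self ((hy g).star_mul ω)
  -- The projection onto H_{n(ω)} can be dropped on both sides; for the factor y(h, g⁻¹ω) this uses
  -- n(g⁻¹ω) = n(ω).
  filter_upwards [hν.ae_comp_fiberProj_eq hn (g * h) (hinv _) key, hinv g⁻¹] with ω h1 h2
  have h1' : y (g * h) ω * fiberProj (n ω) =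
    (z • (y g ω * y h (g⁻¹ • ω))) * fiberProj (n ω) := h1
  rw [hP, smul_mul_assoc, mul_assoc, ← h2, hP] at h1'
  exact h1'

end Implemented

/-! ### Covariance -/

section UnitaryRep

variable {E ι G : Type*} [NormedAddCommGroup E] [InnerProductSpace ℂ E] [CompleteSpace E] [Group G]

lemma ext_of_dense_span {E' : Type*} [NormedAddCommGroup E'] [InnerProductSpace ℂ E'] {a : ι → E}
    (ha : Dense (Submodule.span ℂ (Set.range a) : Set E)) {A B : E →L[ℂ] E'}
    (h : ∀ i, A (a i) = B (a i)) : A = B := by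
  refine ContinuousLinearMap.ext_on ha ?_
  rintro _ ⟨i, rfl⟩
  exact h i

/-- A group acting on a total family of vectors, leaving the inner products invariant, is
represented by unitary operators. -/
lemma exists_unitary_rep {a : ι → E} (ha : Dense (Submodule.span ℂ (Set.range a) : Set E))
    (σ : G → ι → ι) (hone : ∀ i, a (σ 1 i) = a i)
    (hmul : ∀ g h i, a (σ (g * h) i) = a (σ g (σ h i)))
    (hinner : ∀ g i j, ⟪a (σ g i), a (σ g j)⟫_ℂ = ⟪a i, a j⟫_ℂ) :
    ∃ W : G →* unitary (E →L[ℂ] E), ∀ g i, (W g : E →L[ℂ] E) (a i) = a (σ g i) := by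
  have h1 : ∀ g, ∃ T : E →ₗᵢ[ℂ] E, ∀ i, T (a i) = a (σ g i) := fun g =>
    exists_linearIsometry_of_inner_eq ha fun i j => (hinner g i j).symm
  choose T hT using h1
  have hTmul : ∀ g h, (T (g * h)).toContinuousLinearMap =
      (T g).toContinuousLinearMap * (T h).toContinuousLinearMap := fun g h =>
    ext_of_dense_span ha fun i => by
      show T (g * h) (a i) = T g (T h (a i))
      rw [hT, hT, hmul, ← hT g]
  have hTone : (T 1).toContinuousLinearMap = 1 := ext_of_dense_span ha fun i => by
    show T 1 (a i) = a i
    rw [hT, hone]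
  have hstar : ∀ g, star (T g).toContinuousLinearMap * (T g).toContinuousLinearMap = 1 := fun g =>
    ContinuousLinearMap.ext fun x => ext_inner_left ℂ fun y => by
      rw [mul_apply_eq_comp, ContinuousLinearMap.star_eq_adjoint,
        ContinuousLinearMap.adjoint_inner_right]
      exact (T g).inner_map_map y x
  -- The isometry for g⁻¹ is a right inverse, so the left inverse given by the adjoint is two-sided.
  have hinv : ∀ g, (T g).toContinuousLinearMap * (T g⁻¹).toContinuousLinearMap = 1 := fun g => by
    rw [← hTmul, mul_inv_cancel, hTone]
  have hstar' : ∀ g, (T g).toContinuousLinearMap * star (T g).toContinuousLinearMap = 1 := fun g => by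
    have : star (T g).toContinuousLinearMap = (T g⁻¹).toContinuousLinearMap :=
      left_inv_eq_right_inv (hstar g) (hinv g)
    rw [this, hinv]
  exact ⟨{ toFun := fun g => ⟨(T g).toContinuousLinearMap, hstar g, hstar' g⟩
           map_one' := Subtype.ext hTone
           map_mul' := fun g h => Subtype.ext (hTmul g h) }, hT⟩

end UnitaryRep

/-! ### The group law for translations of L^∞(ν) -/

section TranslateGroup

variable {Ω : Type*} [MeasurableSpace Ω] {ν : Measure Ω} {G : Type*} [Group G] [MulAction G Ω]
  [MeasurableConstSMul G Ω] (hν : IsQuasiInvariant ν G)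

lemma translate_one (f : Lp ℂ ∞ ν) : translate hν (1 : G) f = f := by
  refine Lp.ext ?_
  filter_upwards [coeFn_translate hν 1 f] with ω h1
  rw [h1, inv_one, one_smul]

lemma translate_mul (g h : G) (f : Lp ℂ ∞ ν) :
    translate hν (g * h) f = translate hν g (translate hν h f) := by
  refine Lp.ext ?_
  filter_upwards [coeFn_translate hν (g * h) f, coeFn_translate hν g (translate hν h f),
    hν.ae_smul g⁻¹ (coeFn_translate hν h f)] with ω h1 h2 h3
  rw [h1, h2, h3, mul_inv_rev, mul_smul]

end TranslateGroup

/-! ### Conjugation by a projective representation -/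

section Multiplier

variable {G K : Type*} [Group G] [NormedAddCommGroup K] [InnerProductSpace ℂ K] [CompleteSpace K]
  {m : G → G → Circle} {u : G → unitary (K →L[ℂ] K)}

/-- The phase m(g,h) cancels against its conjugate, so b ↦ u_g b u_g* is a genuine action although u
is only projective. -/
lemma IsMultiplierRep.conj_mul (hu : IsMultiplierRep m u) (g h : G) (b : K →L[ℂ] K) :
    (u (g * h) : K →L[ℂ] K) * b * star (u (g * h) : K →L[ℂ] K) =
      (u g : K →L[ℂ] K) * ((u h : K →L[ℂ] K) * b * star (u h : K →L[ℂ] K)) *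
        star (u g : K →L[ℂ] K) := by
  have hm : (m g h : ℂ) * star (m g h : ℂ) = 1 := by
    rw [Complex.star_def, Complex.mul_conj, Circle.normSq_coe, Complex.ofReal_one]
  rw [hu.map_mul, star_smul, star_mul, smul_mul_assoc, smul_mul_assoc, mul_smul_comm, smul_smul, hm,
    one_smul]
  simp only [mul_assoc]

lemma IsMultiplierRep.conj_one (hu : IsMultiplierRep m u) (b : K →L[ℂ] K) :
    (u 1 : K →L[ℂ] K) * b * star (u 1 : K →L[ℂ] K) = b := by
  rw [hu.map_one, OneMemClass.coe_one, star_one, one_mul, mul_one]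

end Multiplier

/-! ### Covariance of dilations of S -/

section Covariant

variable {Ω : Type u} [MeasurableSpace Ω] {ν : Measure Ω} {K : Type u} [NormedAddCommGroup K]
  [InnerProductSpace ℂ K] [CompleteSpace K]
  {H : Type u} {V : Type u} [NormedAddCommGroup H] [InnerProductSpace ℂ H] [CompleteSpace H]
  [AddCommGroup V] [Module ℂ V] [Module (H →L[ℂ] H)ᵐᵒᵖ V]
  {G : Type*} [Group G] [MulAction G Ω] [MeasurableConstSMul G Ω] {hν : IsQuasiInvariant ν G}
  {m : G → G → Circle} {u : G → unitary (K →L[ℂ] K)} {U : G →* (V ≃ₗ[(H →L[ℂ] H)ᵐᵒᵖ] V)}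
  {s₁ : V → V → (H →L[ℂ] H)} {S : tensorVN ν K →ₗ[ℂ] (V → V → (H →L[ℂ] H))} {n : Ω → ℕ∞}

lemma IsCovariantNCP.apply_translate (hS : IsCovariantNCP hν u U s₁ S) (g : G) (b : K →L[ℂ] K)
    (f : Lp ℂ ∞ ν) (v w : V) :
    S (elem ν ((u g : K →L[ℂ] K) * b * star (u g : K →L[ℂ] K)) (translate hν g f)) (U g v) (U g w) =
      S (elem ν b f) v w := by
  have h : ∀ v, U g⁻¹ (U g v) = v := fun v => by
    rw [← LinearEquiv.mul_apply, ← map_mul, inv_mul_cancel, map_one]; rfl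
  rw [hS.covariant, h, h]

lemma inner_opTensor_diagOp {Y : V →ₗ[ℂ] (H →L[ℂ] HilbertTensor K (DirectIntegral ν n))}
    (hY : ∀ (b : K →L[ℂ] K) (f : Lp ℂ ∞ ν) (v w : V),
      S (elem ν b f) v w = (Y v)† ∘L opTensor b (diagOp f) ∘L Y w)
    (b b' : K →L[ℂ] K) (f f' : Lp ℂ ∞ ν) (v v' : V) (h h' : H) :
    ⟪opTensor b (diagOp f) (Y v h), opTensor b' (diagOp f') (Y v' h')⟫_ℂ =
      ⟪h, S (elem ν (star b * b') (mulFn (star f) f')) v v' h'⟫_ℂ := by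
  rw [inner_opTensor_left, ← mul_apply_eq_comp, opTensor_mul, star_diagOp, ← diagOp_mulFn, hY,
    ContinuousLinearMap.comp_apply, ContinuousLinearMap.adjoint_inner_right]
  rfl

lemma IsCovariantNCP.apply_star_mul_translate (hS : IsCovariantNCP hν u U s₁ S) (g : G)
    (b b' : K →L[ℂ] K) (f f' : Lp ℂ ∞ ν) (v w : V) :
    S (elem ν (star ((u g : K →L[ℂ] K) * b * star (u g : K →L[ℂ] K)) *
      ((u g : K →L[ℂ] K) * b' * star (u g : K →L[ℂ] K)))
      (mulFn (star (translate hν g f)) (translate hν g f'))) (U g v) (U g w) =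
      S (elem ν (star b * b') (mulFn (star f) f')) v w := by
  have hb : star ((u g : K →L[ℂ] K) * b * star (u g : K →L[ℂ] K)) *
      ((u g : K →L[ℂ] K) * b' * star (u g : K →L[ℂ] K)) =
      (u g : K →L[ℂ] K) * (star b * b') * star (u g : K →L[ℂ] K) := by
    rw [star_mul, star_mul, star_star]
    simp only [mul_assoc]
    rw [← mul_assoc (star (u g : K →L[ℂ] K)) (u g : K →L[ℂ] K),
      Unitary.star_mul_self_of_mem (u g).2, one_mul]
  have hf : mulFn (star (translate hν g f)) (translate hν g f') =
      translate hν g (mulFn (star f) f') := by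
    rw [translate_mulFn, translate_star]
  exact (congrArg₂ (fun b f => S (elem ν b f) (U g v) (U g w)) hb hf).trans
    (hS.apply_translate g _ _ v w)

/-- G acts on the labels (b, f, v, h) of the total family, and covariance of S says that the Gram
matrix is invariant. -/
lemma exists_unitary_rep_of_isDilation (hu : IsMultiplierRep m u)
    (hS : IsCovariantNCP hν u U s₁ S)
    {Y : V →ₗ[ℂ] (H →L[ℂ] HilbertTensor K (DirectIntegral ν n))} (hY : IsDilation S diagOp Y) :
    ∃ W : G →* unitary (HilbertTensor K (DirectIntegral ν n) →L[ℂ]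
      HilbertTensor K (DirectIntegral ν n)), ∀ g b f v h, (W g).1 (opTensor b (diagOp f) (Y v h)) =
        opTensor ((u g : K →L[ℂ] K) * b * star (u g : K →L[ℂ] K)) (diagOp (translate hν g f))
          (Y (U g v) h) := by
  obtain ⟨W, hW⟩ := exists_unitary_rep hY.dense
    (fun (g : G) p => (((((u g : K →L[ℂ] K) * p.1.1.1 * star (u g : K →L[ℂ] K)),
      translate hν g p.1.1.2), U g p.1.2), p.2))
    (fun p => by
      dsimp only
      rw [hu.conj_one, translate_one, map_one]; rfl)
    (fun g h p => by
      dsimp only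
      rw [hu.conj_mul, translate_mul, map_mul, LinearEquiv.mul_apply])
    (fun g p q => by
      obtain ⟨⟨⟨b, f⟩, v⟩, h⟩ := p
      obtain ⟨⟨⟨b', f'⟩, v'⟩, h'⟩ := q
      refine (inner_opTensor_diagOp hY.dilates _ _ _ _ _ _ _ _).trans ?_
      refine Eq.trans ?_ (inner_opTensor_diagOp hY.dilates _ _ _ _ _ _ _ _).symm
      exact congrArg (fun A : H →L[ℂ] H => ⟪h, A h'⟫_ℂ)
        (hS.apply_star_mul_translate g b b' f f' v v'))
  exact ⟨W, fun g b f v h => hW g (((b, f), v), h)⟩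

/-- The covariance of a minimal dilation of `S` into a direct integral. -/
theorem exists_isCovariantDilation [SigmaFinite ν] [Nontrivial K] (hu : IsMultiplierRep m u)
    (hS : IsCovariantNCP hν u U s₁ S) (hn : AEMeasurable n ν)
    {Y : V →ₗ[ℂ] (H →L[ℂ] HilbertTensor K (DirectIntegral ν n))} (hY : IsDilation S diagOp Y) :
    ∃ (y : G → Ω → (Ell2 →L[ℂ] Ell2)) (T : G → unitary (DirectIntegral ν n →L[ℂ] DirectIntegral ν n)),
      IsCovariantDilation m u U S n Y y T := by
  have huu : ∀ g, star (u g : K →L[ℂ] K) * (u g : K →L[ℂ] K) = 1 := fun g =>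
    Unitary.star_mul_self_of_mem (u g).2
  have huu' : ∀ g, (u g : K →L[ℂ] K) * star (u g : K →L[ℂ] K) = 1 := fun g =>
    Unitary.mul_star_self_of_mem (u g).2
  obtain ⟨W, hW'⟩ := exists_unitary_rep_of_isDilation hu hS hY
  have hWm : ∀ g b f, (W g).1 * opTensor b (diagOp f) =
      opTensor ((u g : K →L[ℂ] K) * b * star (u g : K →L[ℂ] K)) (diagOp (translate hν g f)) *
        (W g).1 := fun g b f => ext_of_dense_span hY.dense fun p => by
    rw [mul_apply_eq_comp, mul_apply_eq_comp, ← mul_apply_eq_comp (opTensor b (diagOp f)),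
      opTensor_mul, ← diagOp_mulFn, hW', hW', ← mul_apply_eq_comp, opTensor_mul, ← diagOp_mulFn, ← translate_mulFn]
    congr 2
    simp only [mul_assoc]
    rw [← mul_assoc (star (u g : K →L[ℂ] K)) (u g : K →L[ℂ] K), huu, one_mul]
  have hWmul : ∀ g h, (W (g * h)).1 = (W g).1 * (W h).1 := fun g h => by rw [map_mul]; rfl
  -- Conjugation by W_g acts on b ⊗ 1 as conjugation by u_g, so (u_g* ⊗ 1)W_g commutes with L(K) ⊗ 1
  -- and comes from an operator on the multiplicity space.
  have hex : ∀ g, ∃ c : DirectIntegral ν n →L[ℂ] DirectIntegral ν n,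
      (W g).1 = opTensor (u g : K →L[ℂ] K) c := fun g => by
    obtain ⟨c, hc⟩ := exists_eq_opTensor_one
      (T := opTensor (star (u g : K →L[ℂ] K)) (1 : DirectIntegral ν n →L[ℂ] DirectIntegral ν n) *
        (W g).1) fun b => by
      have h1 := hWm g b (oneFn ν)
      rw [translate_oneFn, diagOp_oneFn] at h1
      rw [mul_assoc, h1, ← mul_assoc, ← mul_assoc, opTensor_mul, opTensor_mul, one_mul, ← mul_assoc,
        ← mul_assoc, huu, one_mul]
    refine ⟨c, ?_⟩
    have h2 := congrArg (fun A => opTensor (u g : K →L[ℂ] K)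
      (1 : DirectIntegral ν n →L[ℂ] DirectIntegral ν n) * A) hc
    rwa [← mul_assoc, opTensor_mul, opTensor_mul, huu', one_mul, one_mul, opTensor_one, one_mul,
      mul_one] at h2
  choose c hc using hex
  have hcancel : ∀ g (A B : DirectIntegral ν n →L[ℂ] DirectIntegral ν n),
      opTensor (u g : K →L[ℂ] K) A = opTensor (u g : K →L[ℂ] K) B → A = B := fun g A B h => by
    refine opTensor_one_injective (E := K) ?_
    have h2 := congrArg (fun C => opTensor (star (u g : K →L[ℂ] K))
      (1 : DirectIntegral ν n →L[ℂ] DirectIntegral ν n) * C) h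
    rwa [opTensor_mul, opTensor_mul, huu, one_mul, one_mul] at h2
  have hcu : ∀ g, c g ∈ unitary (DirectIntegral ν n →L[ℂ] DirectIntegral ν n) := fun g => by
    constructor
    · refine opTensor_one_injective (E := K) ?_
      have := Unitary.star_mul_self_of_mem (W g).2
      rw [hc, star_opTensor, opTensor_mul, huu] at this
      rw [this, opTensor_one]
    · refine opTensor_one_injective (E := K) ?_
      have := Unitary.mul_star_self_of_mem (W g).2
      rw [hc, star_opTensor, opTensor_mul, huu'] at this
      rw [this, opTensor_one]
  have hcf : ∀ g f ψ, c g (diagOp f ψ) = diagOp (translate hν g f) (c g ψ) := fun g f ψ => by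
    have h1 := hWm g 1 f
    rw [hc, opTensor_mul, opTensor_mul, mul_one, mul_assoc, huu, mul_one] at h1
    exact congrArg (fun A => A ψ) (hcancel g _ _ h1)
  -- W_g = u_g ⊗ c_g is multiplicative, so c must compensate the multiplier of u by its conjugate.
  have hcmul : ∀ g h, c (g * h) = conj (m g h : ℂ) • (c g * c h) := fun g h => by
    have h1 := hWmul g h
    have hm : conj (m g h : ℂ) * (m g h : ℂ) = 1 := by
      rw [mul_comm, Complex.mul_conj, Circle.normSq_coe, Complex.ofReal_one]
    refine hcancel (g * h) _ _ ?_
    rw [← hc, h1, hc, hc, opTensor_mul, hu.map_mul, opTensor_smul_left, opTensor_smul_right,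
      smul_smul, mul_comm, hm, one_smul]
  have hfield := fun g => hν.exists_unitaryField hn g ⟨c g, hcu g⟩ (hcf g)
  choose hinv y hy hyT using hfield
  refine ⟨y, fun g => ⟨c g, hcu g⟩, hn, hinv, hY.moduleMap, hY.dilates, ?_, hy, hyT, fun g v => ?_,
    fun g h => hν.ae_cocycle hn hinv hy (T := c) hyT (hcmul g h), fun g h => ?_⟩
  · refine sigmaStronglyDense_span_of_dense ?_ (hY.dense.mono ?_)
    · rintro _ ⟨b, f, v, rfl⟩ a
      exact ⟨b, f, MulOpposite.op a • v, by rw [hY.moduleMap, ContinuousLinearMap.comp_assoc]⟩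
    · refine SetLike.coe_subset_coe.2 (Submodule.span_mono ?_)
      rintro _ ⟨p, rfl⟩
      exact ⟨_, ⟨p.1.1.1, p.1.1.2, p.1.2, rfl⟩, p.2, rfl⟩
  · refine ContinuousLinearMap.ext fun h => ?_
    have h1 := hW' g 1 (oneFn ν) v h
    rw [mul_one, huu', translate_oneFn, diagOp_oneFn, opTensor_one, one_apply_eq_self,
      one_apply_eq_self, hc] at h1
    exact h1.symm
  · show opTensor _ (c (g * h)) = opTensor _ (c g) * opTensor _ (c h)
    rw [← hc, ← hc, ← hc, hWmul]

end Covariant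

/-! ### Disintegration of operators on `K ⊗ H_⊕` -/

section Disintegrate

variable {Ω : Type*} [MeasurableSpace Ω] {ν : Measure Ω} {n : Ω → ℕ∞} {K : Type*}
  [NormedAddCommGroup K] [InnerProductSpace ℂ K]

/-- `disintegrate` as a linear isometry. -/
def disintegrateₗᵢ : HilbertTensor K (DirectIntegral ν n) →ₗᵢ[ℂ] Lp (HilbertTensor K Ell2) 2 ν :=
  ⟨(disintegrate (ν := ν) (n := n) (K := K)).toLinearMap, norm_disintegrate⟩

lemma inner_disintegrate (z z' : HilbertTensor K (DirectIntegral ν n)) :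
    ⟪disintegrate z, disintegrate z'⟫_ℂ = ⟪z, z'⟫_ℂ :=
  disintegrateₗᵢ.inner_map_map z z'

lemma ae_disintegrate_apply {A : HilbertTensor K (DirectIntegral ν n) →L[ℂ]
      Lp (HilbertTensor K Ell2) 2 ν}
    (B : HilbertTensor K (DirectIntegral ν n) →L[ℂ] Lp (HilbertTensor K Ell2) 2 ν)
    {a : Ω → (HilbertTensor K Ell2 →L[ℂ] HilbertTensor K Ell2)}
    (h : ∀ x ψ, ∀ᵐ ω ∂ν, A (tmulL x ψ) ω = a ω (B (tmulL x ψ) ω))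
    (z : HilbertTensor K (DirectIntegral ν n)) : ∀ᵐ ω ∂ν, A z ω = a ω (B z ω) := by
  refine ae_apply_eq_of_dense A B dense_span_range_tmulL ?_ z
  rintro _ ⟨p, rfl⟩
  exact h _ _

lemma disintegrate_opTensor_diagOp (b : K →L[ℂ] K) (f : Lp ℂ ∞ ν)
    (z : HilbertTensor K (DirectIntegral ν n)) :
    ∀ᵐ ω ∂ν, disintegrate (opTensor b (diagOp f) z) ω = f ω • opTensor b 1 (disintegrate z ω) := by
  refine ae_disintegrate_apply (A := disintegrate ∘L opTensor b (diagOp f)) disintegrate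
    (a := fun ω => f ω • opTensor b 1) (fun x ψ => ?_) z
  rw [ContinuousLinearMap.comp_apply, opTensor_tmulL]
  filter_upwards [disintegrate_tmulL (b x) (diagOp f ψ), disintegrate_tmulL x ψ, coeFn_diagOp f ψ]
    with ω h1 h2 h3
  rw [h1, h2, h3, smul_apply, opTensor_tmulL, map_smul]
  rfl

lemma disintegrate_opTensor_one (b : K →L[ℂ] K) (z : HilbertTensor K (DirectIntegral ν n)) :
    ∀ᵐ ω ∂ν, disintegrate (opTensor b 1 z) ω = opTensor b 1 (disintegrate z ω) := by
  have := disintegrate_opTensor_diagOp b (oneFn ν) z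
  rw [diagOp_oneFn] at this
  filter_upwards [this, coeFn_oneFn (ν := ν)] with ω h1 h2
  rw [h1, h2, one_smul]

lemma disintegrate_one_opTensor (f : Lp ℂ ∞ ν) (z : HilbertTensor K (DirectIntegral ν n)) :
    disintegrate (opTensor 1 (diagOp f) z) = mulOp ν f (disintegrate z) := by
  refine Lp.ext ?_
  filter_upwards [disintegrate_opTensor_diagOp 1 f z, coeFn_mulOp ν f (disintegrate z)] with ω h1 h2
  rw [h1, h2, opTensor_one, one_apply_eq_self]

lemma disintegrate_mem_fiber (z : HilbertTensor K (DirectIntegral ν n)) :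
    ∀ᵐ ω ∂ν, disintegrate z ω = opTensor 1 (fiberProj (n ω)) (disintegrate z ω) := by
  refine ae_disintegrate_apply disintegrate (a := fun ω => opTensor 1 (fiberProj (n ω)))
    (fun x ψ => ?_) z
  filter_upwards [disintegrate_tmulL x ψ, ψ.mem_fiber] with ω h1 h2
  rw [h1, opTensor_tmulL, fiberProj_eq_self h2]
  rfl

/-- On elementary tensors this is the formula for T. The weighted translation is isometric on L²(ν;
K ⊗ ℓ²), which carries the identity over to all vectors. -/
lemma disintegrate_implemented [SigmaFinite ν] {G : Type*} [Group G] [MulAction G Ω]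
    [MeasurableConstSMul G Ω] (hν : IsQuasiInvariant ν G) {g : G} {a : Ω → (Ell2 →L[ℂ] Ell2)}
    {T : DirectIntegral ν n →L[ℂ] DirectIntegral ν n} (hT : IsImplementedBy ν g a T)
    (b : K →L[ℂ] K) (z : HilbertTensor K (DirectIntegral ν n)) :
    ∀ᵐ ω ∂ν, disintegrate (opTensor b T z) ω =
      (sqrtDensity ν g ω : ℂ) • opTensor b (a ω) (disintegrate z (g⁻¹ • ω)) := by
  obtain ⟨W, hW⟩ := hν.exists_translation_Lp g (HilbertTensor K Ell2)
  have h := ae_disintegrate_apply (A := disintegrate ∘L opTensor b T)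
    (W.toContinuousLinearMap ∘L disintegrate) (a := fun ω => opTensor b (a ω)) (fun x ψ => by
      rw [ContinuousLinearMap.comp_apply, opTensor_tmulL]
      filter_upwards [disintegrate_tmulL (b x) (T ψ), hν.ae_smul g⁻¹ (disintegrate_tmulL x ψ),
        hW (disintegrate (tmulL x ψ)), hT ψ] with ω h1 h2 h3 h4
      have h3' : (W.toContinuousLinearMap ∘L disintegrate) (tmulL x ψ) ω = _ := h3
      rw [h1, h3', h2, h4, map_smul, map_smul, opTensor_tmulL]) z
  filter_upwards [h, hW (disintegrate z)] with ω h1 h2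
  have h2' : (W.toContinuousLinearMap ∘L disintegrate) z ω = _ := h2
  rw [h2', map_smul] at h1
  exact h1

end Disintegrate

/-! ### The second marginal -/

section Marginal

variable {Ω : Type u} [MeasurableSpace Ω] {ν : Measure Ω} {K : Type u} [NormedAddCommGroup K]
  [InnerProductSpace ℂ K] [CompleteSpace K]
  {H : Type u} {V : Type u} [NormedAddCommGroup H] [InnerProductSpace ℂ H] [CompleteSpace H]
  [AddCommGroup V] [Module ℂ V] [Module (H →L[ℂ] H)ᵐᵒᵖ V]
  {S : tensorVN ν K →ₗ[ℂ] (V → V → (H →L[ℂ] H))} {n : Ω → ℕ∞}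

/-- `L` is a minimal dilation of the second marginal of `S` into a direct integral. -/
structure IsMarginalDilation (S : tensorVN ν K →ₗ[ℂ] (V → V → (H →L[ℂ] H)))
    (L : V →ₗ[ℂ] (H →L[ℂ] DirectIntegral ν n)) : Prop where
  moduleMap : IsModuleMap L
  dilates : ∀ (f : Lp ℂ ∞ ν) (v w : V), S (elem ν 1 f) v w = (L v)† ∘L diagOp f ∘L L w
  dense : Dense (Submodule.span ℂ (Set.range fun p : (Lp ℂ ∞ ν × V) × H =>
    diagOp p.1.1 (L p.1.2 p.2)) : Set (DirectIntegral ν n))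

/-- The restriction of `1 ⊗ L^∞(ν)` to a separable invariant subspace is a direct integral. -/
lemma exists_directIntegral_of_invariant [TopologicalSpace.SeparableSpace K]
    [TopologicalSpace.SeparableSpace (DirectIntegral ν n)]
    (Z : Submodule ℂ (HilbertTensor K (DirectIntegral ν n))) [CompleteSpace Z]
    (hZ : ∀ f, ∀ z ∈ Z, opTensor 1 (diagOp f) z ∈ Z) :
    ∃ n₀ : Ω → ℕ∞, Measurable n₀ ∧ ∃ W : Z ≃ₗᵢ[ℂ] DirectIntegral ν n₀,
      ∀ f (z : Z), W ⟨_, hZ f z z.2⟩ = diagOp f (W z) := by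
  set ϖ : Lp ℂ ∞ ν → (Z →L[ℂ] Z) := fun f =>
    (opTensor 1 (diagOp f)).restrict (p := Z) (q := Z) (hZ f) with hϖ
  have hval : ∀ f (z : Z), ((ϖ f z : Z) : HilbertTensor K (DirectIntegral ν n)) =
    opTensor 1 (diagOp f) z := fun f z => rfl
  obtain ⟨n₀, hn₀, W, hW⟩ := exists_directIntegral_equiv ϖ
    (fun f g => ContinuousLinearMap.ext fun z => Subtype.ext (by
      rw [mul_apply_eq_comp, hval, hval, hval, ← mul_apply_eq_comp, opTensor_mul, one_mul,
        diagOp_mulFn]))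
    (fun f => ContinuousLinearMap.ext fun z => ext_inner_left ℂ fun z' => by
      rw [ContinuousLinearMap.star_eq_adjoint, ContinuousLinearMap.adjoint_inner_right,
        Submodule.coe_inner, Submodule.coe_inner, hval, hval, inner_opTensor_left, star_one,
        star_diagOp])
    (ContinuousLinearMap.ext fun z => Subtype.ext (by
      rw [hval, diagOp_oneFn, opTensor_one]; rfl))
    (fun z => by
      -- Inside the disintegrated space the density of a vector is explicit: its pointwise squared
      -- norm.
      refine ⟨fun ω => ‖disintegrate z.1 ω‖ ^ 2,
        ((Lp.stronglyMeasurable _).norm.pow 2).measurable, fun ω => sq_nonneg _,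
        integrable_norm_sq _, fun f => ?_⟩
      rw [Submodule.coe_inner, hval, ← inner_disintegrate, disintegrate_one_opTensor, L2.inner_def]
      refine integral_congr_ae ?_
      filter_upwards [coeFn_mulOp ν f (disintegrate z.1)] with ω h1
      rw [h1, inner_smul_right, inner_self_eq_ofReal])
  exact ⟨n₀, hn₀, W, fun f z => hW f z⟩

lemma dilates_of_isometry {Y : V →ₗ[ℂ] (H →L[ℂ] HilbertTensor K (DirectIntegral ν n))}
    (hY : ∀ (f : Lp ℂ ∞ ν) (v w : V), S (elem ν 1 f) v w =
      (Y v)† ∘L opTensor 1 (diagOp f) ∘L Y w) {n₀ : Ω → ℕ∞}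
    {L : V →ₗ[ℂ] (H →L[ℂ] DirectIntegral ν n₀)}
    (j : DirectIntegral ν n₀ →ₗᵢ[ℂ] HilbertTensor K (DirectIntegral ν n))
    (hj : ∀ v h, j (L v h) = Y v h) (hjf : ∀ f φ, j (diagOp f φ) = opTensor 1 (diagOp f) (j φ))
    (f : Lp ℂ ∞ ν) (v w : V) : S (elem ν 1 f) v w = (L v)† ∘L diagOp f ∘L L w := by
  rw [hY]
  refine ContinuousLinearMap.ext fun h => ext_inner_left ℂ fun h' => ?_
  rw [ContinuousLinearMap.comp_apply, ContinuousLinearMap.comp_apply,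
    ContinuousLinearMap.adjoint_inner_right, ContinuousLinearMap.comp_apply,
    ContinuousLinearMap.comp_apply, ContinuousLinearMap.adjoint_inner_right,
    ← j.inner_map_map, hjf, hj, hj]

/-- The second marginal has a minimal dilation into a direct integral. -/
theorem exists_isMarginalDilation [TopologicalSpace.SeparableSpace K]
    [TopologicalSpace.SeparableSpace (DirectIntegral ν n)]
    {Y : V →ₗ[ℂ] (H →L[ℂ] HilbertTensor K (DirectIntegral ν n))} (hY : IsDilation S diagOp Y) :
    ∃ n₀ : Ω → ℕ∞, Measurable n₀ ∧ ∃ L : V →ₗ[ℂ] (H →L[ℂ] DirectIntegral ν n₀),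
      IsMarginalDilation S L := by
  -- The subspace generated by the vectors (Yv)h under 1 ⊗ L^∞(ν); its closure carries the minimal
  -- dilation of the marginal and is separable because K ⊗ H_⊕ is.
  set N : Submodule ℂ (HilbertTensor K (DirectIntegral ν n)) := Submodule.span ℂ
    (Set.range fun p : (Lp ℂ ∞ ν × V) × H => opTensor 1 (diagOp p.1.1) (Y p.1.2 p.2)) with hN
  have hc : CompleteSpace N.topologicalClosure :=
    N.isClosed_topologicalClosure.completeSpace_coe
  have hgen : ∀ f v h, opTensor 1 (diagOp f) (Y v h) ∈ N := fun f v h =>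
    Submodule.subset_span ⟨((f, v), h), rfl⟩
  have hinv : ∀ f, ∀ z ∈ N, opTensor 1 (diagOp f) z ∈ N := fun f z hz => by
    induction hz using Submodule.span_induction with
    | mem z hz =>
      obtain ⟨p, rfl⟩ := hz
      dsimp only
      rw [← mul_apply_eq_comp, opTensor_mul, one_mul, ← diagOp_mulFn]
      exact hgen _ _ _
    | zero => rw [map_zero]; exact Submodule.zero_mem _
    | add z w _ _ h1 h2 => rw [map_add]; exact Submodule.add_mem _ h1 h2
    | smul c z _ h1 => rw [map_smul]; exact Submodule.smul_mem _ _ h1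
  have hinv' : ∀ f, ∀ z ∈ N.topologicalClosure, opTensor 1 (diagOp f) z ∈ N.topologicalClosure :=
    fun f z hz => map_mem_closure (ContinuousLinearMap.continuous _) hz (hinv f)
  obtain ⟨n₀, hn₀, W, hW⟩ := exists_directIntegral_of_invariant N.topologicalClosure hinv'
  have hYN : ∀ v h, Y v h ∈ N.topologicalClosure := fun v h => by
    refine N.le_topologicalClosure ?_
    have := hgen (oneFn ν) v h
    rwa [diagOp_oneFn, opTensor_one, one_apply_eq_self] at this
  set L : V →ₗ[ℂ] (H →L[ℂ] DirectIntegral ν n₀) :=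
    { toFun := fun v => W.toContinuousLinearEquiv.toContinuousLinearMap ∘L
        (Y v).codRestrict N.topologicalClosure (hYN v)
      map_add' := fun v w => ContinuousLinearMap.ext fun h => by
        show W ⟨Y (v + w) h, _⟩ = W ⟨Y v h, _⟩ + W ⟨Y w h, _⟩
        rw [← map_add]
        exact congrArg W (Subtype.ext (congrArg (fun A : H →L[ℂ] _ => A h) (map_add Y v w)))
      map_smul' := fun c v => ContinuousLinearMap.ext fun h => by
        show W ⟨Y (c • v) h, _⟩ = c • W ⟨Y v h, _⟩
        rw [← map_smul]
        exact congrArg W (Subtype.ext (congrArg (fun A : H →L[ℂ] _ => A h) (map_smul Y c v))) } with hL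
  have hLW : ∀ v h, L v h = W ⟨Y v h, hYN v h⟩ := fun v h => rfl
  have hLf : ∀ f v h, diagOp f (L v h) =
      W ⟨opTensor 1 (diagOp f) (Y v h), hinv' f _ (hYN v h)⟩ := fun f v h => (hW f ⟨_, hYN v h⟩).symm
  refine ⟨n₀, hn₀, L, fun a v => ?_, fun f v w => ?_, ?_⟩
  · refine ContinuousLinearMap.ext fun h => ?_
    rw [ContinuousLinearMap.comp_apply, hLW, hLW]
    exact congrArg W (Subtype.ext (congrArg (fun A : H →L[ℂ] _ => A h) (hY.moduleMap a v)))
  · refine dilates_of_isometry (hY.dilates 1)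
      (N.topologicalClosure.subtypeₗᵢ.comp W.symm.toLinearIsometry) (fun v h => ?_)
      (fun f φ => ?_) f v w
    · exact congrArg N.topologicalClosure.subtypeₗᵢ (W.symm_apply_apply _)
    · obtain ⟨z, rfl⟩ := W.surjective φ
      rw [← hW]
      exact (congrArg N.topologicalClosure.subtypeₗᵢ (W.symm_apply_apply _)).trans
        (congrArg (fun x : N.topologicalClosure => opTensor 1 (diagOp f)
          (x : HilbertTensor K (DirectIntegral ν n))) (W.symm_apply_apply z)).symm
  · refine dense_span_of_forall_inner_eq_zero fun x hx => ?_
    obtain ⟨z, rfl⟩ := W.surjective x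
    have hz : (z : HilbertTensor K (DirectIntegral ν n)) ∈ N.topologicalClosureᗮ := by
      rw [Submodule.orthogonal_closure, Submodule.mem_orthogonal]
      intro y hy
      induction hy using Submodule.span_induction with
      | mem y hy =>
        obtain ⟨p, rfl⟩ := hy
        have := hx _ ⟨p, rfl⟩
        dsimp only at this
        rwa [hLf, W.inner_map_map] at this
      | zero => rw [inner_zero_left]
      | add y w _ _ h1 h2 => rw [inner_add_left, h1, h2, add_zero]
      | smul c y _ h1 => rw [inner_smul_left, h1, mul_zero]
    have : z = 0 := Subtype.ext (inner_self_eq_zero.1 (hz _ z.2))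
    rw [this, map_zero]

variable {G : Type*} [Group G] [MulAction G Ω] [MeasurableConstSMul G Ω] {hν : IsQuasiInvariant ν G}
  {m : G → G → Circle} {u : G → unitary (K →L[ℂ] K)} {U : G →* (V ≃ₗ[(H →L[ℂ] H)ᵐᵒᵖ] V)}
  {s₁ : V → V → (H →L[ℂ] H)}

lemma IsMarginalDilation.inner_diagOp {L : V →ₗ[ℂ] (H →L[ℂ] DirectIntegral ν n)}
    (hL : IsMarginalDilation S L) (f f' : Lp ℂ ∞ ν) (v v' : V) (h h' : H) :
    ⟪diagOp f (L v h), diagOp f' (L v' h')⟫_ℂ =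
      ⟪h, S (elem ν 1 (mulFn (star f) f')) v v' h'⟫_ℂ := by
  rw [inner_diagOp_left, ← mul_apply_eq_comp, ← diagOp_mulFn, hL.dilates,
    ContinuousLinearMap.comp_apply, ContinuousLinearMap.adjoint_inner_right]
  rfl

lemma IsCovariantNCP.marginal_apply_translate (hS : IsCovariantNCP hν u U s₁ S) (g : G)
    (f f' : Lp ℂ ∞ ν) (v w : V) :
    S (elem ν 1 (mulFn (star (translate hν g f)) (translate hν g f'))) (U g v) (U g w) =
      S (elem ν 1 (mulFn (star f) f')) v w := by
  -- The identity of K is fixed by conjugation with u_g, so the marginal is covariant without u.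
  have hb : (1 : K →L[ℂ] K) = (u g : K →L[ℂ] K) * 1 * star (u g : K →L[ℂ] K) := by
    rw [mul_one, Unitary.mul_star_self_of_mem (u g).2]
  have hf : mulFn (star (translate hν g f)) (translate hν g f') =
      translate hν g (mulFn (star f) f') := by
    rw [translate_mulFn, translate_star]
  exact (congrArg₂ (fun b f => S (elem ν b f) (U g v) (U g w)) hb hf).trans
    (hS.apply_translate g _ _ v w)

lemma IsMarginalDilation.exists_unitary_rep (hS : IsCovariantNCP hν u U s₁ S)
    {L : V →ₗ[ℂ] (H →L[ℂ] DirectIntegral ν n)} (hL : IsMarginalDilation S L) :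
    ∃ T : G →* unitary (DirectIntegral ν n →L[ℂ] DirectIntegral ν n), ∀ g f v h,
      (T g).1 (diagOp f (L v h)) = diagOp (translate hν g f) (L (U g v) h) := by
  obtain ⟨W, hW⟩ := CovariantCP.exists_unitary_rep hL.dense
    (fun (g : G) p => ((translate hν g p.1.1, U g p.1.2), p.2))
    (fun p => by
      dsimp only
      rw [translate_one, map_one]; rfl)
    (fun g h p => by
      dsimp only
      rw [translate_mul, map_mul, LinearEquiv.mul_apply])
    (fun g p q => by
      obtain ⟨⟨f, v⟩, h⟩ := p
      obtain ⟨⟨f', v'⟩, h'⟩ := q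
      refine (hL.inner_diagOp _ _ _ _ _ _).trans ?_
      refine Eq.trans ?_ (hL.inner_diagOp _ _ _ _ _ _).symm
      exact congrArg (fun A : H →L[ℂ] H => ⟪h, A h'⟫_ℂ)
        (hS.marginal_apply_translate g f f' v v'))
  exact ⟨W, fun g f v h => hW g ((f, v), h)⟩

/-- The covariance of a minimal dilation of the second marginal into a direct integral. -/
theorem exists_isCovariantMarginalDilation [SigmaFinite ν] (hS : IsCovariantNCP hν u U s₁ S)
    (hn : AEMeasurable n ν) {L : V →ₗ[ℂ] (H →L[ℂ] DirectIntegral ν n)}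
    (hL : IsMarginalDilation S L) :
    ∃ (y : G → Ω → (Ell2 →L[ℂ] Ell2)) (T : G →* unitary (DirectIntegral ν n →L[ℂ] DirectIntegral ν n)),
      IsCovariantMarginalDilation U S n L y T := by
  obtain ⟨T, hT⟩ := hL.exists_unitary_rep hS
  have hTf : ∀ g f ψ, (T g).1 (diagOp f ψ) = diagOp (translate hν g f) ((T g).1 ψ) := fun g f ψ => by
    have : (T g).1 * diagOp f = diagOp (translate hν g f) * (T g).1 :=
      ext_of_dense_span hL.dense fun p => by
        rw [mul_apply_eq_comp, mul_apply_eq_comp, ← mul_apply_eq_comp (diagOp f), ← diagOp_mulFn, hT,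
          hT, ← mul_apply_eq_comp, ← diagOp_mulFn, ← translate_mulFn]
    exact congrArg (fun A => A ψ) this
  have hfield := fun g => hν.exists_unitaryField hn g (T g) (hTf g)
  choose hinv y hy hyT using hfield
  refine ⟨y, T, hn, hinv, hL.moduleMap, hL.dilates, ?_, hy, hyT, fun g v => ?_, fun g h => ?_⟩
  · refine sigmaStronglyDense_span_of_dense ?_ (hL.dense.mono ?_)
    · rintro _ ⟨f, v, rfl⟩ a
      exact ⟨f, MulOpposite.op a • v, by rw [hL.moduleMap, ContinuousLinearMap.comp_assoc]⟩
    · refine SetLike.coe_subset_coe.2 (Submodule.span_mono ?_)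
      rintro _ ⟨p, rfl⟩
      exact ⟨_, ⟨p.1.1, p.1.2, rfl⟩, p.2, rfl⟩
  · refine ContinuousLinearMap.ext fun h => ?_
    have h1 := hT g (oneFn ν) v h
    rw [translate_oneFn, diagOp_oneFn, one_apply_eq_self, one_apply_eq_self] at h1
    exact h1.symm
  · have := hν.ae_cocycle hn hinv hy (T := fun g => (T g).1) hyT (g := g) (h := h) (z := 1) (by
      rw [one_smul, map_mul]; rfl)
    simpa only [one_smul] using this

end Marginal

/-! ### The factorization -/

section Factor

variable {Ω : Type u} [MeasurableSpace Ω] {ν : Measure Ω} {K : Type u} [NormedAddCommGroup K]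
  [InnerProductSpace ℂ K] [CompleteSpace K]
  {H : Type u} {V : Type u} [NormedAddCommGroup H] [InnerProductSpace ℂ H] [CompleteSpace H]
  [AddCommGroup V] [Module ℂ V] [Module (H →L[ℂ] H)ᵐᵒᵖ V]
  {S : tensorVN ν K →ₗ[ℂ] (V → V → (H →L[ℂ] H))} {n n₀ : Ω → ℕ∞}
  {G : Type*} [Group G] [MulAction G Ω] [MeasurableConstSMul G Ω] (hν : IsQuasiInvariant ν G)
  {m : G → G → Circle} {u : G → unitary (K →L[ℂ] K)} {U : G →* (V ≃ₗ[(H →L[ℂ] H)ᵐᵒᵖ] V)}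
  {L : V →ₗ[ℂ] (H →L[ℂ] DirectIntegral ν n₀)} {y₀ : G → Ω → (Ell2 →L[ℂ] Ell2)}
  {T₀ : G →* unitary (DirectIntegral ν n₀ →L[ℂ] DirectIntegral ν n₀)}
  {Y : V →ₗ[ℂ] (H →L[ℂ] HilbertTensor K (DirectIntegral ν n))} {y : G → Ω → (Ell2 →L[ℂ] Ell2)}
  {T : G → unitary (DirectIntegral ν n →L[ℂ] DirectIntegral ν n)}
  {C : DirectIntegral ν n₀ →ₗᵢ[ℂ] HilbertTensor K (DirectIntegral ν n)}
  {c : Ω → (Ell2 →L[ℂ] HilbertTensor K Ell2)}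

include hν in
/-- A dilation of `S` factors through a minimal dilation of its second marginal. -/
theorem exists_factorization (hL : IsMarginalDilation S L)
    (hL' : IsCovariantMarginalDilation U S n₀ L y₀ T₀) (hY : IsCovariantDilation m u U S n Y y T) :
    ∃ C : DirectIntegral ν n₀ →ₗᵢ[ℂ] HilbertTensor K (DirectIntegral ν n),
      (∀ f φ, C (diagOp f φ) = opTensor 1 (diagOp f) (C φ)) ∧
      (∀ v, Y v = C.toContinuousLinearMap ∘L L v) ∧
      ∀ g φ, C ((T₀ g).1 φ) = opTensor (u g).1 (T g).1 (C φ) := by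
  -- Both Gram matrices are given by the values of S on 1 ⊗ f̄ f'.
  obtain ⟨C, hC⟩ := exists_linearIsometry_of_inner_eq hL.dense
    (b := fun p : (Lp ℂ ∞ ν × V) × H => opTensor 1 (diagOp p.1.1) (Y p.1.2 p.2)) (by
      rintro ⟨⟨f, v⟩, h⟩ ⟨⟨f', v'⟩, h'⟩
      refine (hL.inner_diagOp _ _ _ _ _ _).trans ?_
      refine Eq.trans ?_ (inner_opTensor_diagOp hY.dilates _ _ _ _ _ _ _ _).symm
      rw [star_one, one_mul])
  have hC' : ∀ f v h, C (diagOp f (L v h)) = opTensor 1 (diagOp f) (Y v h) := fun f v h =>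
    hC ((f, v), h)
  have hCf : ∀ f φ, C (diagOp f φ) = opTensor 1 (diagOp f) (C φ) := fun f φ => by
    have : C.toContinuousLinearMap ∘L diagOp f =
        opTensor 1 (diagOp f) ∘L C.toContinuousLinearMap := ext_of_dense_span hL.dense fun p => by
      show C (diagOp f (diagOp p.1.1 (L p.1.2 p.2))) =
        opTensor 1 (diagOp f) (C (diagOp p.1.1 (L p.1.2 p.2)))
      rw [← mul_apply_eq_comp, ← diagOp_mulFn, hC', hC', ← mul_apply_eq_comp, opTensor_mul, one_mul,
        diagOp_mulFn]
    exact congrArg (fun A => A φ) this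
  have hCL : ∀ v h, C (L v h) = Y v h := fun v h => by
    have := hC' (oneFn ν) v h
    rwa [diagOp_oneFn, diagOp_oneFn, opTensor_one, one_apply_eq_self, one_apply_eq_self] at this
  refine ⟨C, hCf, fun v => ContinuousLinearMap.ext fun h => (hCL v h).symm, fun g φ => ?_⟩
  have : C.toContinuousLinearMap ∘L (T₀ g).1 =
      opTensor (u g).1 (T g).1 ∘L C.toContinuousLinearMap := ext_of_dense_span hL.dense fun p => by
    show C ((T₀ g).1 (diagOp p.1.1 (L p.1.2 p.2))) =
      opTensor (u g).1 (T g).1 (C (diagOp p.1.1 (L p.1.2 p.2)))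
    have h1 : (T₀ g).1 (L p.1.2 p.2) = L (U g p.1.2) p.2 :=
      (congrArg (fun A : H →L[ℂ] _ => A p.2) (hL'.intertwines g p.1.2)).symm
    have h2 : opTensor (u g).1 (T g).1 (Y p.1.2 p.2) = Y (U g p.1.2) p.2 :=
      (congrArg (fun A : H →L[ℂ] _ => A p.2) (hY.intertwines g p.1.2)).symm
    have h3 : (T g).1 * diagOp p.1.1 = diagOp (translate hν g p.1.1) * (T g).1 :=
      ContinuousLinearMap.ext fun ψ => (hY.implemented g).comp_diagOp hν p.1.1 ψ
    have h4 := (hL'.implemented g).comp_diagOp hν p.1.1 (L p.1.2 p.2)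
    rw [h4, h1, hC', hC', ← h2, ← mul_apply_eq_comp, ← mul_apply_eq_comp, opTensor_mul, opTensor_mul,
      h3, one_mul, mul_one]
  exact congrArg (fun A => A φ) this

/-- Followed by the disintegration, C is an isometry commuting with L^∞(ν), hence decomposable.
Disintegrated vectors lie in K ⊗ H_{n(ω)}, which gives the range condition. -/
lemma exists_factorization_field [SigmaFinite ν] (hn₀ : AEMeasurable n₀ ν)
    (hC : ∀ f φ, C (diagOp f φ) = opTensor 1 (diagOp f) (C φ)) :
    ∃ c : Ω → (Ell2 →L[ℂ] HilbertTensor K Ell2), IsIsometryField ν n₀ n c ∧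
      (∀ ω, c ω ∘L fiberProj (n₀ ω) = c ω) ∧ ∀ φ, ∀ᵐ ω ∂ν, disintegrate (C φ) ω = c ω (φ ω) := by
  obtain ⟨c, hc, hcc, hcP, hcC⟩ := exists_isometry_field hn₀ (disintegrateₗᵢ.comp C) fun f φ => by
    show disintegrate (C (diagOp f φ)) = mulOp ν f (disintegrate (C φ))
    rw [hC, disintegrate_one_opTensor]
  have hcC' : ∀ φ, ∀ᵐ ω ∂ν, disintegrate (C φ) ω = c ω (φ ω) := hcC
  refine ⟨c, ⟨hc, hcc, ?_⟩, hcP, hcC'⟩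
  have := ae_comp_fiberProj_eq hn₀ (A := fun ω => opTensor 1 (fiberProj (n ω)) ∘L c ω) (B := c)
    fun φ => by
      filter_upwards [hcC' φ, disintegrate_mem_fiber (C φ)] with ω h1 h2
      rw [ContinuousLinearMap.comp_apply, ← h1, ← h2]
  filter_upwards [this] with ω h
  rwa [ContinuousLinearMap.comp_assoc, hcP] at h

include hν in
-- The relation C y⁰_g = (u_g ⊗ y_g) C is read at ω. The factor √ρ occurs on both sides and is
-- nonzero a.e., so it cancels; multiplying by the adjoint of y⁰(g,ω) on the right and replacing ω
-- by gω gives the formula.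
lemma ae_factorization_covariant [SigmaFinite ν] (hL' : IsCovariantMarginalDilation U S n₀ L y₀ T₀)
    (hY : IsCovariantDilation m u U S n Y y T) (hcP : ∀ ω, c ω ∘L fiberProj (n₀ ω) = c ω)
    (hcC : ∀ φ, ∀ᵐ ω ∂ν, disintegrate (C φ) ω = c ω (φ ω)) (g : G)
    (hT : ∀ φ, C ((T₀ g).1 φ) = opTensor (u g).1 (T g).1 (C φ)) :
    ∀ᵐ ω ∂ν, c (g • ω) = opTensor (u g).1 (y g (g • ω)) ∘L c ω ∘L star (y₀ g (g • ω)) := by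
  have key : ∀ φ : DirectIntegral ν n₀, ∀ᵐ ω ∂ν, (c ω ∘L y₀ g ω) (φ (g⁻¹ • ω)) =
      (opTensor (u g).1 (y g ω) ∘L c (g⁻¹ • ω)) (φ (g⁻¹ • ω)) := fun φ => by
    have h0 := disintegrate_implemented hν (hY.implemented g) (u g).1 (C φ)
    filter_upwards [hcC ((T₀ g).1 φ), hL'.implemented g φ, h0, hν.ae_smul g⁻¹ (hcC φ),
      hν.sqrtDensity_ne_zero g] with ω h1 h2 h3 h4 h5
    have h6 : disintegrate (C ((T₀ g).1 φ)) ω =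
        (sqrtDensity ν g ω : ℂ) • opTensor (u g).1 (y g ω) (disintegrate (C φ) (g⁻¹ • ω)) := by
      rw [hT]; exact h3
    rw [h1, h2, h4, map_smul] at h6
    exact smul_right_injective _ h5 h6
  have h1 := hν.ae_comp_fiberProj_eq hL'.measurable g (hL'.invariant g) key
  have h2 : ∀ᵐ ω ∂ν, c ω = opTensor (u g).1 (y g ω) ∘L c (g⁻¹ • ω) ∘L star (y₀ g ω) := by
    filter_upwards [h1, hL'.invariant g⁻¹] with ω h1 h2
    have h3 : y₀ g ω ∘L fiberProj (n₀ ω) = y₀ g ω :=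
      mul_fiberProj_of_star_mul_self ((hL'.unitaryField g).star_mul ω)
    rw [ContinuousLinearMap.comp_assoc, h3, ContinuousLinearMap.comp_assoc, ← h2, hcP] at h1
    have h4 : y₀ g ω ∘L star (y₀ g ω) = fiberProj (n₀ ω) := (hL'.unitaryField g).mul_star ω
    rw [← ContinuousLinearMap.comp_assoc, ← h1, ContinuousLinearMap.comp_assoc, h4, hcP]
  filter_upwards [hν.ae_smul g h2] with ω h
  rwa [inv_smul_smul] at h

/-! ### The channel -/

/-- Matrix elements of Φ(b) against all f̂ψ agree with integrals of fibrewise matrix elements, so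
they agree pointwise a.e. Countably many sections ψ, total in each fibre, then determine the vector
at ω. -/
lemma compression_apply_ae [SigmaFinite ν] (hn₀ : AEMeasurable n₀ ν)
    (hC : ∀ f φ, C (diagOp f φ) = opTensor 1 (diagOp f) (C φ))
    (hcP : ∀ ω, c ω ∘L fiberProj (n₀ ω) = c ω)
    (hcC : ∀ φ, ∀ᵐ ω ∂ν, disintegrate (C φ) ω = c ω (φ ω)) (b : K →L[ℂ] K)
    (φ : DirectIntegral ν n₀) :
    ∀ᵐ ω ∂ν, compression C.toContinuousLinearMap b φ ω = compression (c ω) b (φ ω) := by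
  have h1 : ∀ ψ : DirectIntegral ν n₀, ∀ᵐ ω ∂ν,
      ⟪ψ ω, compression C.toContinuousLinearMap b φ ω⟫_ℂ =
        ⟪ψ ω, compression (c ω) b (φ ω)⟫_ℂ := fun ψ => by
    have h2 := ae_inner_eq_inner (φ := DirectIntegral.toLp ψ)
      (ψ := DirectIntegral.toLp (compression C.toContinuousLinearMap b φ))
      (φ' := disintegrate (C ψ)) (ψ' := disintegrate (opTensor b 1 (C φ))) fun f => by
        rw [← toLp_diagOp, LinearIsometry.inner_map_map, inner_compression,
          ← disintegrate_one_opTensor, inner_disintegrate, ← hC]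
        rfl
    filter_upwards [h2, hcC ψ, hcC φ, disintegrate_opTensor_one b (C φ)] with ω h3 h4 h5 h6
    rw [h3, h4, h6, h5, inner_compression]
  obtain ⟨g, ψ, -, hg, hψ⟩ := exists_sections hn₀
  have hall : ∀ᵐ ω ∂ν, ∀ k, ⟪ψ (TopologicalSpace.denseSeq Ell2 k) ω,
      compression C.toContinuousLinearMap b φ ω⟫_ℂ =
      ⟪ψ (TopologicalSpace.denseSeq Ell2 k) ω, compression (c ω) b (φ ω)⟫_ℂ :=
    ae_all_iff.2 fun k => h1 _
  have hall' : ∀ᵐ ω ∂ν, ∀ k, ψ (TopologicalSpace.denseSeq Ell2 k) ω =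
      g ω • fiberProj (n₀ ω) (TopologicalSpace.denseSeq Ell2 k) := ae_all_iff.2 fun k => hψ _
  filter_upwards [hall, hall', (compression C.toContinuousLinearMap b φ).mem_fiber] with ω h2 h3 h4
  refine (TopologicalSpace.denseRange_denseSeq Ell2).eq_of_inner_right ℂ ?_
  intro k
  have h5 := h2 k
  rw [h3, inner_smul_left, inner_smul_left] at h5
  have h6 := mul_left_cancel₀ ((map_ne_zero _).2 (hg ω)) h5
  have h7 : ∀ x z, ⟪fiberProj (n₀ ω) x, z⟫_ℂ = ⟪x, fiberProj (n₀ ω) z⟫_ℂ := fun x z => by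
    rw [← ContinuousLinearMap.adjoint_inner_right, ← ContinuousLinearMap.star_eq_adjoint,
      star_fiberProj]
  rw [inner_compression, ← ContinuousLinearMap.comp_apply, hcP, ← inner_compression, h7,
    fiberProj_eq_self h4] at h6
  exact h6

lemma commute_compression (hC : ∀ f φ, C (diagOp f φ) = opTensor 1 (diagOp f) (C φ))
    (b : K →L[ℂ] K) (f : Lp ℂ ∞ ν) :
    Commute (compression C.toContinuousLinearMap b) (diagOp f) := by
  refine ContinuousLinearMap.ext fun φ => ext_inner_left ℂ fun ψ => ?_
  have h1 : ∀ f φ, C.toContinuousLinearMap (diagOp f φ) =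
    opTensor 1 (diagOp f) (C.toContinuousLinearMap φ) := hC
  have h2 := inner_diagOp_left (star f) ψ (compression C.toContinuousLinearMap b φ)
  rw [star_star] at h2
  rw [mul_apply_eq_comp, mul_apply_eq_comp, ← h2, inner_compression, inner_compression, h1, h1,
    inner_opTensor_left, star_one, star_diagOp, star_star, ← mul_apply_eq_comp, ← mul_apply_eq_comp,
    opTensor_mul, opTensor_mul, mul_one, one_mul, one_mul, mul_one]

lemma compression_covariant (g : G)
    (hT : ∀ φ, C ((T₀ g).1 φ) = opTensor (u g).1 (T g).1 (C φ)) (b : K →L[ℂ] K) :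
    star (T₀ g).1 * compression C.toContinuousLinearMap b * (T₀ g).1 =
      compression C.toContinuousLinearMap (star (u g).1 * b * (u g).1) := by
  refine ContinuousLinearMap.ext fun φ => ext_inner_left ℂ fun ψ => ?_
  have h1 : ∀ φ, C.toContinuousLinearMap ((T₀ g).1 φ) =
    opTensor (u g).1 (T g).1 (C.toContinuousLinearMap φ) := hT
  rw [mul_apply_eq_comp, mul_apply_eq_comp, ContinuousLinearMap.star_eq_adjoint,
    ContinuousLinearMap.adjoint_inner_right, inner_compression, inner_compression, h1, h1,
    inner_opTensor_left, ← mul_apply_eq_comp, ← mul_apply_eq_comp, opTensor_mul, opTensor_mul,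
    mul_one, Unitary.star_mul_self_of_mem (T g).2]

/-- A statement about two fixed points, so that the null set in the application does not depend on
b. Since y(g,ω')* y(g,ω') is only the projection onto the fibre, the range condition on c is what
removes it. -/
lemma compression_field_covariant {ω ω' : Ω} {g : G} (hcP : ∀ ω, c ω ∘L fiberProj (n₀ ω) = c ω)
    (hn : n ω' = n ω) (hn₀ : n₀ ω' = n₀ ω) (hy : IsUnitaryField ν n (y g))
    (hy₀ : IsUnitaryField ν n₀ (y₀ g)) (hr : opTensor 1 (fiberProj (n ω)) ∘L c ω = c ω)
    (h : c ω' = opTensor (u g).1 (y g ω') ∘L c ω ∘L star (y₀ g ω')) (b : K →L[ℂ] K) :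
    star (y₀ g ω') * compression (c ω') b * y₀ g ω' =
      compression (c ω) (star (u g).1 * b * (u g).1) := by
  have h1 : ∀ x, c ω' (y₀ g ω' x) = opTensor (u g).1 (y g ω') (c ω x) := fun x => by
    have h2 : star (y₀ g ω') (y₀ g ω' x) = fiberProj (n₀ ω) x := by
      rw [← mul_apply_eq_comp, hy₀.star_mul, hn₀]
    rw [h, ContinuousLinearMap.comp_apply, ContinuousLinearMap.comp_apply, h2,
      ← ContinuousLinearMap.comp_apply (c ω), hcP]
  refine ContinuousLinearMap.ext fun x => ext_inner_left ℂ fun z => ?_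
  rw [mul_apply_eq_comp, mul_apply_eq_comp, ContinuousLinearMap.star_eq_adjoint,
    ContinuousLinearMap.adjoint_inner_right, inner_compression, inner_compression, h1, h1,
    inner_opTensor_left, ← mul_apply_eq_comp, ← mul_apply_eq_comp, opTensor_mul, opTensor_mul,
    mul_one, hy.star_mul, hn]
  have h3 : c ω x = opTensor 1 (fiberProj (n ω)) (c ω x) := by
    rw [← ContinuousLinearMap.comp_apply, hr]
  conv_rhs => rw [h3, ← mul_apply_eq_comp, opTensor_mul, one_mul, mul_one]

lemma apply_elem_eq_compression (hC : ∀ f φ, C (diagOp f φ) = opTensor 1 (diagOp f) (C φ))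
    (hCL : ∀ v, Y v = C.toContinuousLinearMap ∘L L v)
    (hY : ∀ (b : K →L[ℂ] K) (f : Lp ℂ ∞ ν) (v w : V),
      S (elem ν b f) v w = (Y v)† ∘L opTensor b (diagOp f) ∘L Y w)
    (b : K →L[ℂ] K) (f : Lp ℂ ∞ ν) (v w : V) : S (elem ν b f) v w =
      (L v)† ∘L (compression C.toContinuousLinearMap b * diagOp f) ∘L L w := by
  rw [hY]
  have h1 : ∀ f φ, C.toContinuousLinearMap (diagOp f φ) =
    opTensor 1 (diagOp f) (C.toContinuousLinearMap φ) := hC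
  refine ContinuousLinearMap.ext fun h => ext_inner_left ℂ fun h' => ?_
  rw [ContinuousLinearMap.comp_apply, ContinuousLinearMap.adjoint_inner_right,
    ContinuousLinearMap.comp_apply ((L v)†), ContinuousLinearMap.adjoint_inner_right, hCL, hCL,
    ContinuousLinearMap.comp_apply, ContinuousLinearMap.comp_apply, ContinuousLinearMap.comp_apply,
    ContinuousLinearMap.comp_apply, mul_apply_eq_comp, inner_compression, h1, ← mul_apply_eq_comp,
    opTensor_mul, mul_one, one_mul]

lemma IsCovariantNCP.isCPForm {hν : IsQuasiInvariant ν G} {s₁ : V → V → (H →L[ℂ] H)}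
    (hS : IsCovariantNCP hν u U s₁ S) : IsCPForm S := ⟨hS.sesquilinear, hS.cp⟩

/-- A formula for S on all b ⊗ f determines S, because normality extends it from these operators to
the whole algebra. -/
lemma IsCovariantNCP.eq_of_apply_elem [SigmaFinite ν] {hν : IsQuasiInvariant ν G}
    {s₁ : V → V → (H →L[ℂ] H)} {S S' : tensorVN ν K →ₗ[ℂ] (V → V → (H →L[ℂ] H))}
    (hS : IsCovariantNCP hν u U s₁ S) (hS' : IsCovariantNCP hν u U s₁ S')
    {Φ : (K →L[ℂ] K) → Lp ℂ ∞ ν → V → V → (H →L[ℂ] H)}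
    (h : ∀ b f v w, S (elem ν b f) v w = Φ b f v w)
    (h' : ∀ b f v w, S' (elem ν b f) v w = Φ b f v w) : S' = S :=
  eq_of_elem_eq hS'.isCPForm hS.isCPForm hS'.normal hS.normal fun b f =>
    funext fun v => funext fun w => (h' b f v w).trans (h b f v w).symm

end Factor

end

end CovariantCP

/-! ### Assembly of the theorem -/

set_option maxHeartbeats 1000000 in
open CovariantCP in
theorem mainTheorem12 {Ω H K V : Type u} {G : Type*}
    [MeasurableSpace Ω] (ν : Measure Ω) [SigmaFinite ν]
    [NormedAddCommGroup H] [InnerProductSpace ℂ H] [CompleteSpace H] [Nontrivial H]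
    [NormedAddCommGroup K] [InnerProductSpace ℂ K] [CompleteSpace K] [Nontrivial K]
    [TopologicalSpace.SeparableSpace K]
    [AddCommGroup V] [Module ℂ V] [Module (H →L[ℂ] H)ᵐᵒᵖ V] [IsScalarTower ℂ (H →L[ℂ] H)ᵐᵒᵖ V]
    [Group G] [MulAction G Ω] [MeasurableConstSMul G Ω] (hν : IsQuasiInvariant ν G)
    (m : G → G → Circle) (u : G → unitary (K →L[ℂ] K)) (hu : IsMultiplierRep m u)
    (U : G →* (V ≃ₗ[(H →L[ℂ] H)ᵐᵒᵖ] V)) (s₁ : V → V → (H →L[ℂ] H))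
    (S : tensorVN ν K →ₗ[ℂ] (V → V → (H →L[ℂ] H))) (hS : IsCovariantNCP hν u U s₁ S)
    (hsep : ∀ (H₀ : Type u) [NormedAddCommGroup H₀] [InnerProductSpace ℂ H₀] [CompleteSpace H₀]
      (F : SpectralMeasure Ω H₀) (Y₀ : V →ₗ[ℂ] (H →L[ℂ] HilbertTensor K H₀)),
      IsMinimalNaimarkDilation S F Y₀ → TopologicalSpace.SeparableSpace H₀) :
    -- the full map has a minimal covariant dilation into a direct integral
    (∃ (n : Ω → ℕ∞) (Y : V →ₗ[ℂ] (H →L[ℂ] HilbertTensor K (DirectIntegral ν n)))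
      (y : G → Ω → (Ell2 →L[ℂ] Ell2))
      (T : G → unitary (DirectIntegral ν n →L[ℂ] DirectIntegral ν n)),
      IsCovariantDilation m u U S n Y y T) ∧
    -- the second marginal has a minimal covariant dilation into a direct integral
    ∃ (n₀ : Ω → ℕ∞) (L : V →ₗ[ℂ] (H →L[ℂ] DirectIntegral ν n₀))
      (y₀ : G → Ω → (Ell2 →L[ℂ] Ell2))
      (T₀ : G →* unitary (DirectIntegral ν n₀ →L[ℂ] DirectIntegral ν n₀)),
      IsCovariantMarginalDilation U S n₀ L y₀ T₀ ∧
      -- every dilation of the full map factors through that of the second marginal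
      ∀ (n : Ω → ℕ∞) (Y : V →ₗ[ℂ] (H →L[ℂ] HilbertTensor K (DirectIntegral ν n)))
        (y : G → Ω → (Ell2 →L[ℂ] Ell2))
        (T : G → unitary (DirectIntegral ν n →L[ℂ] DirectIntegral ν n)),
        IsCovariantDilation m u U S n Y y T →
        ∃ (C : DirectIntegral ν n₀ →ₗᵢ[ℂ] HilbertTensor K (DirectIntegral ν n))
          (c : Ω → (Ell2 →L[ℂ] HilbertTensor K Ell2)),
          IsIsometryField ν n₀ n c ∧
          (∀ φ : DirectIntegral ν n₀, ∀ᵐ ω ∂ν, disintegrate (C φ) ω = c ω (φ ω)) ∧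
          (∀ v : V, Y v = C.toContinuousLinearMap ∘L L v) ∧
          (∀ g : G, ∀ᵐ ω ∂ν, c (g • ω) =
            opTensor (u g : K →L[ℂ] K) (y g (g • ω)) ∘L c ω ∘L star (y₀ g (g • ω))) ∧
          -- the channel `Φ(b) = C* (b ⊗ I) C` is covariant and decomposable
          IsChannel 1 (compression C.toContinuousLinearMap) ∧
          (∀ᵐ ω ∂ν, IsChannel (fiberProj (n₀ ω)) (compression (c ω))) ∧
          (∀ (b : K →L[ℂ] K) (φ : DirectIntegral ν n₀), ∀ᵐ ω ∂ν,
            compression C.toContinuousLinearMap b φ ω = compression (c ω) b (φ ω)) ∧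
          (∀ (b : K →L[ℂ] K) (f : Lp ℂ ∞ ν),
            Commute (compression C.toContinuousLinearMap b) (diagOp f)) ∧
          (∀ (g : G) (b : K →L[ℂ] K),
            star (T₀ g : DirectIntegral ν n₀ →L[ℂ] DirectIntegral ν n₀) *
                compression C.toContinuousLinearMap b * T₀ g =
              compression C.toContinuousLinearMap
                (star (u g : K →L[ℂ] K) * b * (u g : K →L[ℂ] K))) ∧
          (∀ g : G, ∀ᵐ ω ∂ν, ∀ b : K →L[ℂ] K,
            star (y₀ g (g • ω)) * compression (c (g • ω)) b * y₀ g (g • ω) =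
              compression (c ω) (star (u g : K →L[ℂ] K) * b * (u g : K →L[ℂ] K))) ∧
          -- `S` is recovered from `L` and `Φ`, and is the only such normal CP map
          (∀ (b : K →L[ℂ] K) (f : Lp ℂ ∞ ν) (v w : V), S (elem ν b f) v w =
            (L v)† ∘L (compression C.toContinuousLinearMap b * diagOp f) ∘L L w) ∧
          (∀ S' : tensorVN ν K →ₗ[ℂ] (V → V → (H →L[ℂ] H)), IsCovariantNCP hν u U s₁ S' →
            (∀ (b : K →L[ℂ] K) (f : Lp ℂ ∞ ν) (v w : V), S' (elem ν b f) v w =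
              (L v)† ∘L (compression C.toContinuousLinearMap b * diagOp f) ∘L L w) →
            S' = S) := by
  obtain ⟨n, hn, hsepn, Y, hY⟩ := exists_isDilation_directIntegral hS.isCPForm hS.normal hsep
  refine ⟨?_, ?_⟩
  · obtain ⟨y, T, hT⟩ := exists_isCovariantDilation hu hS hn.aemeasurable hY
    exact ⟨n, Y, y, T, hT⟩
  obtain ⟨n₀, hn₀, L, hL⟩ := exists_isMarginalDilation hY
  obtain ⟨y₀, T₀, hL'⟩ := exists_isCovariantMarginalDilation hS hn₀.aemeasurable hL
  -- From here on Y is an arbitrary dilation of S, not the one from which the marginal dilation L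
  -- was built.
  refine ⟨n₀, L, y₀, T₀, hL', fun n Y y T hY => ?_⟩
  obtain ⟨C, hC, hCL, hCT⟩ := exists_factorization hν hL hL' hY
  obtain ⟨c, hc, hcP, hcC⟩ := exists_factorization_field hn₀.aemeasurable hC
  have hcov := fun g => ae_factorization_covariant hν hL' hY hcP hcC g (hCT g)
  have hSC := apply_elem_eq_compression hC hCL hY.dilates
  refine ⟨C, c, hc, hcC, hCL, hcov, ?_, ?_, compression_apply_ae hn₀.aemeasurable hC hcP hcC,
    commute_compression hC, fun g b => compression_covariant g (hCT g) b, fun g => ?_, hSC,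
    fun S' hS' h => hS.eq_of_apply_elem hS' hSC h⟩
  · refine isChannel_compression _ (ContinuousLinearMap.ext fun φ => ext_inner_left ℂ fun ψ => ?_)
    rw [ContinuousLinearMap.comp_apply, ContinuousLinearMap.adjoint_inner_right]
    exact C.inner_map_map ψ φ
  · filter_upwards [hc.isometry] with ω h using isChannel_compression _ h
  -- The exceptional null sets come from the fields alone, so one of them serves all b.
  · filter_upwards [hcov g, hY.invariant g, hL'.invariant g, hc.range] with ω h1 h2 h3 h4 b
    exact compression_field_covariant hcP h2 h3 (hY.unitaryField g) (hL'.unitaryField g) h4 h1 b
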